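/- Let $M\in\mathbb R$, $F(r)=1-2M/r^2$, and consider the five-dimensional Schwarzschild metric $g=-F\,dt^2+F^{-1}dr^2+r^2\gamma_{ij}dz^idz^j$ on $\{r>0,\ F(r)\neq 0\}$, where $y^a=(t,r)$, $z^i$ are positively oriented local coordinates on the unit sphere $S^3\subset\mathbb R^4$ and $\gamma$ is its round metric, with Levi-Civita connection $\hat D$, Laplacian $\hat\triangle=\hat D^i\hat D_i$ and volume form $\hat\varepsilon_{ijk}$; sphere indices are raised with $\gamma$. Let $f$ be the 3-form with $f_{ijk}=r^4\hat\varepsilon_{ijk}$ and all other components zero (a Killing–Yano form), and for a symmetric tensor $h$ put $$Z_{\lambda\rho}[h]=2f_{(\lambda}{}^{\kappa\tau}\nabla_{|\kappa|}h_{\rho)\tau},$$ with $\nabla$ the Levi-Civita connection of $g$ and symmetrization of weight one. For covectors and symmetric 2-tensors on $S^3$ put $(\hat{\mathcal S}V)_i=\hat\varepsilon_i{}^{kl}\hat D_kV_l$ and $(\hat{\mathcal S}T)_{ij}=2\hat\varepsilon_{(i}{}^{kl}\hat D_{|k|}T_{j)l}$. All fields are smooth and complex valued; no field equation is imposed. **(1)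 Components.** For every symmetric $h$: $Z_{ab}=0$, $Z_{ai}=\hat\varepsilon_i{}^{kl}\hat D_kh_{al}$, $Z_{ij}=2\hat\varepsilon_{(i}{}^{kl}\hat D_{|k|}h_{j)l}$; and $\hat{\mathcal S}V=\hat\star\hat dV$ for covectors $V$. **(2) Pieces.** Write $h$ as a sum of pieces: $h_{ab}$, $h_{ai}=\hat D_ih_a+h_{T\,ai}$, $h_{ij}=h_{T\,ij}+2\hat D_{(i}h_{T\,j)}+h_L\gamma_{ij}+\hat L_{ij}h_T$, where $\hat L_{ij}=\hat D_i\hat D_j-\frac13\gamma_{ij}\hat\triangle$, $\hat D^ih_{T\,ai}=0$, $\hat D^ih_{T\,i}=0$, and $h_{T\,ij}$ is symmetric with $\hat D^ih_{T\,ij}=0$, $h_T{}^i{}_i=0$. Then (over any coordinate patch of $S^3$) the scalar pieces $h_{ab},h_a,h_L,h_T$ contribute nothing to $Z$, and $Z$ has a decomposition of the same kind with pieces $Z_{ab}=0$, $Z_a=Z_L=Z_T=0$ and $$Z_{T\,ai}=\hat\varepsilon_i{}^{kl}\hat D_kh_{T\,al},\qquad Z_{T\,j}=\hat\varepsilon_j{}^{kl}\hat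 D_kh_{T\,l},\qquad Z_{T\,ij}=2\hat\varepsilon_{(i}{}^{kl}\hat D_{|k|}h_{T\,j)l};$$ in particular these are again transverse, respectively transverse and traceless. Moreover, when the pieces are defined on all of $S^3$, every such decomposition of $Z$ over all of $S^3$ is this one up to the kernels of the differential operators in the decomposition: $Z_{ab}=0$, $\hat D_iZ_a=0$, $Z_L=0$, $\hat L_{ij}Z_T=0$, $Z_{T\,ai}$ and $Z_{T\,ij}$ are as displayed, and $\hat D_{(i}Z_{T\,j)}=\hat D_{(i}(\hat{\mathcal S}h_T)_{j)}$. **(3) Modes.** Let $\lambda_s,\lambda_v\ne0$ be real. If $(\hat\triangle+\lambda_s^2)\mathbb S=0$, the scalar mode $h_{ab}=f_{ab}\mathbb S$ ($f_{ab}=f_{ba}$), $h_{ai}=-\frac{r}{\lambda_s}f_a\hat D_i\mathbb S$, $h_{ij}=2r^2\{H_L\gamma_{ij}\mathbb S+H_T(\lambda_s^{-2}\hat D_i\hat D_j\mathbb S+\frac13\gamma_{ij}\mathbb S)\}$ has $Z=0$. If $\hat D^i\mathbb V_i=0$ (for instance a vector harmonic, $(\hat\triangle+\lambda_v^2)\mathbb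 V_i=0$), the mode $h_{ai}=rf_a\mathbb V_i$, $h_{ij}=-\frac{2r^2}{\lambda_v}H_T\hat D_{(i}\mathbb V_{j)}$, $h_{ab}=0$, is mapped to the tensor with only the pieces $Z_{T\,ai}=rf_a(\hat{\mathcal S}\mathbb V)_i$, $Z_{T\,j}=-\frac{r^2}{\lambda_v}H_T(\hat{\mathcal S}\mathbb V)_j$. If $\mathbb T_{ij}$ is symmetric, transverse and traceless, the mode $h_{ij}=2r^2H_T\mathbb T_{ij}$, $h_{ab}=h_{ai}=0$, is mapped to the one with only the piece $Z_{T\,ij}=2r^2H_T(\hat{\mathcal S}\mathbb T)_{ij}$. Here $f_{ab},f_a,H_L,H_T$ are functions of $y$. **(4) Harmonic classes.** Let $(\chi,\vartheta,\varphi)$ be hyperspherical coordinates, $0<\chi,\vartheta<\pi$, let $k\ge\ell\ge|m|$ be integers and $\mathbb S=H(\chi)Y(\vartheta,\varphi)$, $H=\sin^\ell\!\chi\,C$, $Y=e^{-im\varphi}\Theta(\vartheta)$, where $C$, a function of $x=\cos\chi\in(-1,1)$, and $\Theta$ on $(0,\pi)$ are smooth, not identically zero and satisfy $$(1-x^2)C''-(2\ell+3)xC'+[k(k+2)-\ell(\ell+2)]C=0,\quad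 \sin\vartheta\tfrac{d}{d\vartheta}\big(\sin\vartheta\tfrac{d\Theta}{d\vartheta}\big)+[\ell(\ell+1)\sin^2\vartheta-m^2]\Theta=0.$$ Define $$\mathbb V^{(0)}_i=\tfrac{\hat D_i\mathbb S}{\sqrt{k(k+2)}},\quad \mathbb V^{(1)}_i=\tfrac{\hat\varepsilon_i{}^{jk}\hat D_j\mathbb S\,\hat D_k\cos\chi}{\sqrt{\ell(\ell+1)}},\quad \mathbb V^{(2)}_i=\tfrac{1}{k+1}\hat\varepsilon_i{}^{jk}\hat D_j\mathbb V^{(1)}_k,$$ $$\mathbb T^{(0)}_{ij}=\tfrac{1}{\sqrt3}\mathbb S\gamma_{ij},\quad \mathbb T^{(1),(2)}_{ij}=\tfrac{2}{\sqrt{2(k-1)(k+3)}}\hat D_{(i}\mathbb V^{(1),(2)}_{j)},\quad \mathbb T^{(3)}_{ij}=\tfrac{\sqrt3}{\sqrt{2(k-1)(k+3)}}\Big(\hat D_i\mathbb V^{(0)}_j+\tfrac{\sqrt{k(k+2)}}{\sqrt3}\mathbb T^{(0)}_{ij}\Big),$$ $$\mathbb T^{(4)}_{ij}=\sqrt{\tfrac{(\ell-1)(\ell+2)}{2k(k+2)}}\Big\{E\,\hat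 D_{(i}F_{j)}+2\csc^2\!\chi\big[\tfrac{\ell-1}{2}\cos\chi\,E+C\big]F_{(i}\hat D_{j)}\cos\chi\Big\},\quad \mathbb T^{(5)}_{ij}=\tfrac{1}{k+1}\hat\varepsilon_{(i}{}^{kl}\hat D_{|k|}\mathbb T^{(4)}_{j)l},$$ $$E=-\tfrac{2\csc^{\ell+1}\chi}{(\ell-1)(\ell+2)}\tfrac{d}{d\chi}(\sin^2\!\chi\,H),\qquad F_a=\tfrac{1}{\sqrt{\ell(\ell+1)}}\hat\varepsilon_a{}^{bc}\hat D_b(\sin^\ell\!\chi\,Y)\hat D_c\cos\chi .$$ (In the degenerate cases where a normalizing factor is singular or imaginary — $k=0$ for $\mathbb V^{(0)}$, $\ell=0$ for $\mathbb V^{(1)},\mathbb V^{(2)}$, $k\le1$ for $\mathbb T^{(1)},\mathbb T^{(2)},\mathbb T^{(3)}$, $\ell\le1$ for $\mathbb T^{(4)},\mathbb T^{(5)}$ — the field in question is understood to be zero.) Then on the coordinate domain $$\hat{\mathcal S}\mathbb V^{(0)}=0,\quad \hat{\mathcal S}\mathbb V^{(1)}=(k+1)\mathbb V^{(2)},\quad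 \hat{\mathcal S}\mathbb V^{(2)}=(k+1)\mathbb V^{(1)},$$ $$\hat{\mathcal S}\mathbb T^{(0)}=\hat{\mathcal S}\mathbb T^{(3)}=0,\quad \hat{\mathcal S}\mathbb T^{(1)}=(k+1)\mathbb T^{(2)},\quad \hat{\mathcal S}\mathbb T^{(2)}=(k+1)\mathbb T^{(1)},$$ $$\hat{\mathcal S}\mathbb T^{(4)}=2(k+1)\mathbb T^{(5)},\quad \hat{\mathcal S}\mathbb T^{(5)}=2(k+1)\mathbb T^{(4)} .$$ Consequently $\mathbb V^{(1)}\pm\mathbb V^{(2)}$ and $\mathbb T^{(1)}\pm\mathbb T^{(2)}$ satisfy $\hat{\mathcal S}X=\pm(k+1)X$ and $\mathbb T^{(4)}\pm\mathbb T^{(5)}$ satisfy $\hat{\mathcal S}X=\pm2(k+1)X$; they are not identically zero (hence eigenvectors, respectively eigentensors) when $\ell\ge1$, when $\ell\ge1$ and $k\ge2$, and when $\ell\ge2$, respectively. -/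

import Mathlib

open scoped ContDiff

noncomputable section

namespace SchwKY

/-! ## Tensor calculus in a coordinate chart

Coordinates are points of `ι → ℝ`.  A metric is a matrix-valued function of the coordinates, and a
covariant tensor field is given by its (possibly complex) components.  -/

section Calculus

variable {ι : Type} [Fintype ι] [DecidableEq ι] {E : Type} [NormedAddCommGroup E] [NormedSpace ℝ E]

/-- The partial derivative `∂_i f`. -/
def pd (i : ι) (f : (ι → ℝ) → E) (x : ι → ℝ) : E := fderiv ℝ f x (Pi.single i 1)

/-- The Christoffel symbol `Γ^k_{ij}` of the Levi-Civita connection of the metric `G`. -/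
def christoffel (G : (ι → ℝ) → Matrix ι ι ℝ) (x : ι → ℝ) (k i j : ι) : ℝ :=
  (1 / 2) * ∑ l, (G x)⁻¹ k l *
    (pd i (fun x => G x l j) x + pd j (fun x => G x l i) x - pd l (fun x => G x i j) x)

/-- The covariant derivative `D_k w_i` of a covector field. -/
def cov1 (G : (ι → ℝ) → Matrix ι ι ℝ) (w : (ι → ℝ) → ι → ℂ) (x : ι → ℝ) (k i : ι) : ℂ :=
  pd k (fun x => w x i) x - ∑ m, christoffel G x m k i • w x m

/-- The covariant derivative `D_k T_{ij}` of a covariant 2-tensor field. -/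
def cov2 (G : (ι → ℝ) → Matrix ι ι ℝ) (T : (ι → ℝ) → ι → ι → ℂ) (x : ι → ℝ) (k i j : ι) : ℂ :=
  pd k (fun x => T x i j) x - ∑ m, christoffel G x m k i • T x m j
    - ∑ m, christoffel G x m k j • T x i m

/-- The gradient `D_i φ` of a scalar. -/
def grad (φ : (ι → ℝ) → ℂ) (x : ι → ℝ) (i : ι) : ℂ := pd i φ x

/-- `D_i D_j φ`. -/
def hess (G : (ι → ℝ) → Matrix ι ι ℝ) (φ : (ι → ℝ) → ℂ) (x : ι → ℝ) (i j : ι) : ℂ :=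
  cov1 G (grad φ) x i j

/-- `△ φ = D^i D_i φ`. -/
def lap (G : (ι → ℝ) → Matrix ι ι ℝ) (φ : (ι → ℝ) → ℂ) (x : ι → ℝ) : ℂ :=
  ∑ i, ∑ j, (G x)⁻¹ i j • hess G φ x i j

/-- `D^i w_i`. -/
def div1 (G : (ι → ℝ) → Matrix ι ι ℝ) (w : (ι → ℝ) → ι → ℂ) (x : ι → ℝ) : ℂ :=
  ∑ i, ∑ j, (G x)⁻¹ i j • cov1 G w x i j

/-- `D^i T_{ij}`. -/
def div2 (G : (ι → ℝ) → Matrix ι ι ℝ) (T : (ι → ℝ) → ι → ι → ℂ) (x : ι → ℝ) (j : ι) : ℂ :=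
  ∑ i, ∑ k, (G x)⁻¹ i k • cov2 G T x i k j

/-- `T^i_i`. -/
def trace2 (G : (ι → ℝ) → Matrix ι ι ℝ) (T : (ι → ℝ) → ι → ι → ℂ) (x : ι → ℝ) : ℂ :=
  ∑ i, ∑ j, (G x)⁻¹ i j • T x i j

/-- `D_{(i} w_{j)}`, with the symmetrization of weight one. -/
def symGrad (G : (ι → ℝ) → Matrix ι ι ℝ) (w : (ι → ℝ) → ι → ℂ) (x : ι → ℝ) (i j : ι) : ℂ :=
  (1 / 2 : ℝ) • (cov1 G w x i j + cov1 G w x j i)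

end Calculus

/-! ## Three-dimensional operators -/

/-- `L_{ij} φ = D_i D_j φ - (1/3) γ_{ij} △ φ` in dimension three. -/
def Lop (G : (Fin 3 → ℝ) → Matrix (Fin 3) (Fin 3) ℝ) (φ : (Fin 3 → ℝ) → ℂ) (z : Fin 3 → ℝ)
    (i j : Fin 3) : ℂ :=
  hess G φ z i j - ((1 / 3 : ℝ) * G z i j) • lap G φ z

/-- The totally antisymmetric symbol with `leviCivita 0 1 2 = 1`. -/
def leviCivita (i j k : Fin 3) : ℝ :=
  (((j : ℕ) : ℝ) - ((i : ℕ) : ℝ)) * (((k : ℕ) : ℝ) - ((i : ℕ) : ℝ)) *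
    (((k : ℕ) : ℝ) - ((j : ℕ) : ℝ)) / 2

/-- The volume form `ε_{ijk}` of the metric `G`, in positively oriented coordinates. -/
def vol (G : (Fin 3 → ℝ) → Matrix (Fin 3) (Fin 3) ℝ) (z : Fin 3 → ℝ) (i j k : Fin 3) : ℝ :=
  Real.sqrt (G z).det * leviCivita i j k

/-- `ε_i^{kl}`. -/
def volUp (G : (Fin 3 → ℝ) → Matrix (Fin 3) (Fin 3) ℝ) (z : Fin 3 → ℝ) (i k l : Fin 3) : ℝ :=
  ∑ k', ∑ l', vol G z i k' l' * (G z)⁻¹ k' k * (G z)⁻¹ l' l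

/-- `ε_i^{kl} D_k w_l`: the operator `Ŝ` on covector fields. -/
def curl (G : (Fin 3 → ℝ) → Matrix (Fin 3) (Fin 3) ℝ) (w : (Fin 3 → ℝ) → Fin 3 → ℂ)
    (z : Fin 3 → ℝ) (i : Fin 3) : ℂ :=
  ∑ k, ∑ l, volUp G z i k l • cov1 G w z k l

/-- `2 ε_{(i}^{kl} D_{|k|} T_{j)l}`: the operator `Ŝ` on 2-tensor fields. -/
def symCurl (G : (Fin 3 → ℝ) → Matrix (Fin 3) (Fin 3) ℝ) (T : (Fin 3 → ℝ) → Fin 3 → Fin 3 → ℂ)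
    (z : Fin 3 → ℝ) (i j : Fin 3) : ℂ :=
  ∑ k, ∑ l, (volUp G z i k l • cov2 G T z k j l + volUp G z j k l • cov2 G T z k i l)

/-- The exterior derivative `(dw)_{kl} = ∂_k w_l - ∂_l w_k` of a 1-form. -/
def extD (w : (Fin 3 → ℝ) → Fin 3 → ℂ) (z : Fin 3 → ℝ) (k l : Fin 3) : ℂ :=
  pd k (fun z => w z l) z - pd l (fun z => w z k) z

/-- The Hodge star `(⋆α)_i = (1/2) ε_i^{kl} α_{kl}` of a 2-form. -/
def hodge (G : (Fin 3 → ℝ) → Matrix (Fin 3) (Fin 3) ℝ) (α : (Fin 3 → ℝ) → Fin 3 → Fin 3 → ℂ)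
    (z : Fin 3 → ℝ) (i : Fin 3) : ℂ :=
  (1 / 2 : ℝ) • ∑ k, ∑ l, volUp G z i k l • α z k l

/-! ## The unit 3-sphere -/

/-- A positively oriented smooth local parametrization of the unit sphere `S³ ⊂ ℝ⁴`.  The
orientation of `S³` is the one of the outward normal. -/
structure S3Chart where
  /-- the coordinate domain -/
  dom : Set (Fin 3 → ℝ)
  /-- the point of `S³ ⊂ ℝ⁴` with the given coordinates -/
  emb : (Fin 3 → ℝ) → Fin 4 → ℝ
  isOpen_dom : IsOpen dom
  contDiff : ContDiffOn ℝ ∞ emb dom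
  unit : ∀ z ∈ dom, ∑ A, emb z A ^ 2 = 1
  oriented : ∀ z ∈ dom,
    0 < (Matrix.of ![emb z, pd 0 emb z, pd 1 emb z, pd 2 emb z]).det

/-- The round metric `γ_{ij}` of the unit 3-sphere in a chart. -/
def S3Chart.metric (c : S3Chart) (z : Fin 3 → ℝ) : Matrix (Fin 3) (Fin 3) ℝ :=
  Matrix.of fun i j => ∑ A, pd i c.emb z A * pd j c.emb z A

/-! ## The five-dimensional Schwarzschild spacetime

The spacetime coordinates are `x = (y, z)`, with `y = (t, r)` (left summand) and `z` the
coordinates of a chart of the 3-sphere (right summand). -/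

/-- Spacetime indices. -/
abbrev Idx5 : Type := Fin 2 ⊕ Fin 3

/-- The coordinates `y = (t, r)` of a point. -/
def yOf (x : Idx5 → ℝ) : Fin 2 → ℝ := fun a => x (Sum.inl a)

/-- The sphere coordinates of a point. -/
def zOf (x : Idx5 → ℝ) : Fin 3 → ℝ := fun i => x (Sum.inr i)

/-- `F(r) = 1 - 2M/r²`. -/
def schwF (M r : ℝ) : ℝ := 1 - 2 * M / r ^ 2

/-- The range of `y = (t, r)`: everything away from the singularity and the horizon. -/
def regionY (M : ℝ) : Set (Fin 2 → ℝ) := {y | 0 < y 1 ∧ schwF M (y 1) ≠ 0}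

/-- The coordinate domain of the spacetime over a chart of the sphere. -/
def region (M : ℝ) (c : S3Chart) : Set (Idx5 → ℝ) :=
  {x | yOf x ∈ regionY M ∧ zOf x ∈ c.dom}

/-- `g = -F dt² + F⁻¹ dr² + r² γ`. -/
def schwMetric (M : ℝ) (c : S3Chart) (x : Idx5 → ℝ) : Matrix Idx5 Idx5 ℝ :=
  Matrix.fromBlocks
    !![-schwF M (x (Sum.inl 1)), 0; 0, (schwF M (x (Sum.inl 1)))⁻¹] 0 0
    (x (Sum.inl 1) ^ 2 • c.metric (zOf x))

/-- The Killing–Yano 3-form: `f_{ijk} = r⁴ ε̂_{ijk}`, all other components being zero. -/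
def kyForm (c : S3Chart) (x : Idx5 → ℝ) : Idx5 → Idx5 → Idx5 → ℝ
  | Sum.inr i, Sum.inr j, Sum.inr k =>
      x (Sum.inl 1) ^ 4 * vol c.metric (zOf x) i j k
  | _, _, _ => 0

/-- `f_λ^{κτ}`, the indices being raised with the spacetime metric. -/
def kyUp (M : ℝ) (c : S3Chart) (x : Idx5 → ℝ) (l κ τ : Idx5) : ℝ :=
  ∑ κ', ∑ τ', kyForm c x l κ' τ' * (schwMetric M c x)⁻¹ κ' κ * (schwMetric M c x)⁻¹ τ' τ

/-- The symmetry operator `Z_{λρ} = 2 f_{(λ}^{κτ} ∇_{|κ|} h_{ρ)τ}`. -/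
def Zop (M : ℝ) (c : S3Chart) (h : (Idx5 → ℝ) → Idx5 → Idx5 → ℂ) (x : Idx5 → ℝ) (l ρ : Idx5) : ℂ :=
  ∑ κ, ∑ τ, (kyUp M c x l κ τ • cov2 (schwMetric M c) h x κ ρ τ
    + kyUp M c x ρ κ τ • cov2 (schwMetric M c) h x κ l τ)

/-- The symmetric spacetime tensor with components `A_{ab}`, `B_{ai} = B_{ia}` and `C_{ij}`. -/
def blocks (A : Fin 2 → Fin 2 → ℂ) (B : Fin 2 → Fin 3 → ℂ) (C : Fin 3 → Fin 3 → ℂ) :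
    Idx5 → Idx5 → ℂ
  | Sum.inl a, Sum.inl b => A a b
  | Sum.inl a, Sum.inr i => B a i
  | Sum.inr i, Sum.inl a => B a i
  | Sum.inr i, Sum.inr j => C i j

/-! ## Scalar, vector and tensor pieces of a symmetric 2-tensor -/

/-- The pieces `h_{ab}, h_a, h_L, h_T` (scalar type), `h_{T ai}, h_{T i}` (vector type) and
`h_{T ij}` (tensor type), as functions of `y` and of a point `z`.  With `ι = Fin 3` these are
components in a chart of `S³`; with `ι = Fin 4` they are components of tensor fields on
`ℝ⁴ ∖ {0} ⊃ S³`, to be pulled back to the sphere. -/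
structure Pieces (ι : Type) where
  ab : (Fin 2 → ℝ) → (ι → ℝ) → Fin 2 → Fin 2 → ℂ
  sa : (Fin 2 → ℝ) → (ι → ℝ) → Fin 2 → ℂ
  sL : (Fin 2 → ℝ) → (ι → ℝ) → ℂ
  sT : (Fin 2 → ℝ) → (ι → ℝ) → ℂ
  va : (Fin 2 → ℝ) → (ι → ℝ) → Fin 2 → ι → ℂ
  vi : (Fin 2 → ℝ) → (ι → ℝ) → ι → ℂ
  tij : (Fin 2 → ℝ) → (ι → ℝ) → ι → ι → ℂ

namespace Pieces

/-- All pieces are smooth on `s`. -/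
def SmoothOn {ι : Type} [Fintype ι] (p : Pieces ι) (s : Set ((Fin 2 → ℝ) × (ι → ℝ))) : Prop :=
  ContDiffOn ℝ ∞ (fun q => p.ab q.1 q.2) s ∧ ContDiffOn ℝ ∞ (fun q => p.sa q.1 q.2) s ∧
  ContDiffOn ℝ ∞ (fun q => p.sL q.1 q.2) s ∧ ContDiffOn ℝ ∞ (fun q => p.sT q.1 q.2) s ∧
  ContDiffOn ℝ ∞ (fun q => p.va q.1 q.2) s ∧ ContDiffOn ℝ ∞ (fun q => p.vi q.1 q.2) s ∧
  ContDiffOn ℝ ∞ (fun q => p.tij q.1 q.2) s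

/-- The pieces are smooth, `h_{ab}` and `h_{T ij}` are symmetric, the vector pieces are transverse,
and the tensor piece is transverse and traceless, in the chart `c`. -/
def Admissible (M : ℝ) (c : S3Chart) (p : Pieces (Fin 3)) : Prop :=
  p.SmoothOn (regionY M ×ˢ c.dom) ∧
  ∀ y ∈ regionY M, ∀ z ∈ c.dom,
    (∀ a b, p.ab y z a b = p.ab y z b a) ∧
    (∀ i j, p.tij y z i j = p.tij y z j i) ∧
    (∀ a, div1 c.metric (fun z => p.va y z a) z = 0) ∧
    div1 c.metric (p.vi y) z = 0 ∧
    (∀ j, div2 c.metric (p.tij y) z j = 0) ∧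
    trace2 c.metric (p.tij y) z = 0

/-- The symmetric tensor with the given pieces: `h_{ab}`, `h_{ai} = D_i h_a + h_{T ai}` and
`h_{ij} = h_{T ij} + 2 D_{(i} h_{T j)} + h_L γ_{ij} + L_{ij} h_T`. -/
def toTensor (c : S3Chart) (p : Pieces (Fin 3)) (x : Idx5 → ℝ) : Idx5 → Idx5 → ℂ :=
  blocks (p.ab (yOf x) (zOf x))
    (fun a i => grad (fun z => p.sa (yOf x) z a) (zOf x) i + p.va (yOf x) (zOf x) a i)
    (fun i j => p.tij (yOf x) (zOf x) i j
      + (2 : ℝ) • symGrad c.metric (p.vi (yOf x)) (zOf x) i j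
      + c.metric (zOf x) i j • p.sL (yOf x) (zOf x)
      + Lop c.metric (p.sT (yOf x)) (zOf x) i j)

/-- The pull-back to a chart of the sphere of tensor fields given on `ℝ⁴ ∖ {0}`. -/
def pull (c : S3Chart) (p : Pieces (Fin 4)) : Pieces (Fin 3) where
  ab y z := p.ab y (c.emb z)
  sa y z := p.sa y (c.emb z)
  sL y z := p.sL y (c.emb z)
  sT y z := p.sT y (c.emb z)
  va y z a i := ∑ A, pd i c.emb z A • p.va y (c.emb z) a A
  vi y z i := ∑ A, pd i c.emb z A • p.vi y (c.emb z) A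
  tij y z i j := ∑ A, ∑ B, (pd i c.emb z A * pd j c.emb z B) • p.tij y (c.emb z) A B

/-- Pieces defined on the whole sphere, with the required properties in every chart. -/
def GlobAdmissible (M : ℝ) (p : Pieces (Fin 4)) : Prop :=
  p.SmoothOn (regionY M ×ˢ {n | n ≠ 0}) ∧ ∀ c : S3Chart, (p.pull c).Admissible M c

/-- The pieces of scalar type alone. -/
def scalarPart (p : Pieces (Fin 3)) : Pieces (Fin 3) where
  ab := p.ab
  sa := p.sa
  sL := p.sL
  sT := p.sT
  va _ _ _ _ := 0
  vi _ _ _ := 0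
  tij _ _ _ _ := 0

/-- Pieces without scalar contributions. -/
def ofVT (va : (Fin 2 → ℝ) → (Fin 3 → ℝ) → Fin 2 → Fin 3 → ℂ)
    (vi : (Fin 2 → ℝ) → (Fin 3 → ℝ) → Fin 3 → ℂ)
    (tij : (Fin 2 → ℝ) → (Fin 3 → ℝ) → Fin 3 → Fin 3 → ℂ) : Pieces (Fin 3) where
  ab _ _ _ _ := 0
  sa _ _ _ := 0
  sL _ _ := 0
  sT _ _ := 0
  va := va
  vi := vi
  tij := tij

/-- The pieces obtained by removing the scalar pieces and letting `Ŝ` act on the vector and tensor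
pieces. -/
def image (c : S3Chart) (p : Pieces (Fin 3)) : Pieces (Fin 3) :=
  ofVT (fun y z a i => curl c.metric (fun z => p.va y z a) z i)
    (fun y z i => curl c.metric (p.vi y) z i)
    (fun y z i j => symCurl c.metric (p.tij y) z i j)

end Pieces

/-! ## Modes

Here `S`, `V`, `T` are a scalar, vector and tensor harmonic and `ev` is the root of the eigenvalue,
`(△ + ev²) S = 0` or `(△ + ev²) V = 0`. -/

/-- `h_{ab} = f_{ab} S`, `h_{ai} = r f_a S_i`, `h_{ij} = 2 r² (H_L γ_{ij} S + H_T S_{ij})`, where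
`S_i = -(1/ev) D_i S` and `S_{ij} = (1/ev²) D_i D_j S + (1/3) γ_{ij} S`. -/
def scalarMode (c : S3Chart) (ev : ℝ) (S : (Fin 3 → ℝ) → ℂ)
    (fab : (Fin 2 → ℝ) → Fin 2 → Fin 2 → ℂ) (fa : (Fin 2 → ℝ) → Fin 2 → ℂ)
    (HL HT : (Fin 2 → ℝ) → ℂ) (x : Idx5 → ℝ) : Idx5 → Idx5 → ℂ :=
  blocks (fun a b => fab (yOf x) a b * S (zOf x))
    (fun a i => yOf x 1 • (fa (yOf x) a * ((-(1 / ev)) • grad S (zOf x) i)))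
    (fun i j => (2 * yOf x 1 ^ 2) • (HL (yOf x) * (c.metric (zOf x) i j • S (zOf x))
      + HT (yOf x) * ((1 / ev ^ 2) • hess c.metric S (zOf x) i j
        + (1 / 3 * c.metric (zOf x) i j) • S (zOf x))))

/-- `h_{ai} = r f_a V_i`, `h_{ij} = 2 r² H_T V_{ij}`, where `V_{ij} = -(1/ev) D_{(i} V_{j)}`. -/
def vectorMode (c : S3Chart) (ev : ℝ) (V : (Fin 3 → ℝ) → Fin 3 → ℂ)
    (fa : (Fin 2 → ℝ) → Fin 2 → ℂ) (HT : (Fin 2 → ℝ) → ℂ) (x : Idx5 → ℝ) : Idx5 → Idx5 → ℂ :=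
  blocks (fun _ _ => 0) (fun a i => yOf x 1 • (fa (yOf x) a * V (zOf x) i))
    (fun i j => (2 * yOf x 1 ^ 2) •
      (HT (yOf x) * ((-(1 / ev)) • symGrad c.metric V (zOf x) i j)))

/-- `h_{ij} = 2 r² H_T T_{ij}`. -/
def tensorMode (T : (Fin 3 → ℝ) → Fin 3 → Fin 3 → ℂ) (HT : (Fin 2 → ℝ) → ℂ) (x : Idx5 → ℝ) :
    Idx5 → Idx5 → ℂ :=
  blocks (fun _ _ => 0) (fun _ _ => 0)
    (fun i j => (2 * yOf x 1 ^ 2) • (HT (yOf x) * T (zOf x) i j))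

/-! ## Hyperspherical coordinates and the classes of harmonics -/

/-- The point of `S³` with hyperspherical coordinates `(χ, ϑ, φ)`. -/
def hyperEmb (z : Fin 3 → ℝ) : Fin 4 → ℝ :=
  ![Real.cos (z 0), Real.sin (z 0) * (Real.sin (z 1) * Real.cos (z 2)),
    Real.sin (z 0) * (Real.sin (z 1) * Real.sin (z 2)), Real.sin (z 0) * Real.cos (z 1)]

/-- The domain `0 < χ < π`, `0 < ϑ < π`. -/
def hyperDom : Set (Fin 3 → ℝ) := {z | z 0 ∈ Set.Ioo 0 Real.pi ∧ z 1 ∈ Set.Ioo 0 Real.pi}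

lemma isOpen_hyperDom : IsOpen hyperDom :=
  (isOpen_Ioo.preimage (continuous_apply (0 : Fin 3))).inter
    (isOpen_Ioo.preimage (continuous_apply (1 : Fin 3)))

lemma contDiff_hyperEmb : ContDiff ℝ ∞ hyperEmb := by
  rw [contDiff_pi]
  intro A
  fin_cases A <;> simp [hyperEmb] <;> fun_prop

lemma hyperEmb_unit (z : Fin 3 → ℝ) : ∑ A, hyperEmb z A ^ 2 = 1 := by
  simp only [Fin.sum_univ_four, hyperEmb, Matrix.cons_val]
  linear_combination (Real.sin (z 0)) ^ 2 * (Real.sin (z 1)) ^ 2 * Real.sin_sq_add_cos_sq (z 2)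
    + (Real.sin (z 0)) ^ 2 * Real.sin_sq_add_cos_sq (z 1) + Real.sin_sq_add_cos_sq (z 0)

lemma hasFDerivAt_apply' (i : Fin 3) (z : Fin 3 → ℝ) :
    HasFDerivAt (fun z : Fin 3 → ℝ => z i) (ContinuousLinearMap.proj i : (Fin 3 → ℝ) →L[ℝ] ℝ) z :=
  hasFDerivAt_apply i z

lemma pd_hyperEmb (z : Fin 3 → ℝ) (i : Fin 3) :
    pd i hyperEmb z =
      ![![-Real.sin (z 0), Real.cos (z 0) * (Real.sin (z 1) * Real.cos (z 2)),
          Real.cos (z 0) * (Real.sin (z 1) * Real.sin (z 2)), Real.cos (z 0) * Real.cos (z 1)],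
        ![0, Real.sin (z 0) * (Real.cos (z 1) * Real.cos (z 2)),
          Real.sin (z 0) * (Real.cos (z 1) * Real.sin (z 2)), -(Real.sin (z 0) * Real.sin (z 1))],
        ![0, -(Real.sin (z 0) * (Real.sin (z 1) * Real.sin (z 2))),
          Real.sin (z 0) * (Real.sin (z 1) * Real.cos (z 2)), 0]] i := by
  have h0 := hasFDerivAt_apply' 0 z
  have h1 := hasFDerivAt_apply' 1 z
  have h2 := hasFDerivAt_apply' 2 z
  have hd : DifferentiableAt ℝ hyperEmb z := (contDiff_hyperEmb.differentiable (by simp)) z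
  funext A
  have key : pd i hyperEmb z A = fderiv ℝ (fun z => hyperEmb z A) z (Pi.single i 1) := by
    have := (hasFDerivAt_pi'.1 hd.hasFDerivAt) A
    rw [this.fderiv]; rfl
  rw [key]
  fin_cases A
  · simp only [hyperEmb, Matrix.cons_val, Fin.zero_eta]
    rw [h0.cos.fderiv]
    fin_cases i <;> simp
  · simp only [hyperEmb, Matrix.cons_val, Fin.mk_one]
    have h : HasFDerivAt (fun z : Fin 3 → ℝ => Real.sin (z 0) * (Real.sin (z 1) * Real.cos (z 2))) _ z := h0.sin.mul (h1.sin.mul h2.cos)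
    rw [h.fderiv]
    fin_cases i <;> simp [mul_comm, mul_left_comm]
  · simp only [hyperEmb, Matrix.cons_val, Fin.reduceFinMk]
    have h : HasFDerivAt (fun z : Fin 3 → ℝ => Real.sin (z 0) * (Real.sin (z 1) * Real.sin (z 2))) _ z := h0.sin.mul (h1.sin.mul h2.sin)
    rw [h.fderiv]
    fin_cases i <;> simp [mul_comm, mul_left_comm]
  · simp only [hyperEmb, Matrix.cons_val, Fin.reduceFinMk]
    have h : HasFDerivAt (fun z : Fin 3 → ℝ => Real.sin (z 0) * Real.cos (z 1)) _ z := h0.sin.mul h1.cos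
    rw [h.fderiv]
    fin_cases i <;> simp [mul_comm, mul_left_comm]

lemma hyperEmb_oriented (z : Fin 3 → ℝ) (hz : z ∈ hyperDom) :
    0 < (Matrix.of ![hyperEmb z, pd 0 hyperEmb z, pd 1 hyperEmb z, pd 2 hyperEmb z]).det := by
  have hs0 : 0 < Real.sin (z 0) := Real.sin_pos_of_mem_Ioo hz.1
  have hs1 : 0 < Real.sin (z 1) := Real.sin_pos_of_mem_Ioo hz.2
  have : (Matrix.of ![hyperEmb z, pd 0 hyperEmb z, pd 1 hyperEmb z, pd 2 hyperEmb z]).det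
      = Real.sin (z 0) ^ 2 * Real.sin (z 1) := by
    have c0 : Real.cos (z 0) ^ 2 = 1 - Real.sin (z 0) ^ 2 := Real.cos_sq' _
    have c1 : Real.cos (z 1) ^ 2 = 1 - Real.sin (z 1) ^ 2 := Real.cos_sq' _
    have c2 : Real.cos (z 2) ^ 2 = 1 - Real.sin (z 2) ^ 2 := Real.cos_sq' _
    simp only [pd_hyperEmb, hyperEmb]
    simp [Matrix.det_succ_row_zero, Fin.sum_univ_succ, Fin.succAbove]
    ring_nf
    grind
  rw [this]
  positivity

/-- The hyperspherical coordinates as a chart of `S³`. -/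
def hyperChart : S3Chart where
  dom := hyperDom
  emb := hyperEmb
  isOpen_dom := isOpen_hyperDom
  contDiff := contDiff_hyperEmb.contDiffOn
  unit := fun z _ => hyperEmb_unit z
  oriented := hyperEmb_oriented

/-- The round metric in hyperspherical coordinates. -/
abbrev γ : (Fin 3 → ℝ) → Matrix (Fin 3) (Fin 3) ℝ := hyperChart.metric

/-- `cos χ` as a scalar field. -/
def cosχ (z : Fin 3 → ℝ) : ℂ := (Real.cos (z 0) : ℂ)

/-- The labels and radial and polar functions of a scalar harmonic on `S³`.  `C` is a function of
`cos χ`, and the harmonic is `sin^ℓ χ C(cos χ) e^{-imφ} Θ(ϑ)`. -/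
structure HarmonicData where
  k : ℕ
  l : ℕ
  m : ℤ
  C : ℝ → ℂ
  Θ : ℝ → ℂ
  l_le_k : l ≤ k
  abs_m_le : |m| ≤ (l : ℤ)
  contDiff_C : ContDiffOn ℝ ∞ C (Set.Ioo (-1) 1)
  contDiff_Θ : ContDiffOn ℝ ∞ Θ (Set.Ioo 0 Real.pi)
  /-- the differential equation of `C`, in the variable `x = cos χ` -/
  ode_C : ∀ x ∈ Set.Ioo (-1 : ℝ) 1,
    (1 - x ^ 2) • deriv (deriv C) x - ((2 * (l : ℝ) + 3) * x) • deriv C x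
      + ((k : ℝ) * (k + 2) - (l : ℝ) * (l + 2)) • C x = 0
  ode_Θ : ∀ t ∈ Set.Ioo (0 : ℝ) Real.pi,
    Real.sin t • deriv (fun s => Real.sin s • deriv Θ s) t
      + ((l : ℝ) * (l + 1) * Real.sin t ^ 2 - (m : ℝ) ^ 2) • Θ t = 0
  C_ne : ∃ x ∈ Set.Ioo (-1 : ℝ) 1, C x ≠ 0
  Θ_ne : ∃ t ∈ Set.Ioo (0 : ℝ) Real.pi, Θ t ≠ 0

namespace HarmonicData

variable (d : HarmonicData)

/-- `H(χ) = sin^ℓ χ C(cos χ)`. -/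
def H (χ : ℝ) : ℂ := Real.sin χ ^ d.l • d.C (Real.cos χ)

/-- `Y(ϑ, φ) = e^{-imφ} Θ(ϑ)`. -/
def Y (t φ : ℝ) : ℂ := Complex.exp (-(Complex.I * d.m * φ)) * d.Θ t

/-- The scalar harmonic `𝕊 = H(χ) Y(ϑ, φ)`. -/
def S (z : Fin 3 → ℝ) : ℂ := d.H (z 0) * d.Y (z 1) (z 2)

def V0 (z : Fin 3 → ℝ) (i : Fin 3) : ℂ :=
  (1 / Real.sqrt ((d.k : ℝ) * (d.k + 2))) • grad d.S z i

def V1 (z : Fin 3 → ℝ) (i : Fin 3) : ℂ :=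
  (1 / Real.sqrt ((d.l : ℝ) * (d.l + 1))) •
    ∑ j, ∑ k, volUp γ z i j k • (grad d.S z j * grad cosχ z k)

def V2 (z : Fin 3 → ℝ) (i : Fin 3) : ℂ :=
  (1 / ((d.k : ℝ) + 1)) • ∑ j, ∑ k, volUp γ z i j k • cov1 γ d.V1 z j k

def T0 (z : Fin 3 → ℝ) (i j : Fin 3) : ℂ := (1 / Real.sqrt 3 * γ z i j) • d.S z

def T1 (z : Fin 3 → ℝ) (i j : Fin 3) : ℂ :=
  (2 / Real.sqrt (2 * ((d.k : ℝ) - 1) * (d.k + 3))) • symGrad γ d.V1 z i j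

def T2 (z : Fin 3 → ℝ) (i j : Fin 3) : ℂ :=
  (2 / Real.sqrt (2 * ((d.k : ℝ) - 1) * (d.k + 3))) • symGrad γ d.V2 z i j

def T3 (z : Fin 3 → ℝ) (i j : Fin 3) : ℂ :=
  (Real.sqrt 3 / Real.sqrt (2 * ((d.k : ℝ) - 1) * (d.k + 3))) •
    (cov1 γ d.V0 z i j + (Real.sqrt ((d.k : ℝ) * (d.k + 2)) / Real.sqrt 3) • d.T0 z i j)

/-- `E(χ) = - 2 csc^{ℓ+1} χ / ((ℓ-1)(ℓ+2)) · d/dχ (sin² χ H(χ))`. -/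
def E (χ : ℝ) : ℂ :=
  (-2 * (1 / Real.sin χ) ^ (d.l + 1) / (((d.l : ℝ) - 1) * (d.l + 2))) •
    deriv (fun s => Real.sin s ^ 2 • d.H s) χ

/-- `F_a = (ℓ(ℓ+1))^{-1/2} ε_a^{bc} D_b (sin^ℓ χ Y) D_c cos χ`. -/
def F (z : Fin 3 → ℝ) (i : Fin 3) : ℂ :=
  (1 / Real.sqrt ((d.l : ℝ) * (d.l + 1))) •
    ∑ j, ∑ k, volUp γ z i j k •
      (grad (fun z => Real.sin (z 0) ^ d.l • d.Y (z 1) (z 2)) z j * grad cosχ z k)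

def T4 (z : Fin 3 → ℝ) (i j : Fin 3) : ℂ :=
  Real.sqrt (((d.l : ℝ) - 1) * (d.l + 2) / (2 * (d.k : ℝ) * (d.k + 2))) •
    (d.E (z 0) * symGrad γ d.F z i j
      + (2 * (1 / Real.sin (z 0)) ^ 2) •
        (((((d.l : ℝ) - 1) / 2 * Real.cos (z 0)) • d.E (z 0) + d.C (Real.cos (z 0))) *
          ((1 / 2 : ℝ) • (d.F z i * grad cosχ z j + d.F z j * grad cosχ z i))))

/-- `T5 = (2 / (2(k+1))) ε_{(i}^{kl} D_{|k|} T4_{j)l}`. -/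
def T5 (z : Fin 3 → ℝ) (i j : Fin 3) : ℂ :=
  (2 / (2 * ((d.k : ℝ) + 1))) •
    ((1 / 2 : ℝ) • ∑ k, ∑ l,
      (volUp γ z i k l • cov2 γ d.T4 z k j l + volUp γ z j k l • cov2 γ d.T4 z k i l))

end HarmonicData

end SchwKY

end

open SchwKY

/-! The sphere is treated as the group of unit quaternions. The left-invariant fields `x ↦ x q_a`
are orthonormal on it, `D_a e_b = ε_{abc} e_c`, and `[e_a, e_b] = 2 ε_{abc} e_c`. In this frame the
metric is `δ_{ab}` and the volume form is the constant symbol `ε_{abc}`. Smooth functions on a chart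
form a commutative algebra with three derivations, so tensor identities become identities of
noncommuting derivations, the commutators (`FrameComm`) being the only geometric input. The ones
needed are: curl grad = 0, div curl = 0, symCurl symGrad = symGrad curl, symCurl(f γ) = 0, symCurl L
= 0, div symCurl = curl div and tr symCurl = 0 on symmetric tensors.

Components (`Zop_eq`): the Killing–Yano form has only sphere indices, and the powers of `r` cancel,
so its raised form is `ε̂_i^{kl}`. The Christoffel symbols with mixed indices enter only through
`γ_{kj}` and `δ^m_k`. Their contributions are either symmetric in `k, l`, and killed by `ε̂`, or
antisymmetric in `i, j`, and killed by the symmetrization. What remains is the curl of `h_{ai}` and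
the symmetrized curl of `h_{ij}`, so the action on pieces and on modes follows from the identities
above.

Uniqueness (`Pieces.unique_of_glob`): the left-invariant fields extend linearly to `ℝ⁴ ∖ {0}` with
the same commutators, so functions on the sphere are replaced by their extensions of degree zero.
Integration over the sphere is replaced by integration over `ℝ⁴` against a radial cut-off; the
fields are divergence free and annihilate radial functions, so integration by parts holds without
boundary terms. A decomposition of zero is then trivial. The trace gives `h_L = 0`. The double
divergence of `h_{T ij}` and of `D_{(i} h_{T j)}` vanishes, so pairing with `L h_T` gives `L h_T =
0`. Finally `h_{T ij} = -2 D_{(i} h_{T j)}` is orthogonal to itself. For `h_{ai}`, a divergence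
shows that the scalar part is harmonic, hence locally constant.

Harmonic classes: the gradient, Hessian and metric types are killed by the general identities, and
`T1`, `T2` follow from `V1`, `V2` by symCurl symGrad = symGrad curl. For `V1`, `V2`, `T4`, `T5` the
orthonormal frame of the hyperspherical coordinates is used, where the harmonic equation separates.
Explicit components (`vecO`, `tenO`, `tenO'`) and the second-order equations of `H` and `Y` reduce
`curl² = (k+1)²` and `symCurl² = 4(k+1)²` to polynomial identities. Nonvanishing is read off from
the `χχ` or `χ` component, to which only `V2`, `T2`, `T5` contribute. -/

noncomputable section

set_option linter.unusedSectionVars false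

namespace SchwKY

open TopologicalSpace

/-! ## The algebra of smooth functions on an open set -/

section SmoothAlgebra

variable {ι : Type} [Fintype ι] [DecidableEq ι]

/-- Smooth complex functions on an open set of a coordinate space. -/
def smoothSub (U : Opens (ι → ℝ)) : Subalgebra ℂ (U → ℂ) where
  carrier := {g | ∃ f : (ι → ℝ) → ℂ, ContDiffOn ℝ ∞ f U ∧ ∀ u : U, g u = f u}
  mul_mem' := by
    rintro a b ⟨f, hf, hfa⟩ ⟨g, hg, hgb⟩
    exact ⟨fun z => f z * g z, hf.mul hg, fun u => by simp [hfa, hgb]⟩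
  add_mem' := by
    rintro a b ⟨f, hf, hfa⟩ ⟨g, hg, hgb⟩
    exact ⟨fun z => f z + g z, hf.add hg, fun u => by simp [hfa, hgb]⟩
  algebraMap_mem' := fun r => ⟨fun _ => r, contDiffOn_const, fun u => rfl⟩

/-- The algebra of smooth complex functions on an open set of a coordinate space. -/
abbrev Sm (U : Opens (ι → ℝ)) : Type := ↥(smoothSub U)

variable {U : Opens (ι → ℝ)}

/-- Evaluation at a point. -/
def ev (u : U) : Sm U →ₐ[ℂ] ℂ := (Pi.evalAlgHom ℂ (fun _ : U => ℂ) u).comp (smoothSub U).val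

/-- The function `f`, defined on the whole coordinate space, restricts to `a` on `U`. -/
def Lift (f : (ι → ℝ) → ℂ) (a : Sm U) : Prop := ∀ u : U, f u = ev u a

lemma Sm.ext' {a b : Sm U} (h : ∀ u, ev u a = ev u b) : a = b :=
  Subtype.ext (funext h)

lemma Lift.eqOn {f g : (ι → ℝ) → ℂ} {a : Sm U} (hf : Lift f a) (hg : Lift g a) :
    Set.EqOn f g U := fun z hz => (hf ⟨z, hz⟩).trans (hg ⟨z, hz⟩).symm

lemma Lift.unique {f : (ι → ℝ) → ℂ} {a b : Sm U} (ha : Lift f a) (hb : Lift f b) : a = b :=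
  Sm.ext' fun u => (ha u).symm.trans (hb u)

lemma exists_lift {f : (ι → ℝ) → ℂ} (hf : ContDiffOn ℝ ∞ f U) : ∃ a : Sm U, Lift f a :=
  ⟨⟨fun u => f u, f, hf, fun _ => rfl⟩, fun _ => rfl⟩

/-- The restriction of a smooth function. -/
def mkS (f : (ι → ℝ) → ℂ) (hf : ContDiffOn ℝ ∞ f U) : Sm U := ⟨fun u => f u, f, hf, fun _ => rfl⟩

lemma lift_mkS (f : (ι → ℝ) → ℂ) (hf : ContDiffOn ℝ ∞ f U) : Lift f (mkS f hf) := fun _ => rfl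

@[simp] lemma ev_mkS (f : (ι → ℝ) → ℂ) (hf : ContDiffOn ℝ ∞ f U) (u : U) :
    ev u (mkS f hf) = f u := rfl

/-- An extension of an element of `Sm U` to the whole coordinate space. -/
def rep (a : Sm U) : (ι → ℝ) → ℂ := a.2.choose

lemma contDiffOn_rep (a : Sm U) : ContDiffOn ℝ ∞ (rep a) U := a.2.choose_spec.1

lemma lift_rep (a : Sm U) : Lift (rep a) a := fun u => (a.2.choose_spec.2 u).symm

lemma Lift.contDiffOn {f : (ι → ℝ) → ℂ} {a : Sm U} (h : Lift f a) : ContDiffOn ℝ ∞ f U :=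
  (contDiffOn_rep a).congr (h.eqOn (lift_rep a))

lemma Lift.differentiableAt {f : (ι → ℝ) → ℂ} {a : Sm U} (h : Lift f a) (u : U) :
    DifferentiableAt ℝ f u :=
  (h.contDiffOn.contDiffAt (U.isOpen.mem_nhds u.2)).differentiableAt (by simp)

lemma Lift.add {f g : (ι → ℝ) → ℂ} {a b : Sm U} (hf : Lift f a) (hg : Lift g b) :
    Lift (fun z => f z + g z) (a + b) := fun u => by simp [hf u, hg u]

lemma Lift.mul {f g : (ι → ℝ) → ℂ} {a b : Sm U} (hf : Lift f a) (hg : Lift g b) :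
    Lift (fun z => f z * g z) (a * b) := fun u => by simp [hf u, hg u]

lemma Lift.const_smul {f : (ι → ℝ) → ℂ} {a : Sm U} (hf : Lift f a) (r : ℂ) :
    Lift (fun z => r * f z) (r • a) := fun u => by simp [hf u]

lemma pd_congr {E : Type} [NormedAddCommGroup E] [NormedSpace ℝ E] {f g : (ι → ℝ) → E}
    {s : Set (ι → ℝ)} (hs : IsOpen s) (h : Set.EqOn f g s) (i : ι) :
    Set.EqOn (pd i f) (pd i g) s := fun z hz => by
  have : f =ᶠ[nhds z] g := Filter.eventuallyEq_of_mem (hs.mem_nhds hz) h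
  rw [pd, pd, this.fderiv_eq]

lemma contDiffOn_pd {E : Type} [NormedAddCommGroup E] [NormedSpace ℝ E] {f : (ι → ℝ) → E}
    {s : Set (ι → ℝ)} (hs : IsOpen s) (hf : ContDiffOn ℝ ∞ f s) (i : ι) :
    ContDiffOn ℝ ∞ (pd i f) s :=
  (hf.fderiv_of_isOpen hs (m := ∞) (by simp)).clm_apply contDiffOn_const

/-- The function underlying `pdS`. -/
def pdFun (i : ι) (a : Sm U) : Sm U := mkS (pd i (rep a)) (contDiffOn_pd U.isOpen (contDiffOn_rep a) i)

/-- Since `U` is open, derivatives at its points depend only on the values on `U`, so the choice of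
the extension `rep a` is immaterial. This is what allows partial differentiation to act on
restrictions. -/
lemma Lift.pdFun {f : (ι → ℝ) → ℂ} {a : Sm U} (h : Lift f a) (i : ι) :
    Lift (pd i f) (pdFun i a) := fun u => pd_congr U.isOpen (h.eqOn (lift_rep a)) i u.2

/-- The partial derivatives as derivations of the algebra of smooth functions. -/
def pdS (i : ι) : Derivation ℂ (Sm U) (Sm U) :=
  Derivation.mk'
    { toFun := pdFun i
      map_add' := fun a b => by
        refine (((lift_rep a).add (lift_rep b)).pdFun i).unique fun u => ?_
        rw [map_add, ← (lift_rep a).pdFun i u, ← (lift_rep b).pdFun i u]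
        simp only [pd]
        rw [fderiv_fun_add ((lift_rep a).differentiableAt u) ((lift_rep b).differentiableAt u)]
        rfl
      map_smul' := fun r a => by
        refine (((lift_rep a).const_smul r).pdFun i).unique fun u => ?_
        rw [RingHom.id_apply, map_smul, ← (lift_rep a).pdFun i u]
        simp only [pd]
        rw [fderiv_const_mul ((lift_rep a).differentiableAt u)]
        rfl }
    fun a b => by
      refine (((lift_rep a).mul (lift_rep b)).pdFun i).unique fun u => ?_
      simp only [smul_eq_mul, map_add, map_mul]
      change _ = ev u a * ev u (pdFun i b) + ev u b * ev u (pdFun i a)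
      rw [← (lift_rep a).pdFun i u, ← (lift_rep b).pdFun i u, ← lift_rep a u, ← lift_rep b u]
      simp only [pd]
      rw [fderiv_fun_mul ((lift_rep a).differentiableAt u) ((lift_rep b).differentiableAt u)]
      simp

lemma Lift.pd {f : (ι → ℝ) → ℂ} {a : Sm U} (h : Lift f a) (i : ι) :
    Lift (pd i f) (pdS i a) := h.pdFun i

lemma Lift.ev_pdS {f : (ι → ℝ) → ℂ} {a : Sm U} (h : Lift f a) (i : ι) (u : U) :
    ev u (pdS i a) = SchwKY.pd i f u := (h.pd i u).symm

lemma pd_comm {E : Type} [NormedAddCommGroup E] [NormedSpace ℝ E] {f : (ι → ℝ) → E}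
    {z : ι → ℝ} (hf : ContDiffAt ℝ ∞ f z) (i j : ι) : pd i (pd j f) z = pd j (pd i f) z := by
  have hd : DifferentiableAt ℝ (fderiv ℝ f) z :=
    (hf.fderiv_right (m := ∞) (by simp)).differentiableAt (by simp)
  have key : ∀ i j, pd i (pd j f) z
      = fderiv ℝ (fderiv ℝ f) z (Pi.single i 1) (Pi.single j 1) := fun i j => by
    change fderiv ℝ (fun y => fderiv ℝ f y (Pi.single j 1)) z _ = _
    rw [fderiv_clm_apply hd (differentiableAt_const _)]
    simp
  rw [key, key]
  exact (hf.isSymmSndFDerivAt (by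
    simpa using (WithTop.coe_le_coe.2 (le_top : (2 : ℕ∞) ≤ ⊤)))).eq _ _

lemma pdS_comm (i j : ι) (a : Sm U) : pdS i (pdS j a) = pdS j (pdS i a) :=
  Sm.ext' fun u => by
    rw [(((lift_rep a).pd j).ev_pdS i u), (((lift_rep a).pd i).ev_pdS j u)]
    exact pd_comm ((contDiffOn_rep a).contDiffAt (U.isOpen.mem_nhds u.2)) i j

lemma pd_ofReal {f : (ι → ℝ) → ℝ} {z : ι → ℝ} (hf : DifferentiableAt ℝ f z) (i : ι) :
    pd i (fun z => (f z : ℂ)) z = ((pd i f z : ℝ) : ℂ) := by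
  have := (Complex.ofRealCLM.hasFDerivAt.comp z hf.hasFDerivAt).fderiv
  simp only [pd]
  change fderiv ℝ (Complex.ofRealCLM ∘ f) z _ = _
  rw [this]; rfl

lemma contDiffOn_ofReal {f : (ι → ℝ) → ℝ} {s : Set (ι → ℝ)} (hf : ContDiffOn ℝ ∞ f s) :
    ContDiffOn ℝ ∞ (fun z => (f z : ℂ)) s := Complex.ofRealCLM.contDiff.comp_contDiffOn hf

end SmoothAlgebra

/-! ## The left-invariant frame of the 3-sphere -/

/-- The left-invariant vector fields `x ↦ x q_a` on the quaternions `ℝ⁴`. -/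
def quatJ (a : Fin 3) (x : Fin 4 → ℝ) : Fin 4 → ℝ :=
  ![![-x 1, x 0, x 3, -x 2], ![-x 2, -x 3, x 0, x 1], ![-x 3, x 2, -x 1, x 0]] a

lemma quatJ_add (a : Fin 3) (x y : Fin 4 → ℝ) : quatJ a (x + y) = quatJ a x + quatJ a y := by
  fin_cases a <;> funext A <;> fin_cases A <;> simp [quatJ] <;> ring

lemma quatJ_smul (a : Fin 3) (r : ℝ) (x : Fin 4 → ℝ) : quatJ a (r • x) = r • quatJ a x := by
  fin_cases a <;> funext A <;> fin_cases A <;> simp [quatJ]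

/-- `quatJ a` as a continuous linear map. -/
def quatJL (a : Fin 3) : (Fin 4 → ℝ) →L[ℝ] (Fin 4 → ℝ) :=
  LinearMap.toContinuousLinearMap
    { toFun := quatJ a, map_add' := quatJ_add a, map_smul' := quatJ_smul a }

@[simp] lemma quatJL_apply (a : Fin 3) (x : Fin 4 → ℝ) : quatJL a x = quatJ a x := rfl

lemma quatJ_orthogonal (a : Fin 3) (x : Fin 4 → ℝ) : ∑ A, x A * quatJ a x A = 0 := by
  fin_cases a <;> simp [quatJ, Fin.sum_univ_four] <;> ring

/-- Right multiplication by a unit quaternion preserves the norm, so `x` and the three `quatJ a x`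
are orthogonal, all of length `|x|`; this is the expansion of `v` in that basis. -/
lemma quatJ_expand (x v : Fin 4 → ℝ) (A : Fin 4) :
    (∑ B, x B ^ 2) * v A
      = (∑ B, x B * v B) * x A + ∑ a, (∑ B, quatJ a x B * v B) * quatJ a x A := by
  fin_cases A <;> simp [quatJ, Fin.sum_univ_four, Fin.sum_univ_three] <;> ring

/-- The coordinate domain of a chart as an open set. -/
def S3Chart.U (c : S3Chart) : Opens (Fin 3 → ℝ) := ⟨c.dom, c.isOpen_dom⟩

namespace S3Chart

variable (c : S3Chart)

/-- The components `θ^a_i` of the left-invariant coframe in a chart. -/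
def cofr (z : Fin 3 → ℝ) (a i : Fin 3) : ℝ := ∑ A, quatJ a (c.emb z) A * pd i c.emb z A

variable {c} {z : Fin 3 → ℝ}

lemma contDiffAt_emb (hz : z ∈ c.dom) : ContDiffAt ℝ ∞ c.emb z :=
  c.contDiff.contDiffAt (c.isOpen_dom.mem_nhds hz)

lemma contDiffOn_pd_emb (i : Fin 3) : ContDiffOn ℝ ∞ (pd i c.emb) c.dom :=
  contDiffOn_pd c.isOpen_dom c.contDiff i

lemma pd_apply {n : ℕ} {f : (Fin 3 → ℝ) → Fin n → ℝ} (hf : DifferentiableAt ℝ f z) (i : Fin 3)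
    (A : Fin n) : pd i (fun z => f z A) z = pd i f z A := by
  have := (hasFDerivAt_pi'.1 hf.hasFDerivAt) A
  rw [pd, this.fderiv]; rfl

lemma sum_emb_pd (hz : z ∈ c.dom) (i : Fin 3) : ∑ A, c.emb z A * pd i c.emb z A = 0 := by
  have hd := (contDiffAt_emb hz).differentiableAt (by simp)
  have h1 : pd i (fun z => ∑ A, c.emb z A ^ 2) z = 0 := by
    have := pd_congr c.isOpen_dom (f := fun z => ∑ A, c.emb z A ^ 2) (g := fun _ => (1 : ℝ))
      (fun z hz => c.unit z hz) i hz
    rw [this]; simp [pd]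
  have h2 : pd i (fun z => ∑ A, c.emb z A ^ 2) z = 2 * ∑ A, c.emb z A * pd i c.emb z A := by
    have hA : ∀ A, HasFDerivAt (fun z => c.emb z A) (fderiv ℝ (fun z => c.emb z A) z) z := fun A =>
      (differentiableAt_pi.1 hd A).hasFDerivAt
    have := HasFDerivAt.fun_sum (u := Finset.univ) fun A _ => (hA A).pow 2
    rw [pd, this.fderiv, Finset.mul_sum, sum_apply]
    refine Finset.sum_congr rfl fun A _ => ?_
    rw [← pd_apply hd]
    simp [pd]; ring
  rw [h1] at h2
  linarith

lemma pd_emb_eq (hz : z ∈ c.dom) (i : Fin 3) (A : Fin 4) :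
    pd i c.emb z A = ∑ a, c.cofr z a i * quatJ a (c.emb z) A := by
  have := quatJ_expand (c.emb z) (pd i c.emb z) A
  rw [c.unit z hz, sum_emb_pd hz] at this
  simpa [cofr] using this

lemma metric_eq (hz : z ∈ c.dom) (i j : Fin 3) :
    c.metric z i j = ∑ a, c.cofr z a i * c.cofr z a j := by
  simp only [metric, Matrix.of_apply]
  simp_rw [pd_emb_eq hz j, Finset.mul_sum]
  rw [Finset.sum_comm]
  refine Finset.sum_congr rfl fun a _ => ?_
  rw [show c.cofr z a i = ∑ A, quatJ a (c.emb z) A * pd i c.emb z A from rfl, Finset.sum_mul]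
  exact Finset.sum_congr rfl fun A _ => by rw [show c.cofr z a j = ∑ A, quatJ a (c.emb z) A * pd j c.emb z A from rfl]; ring

/-- The coframe as a matrix. -/
def cofrM (c : S3Chart) (z : Fin 3 → ℝ) : Matrix (Fin 3) (Fin 3) ℝ := Matrix.of (c.cofr z)

lemma metric_eq_mul (hz : z ∈ c.dom) : c.metric z = (c.cofrM z).transpose * c.cofrM z := by
  ext i j
  rw [metric_eq hz, Matrix.mul_apply]; rfl

/-- The matrix of `X, ∂X` factors through the basis `X, quatJ a X`, whose determinant is `|X|⁴ = 1`.
The orientation of the chart therefore passes to the coframe, and the square root of `det γ` is `det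
θ` with no sign ambiguity. -/
lemma det_cofrM_pos (hz : z ∈ c.dom) : 0 < (c.cofrM z).det := by
  have h := c.oriented z hz
  set Q : Matrix (Fin 4) (Fin 4) ℝ := Matrix.of ![c.emb z, quatJ 0 (c.emb z), quatJ 1 (c.emb z),
    quatJ 2 (c.emb z)] with hQ
  set N : Matrix (Fin 4) (Fin 4) ℝ := Matrix.of ![![1, 0, 0, 0],
    ![0, c.cofr z 0 0, c.cofr z 1 0, c.cofr z 2 0],
    ![0, c.cofr z 0 1, c.cofr z 1 1, c.cofr z 2 1],
    ![0, c.cofr z 0 2, c.cofr z 1 2, c.cofr z 2 2]] with hN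
  have e : Matrix.of ![c.emb z, pd 0 c.emb z, pd 1 c.emb z, pd 2 c.emb z] = N * Q := by
    ext i A
    rw [Matrix.mul_apply]
    fin_cases i
    · simp [hN, hQ, Fin.sum_univ_four]
    · simp [hN, hQ, Fin.sum_univ_four, pd_emb_eq hz, Fin.sum_univ_three]
    · simp [hN, hQ, Fin.sum_univ_four, pd_emb_eq hz, Fin.sum_univ_three]
    · simp [hN, hQ, Fin.sum_univ_four, pd_emb_eq hz, Fin.sum_univ_three]
  have hQd : Q.det = 1 := by
    have hu := c.unit z hz
    have : Q.det = (∑ A, c.emb z A ^ 2) ^ 2 := by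
      simp [hQ, Matrix.det_succ_row_zero, Fin.sum_univ_succ, Fin.succAbove, quatJ]
      ring
    rw [this, hu]; norm_num
  have hNd : N.det = (c.cofrM z).det := by
    rw [Matrix.det_fin_three]
    simp [hN, Matrix.det_succ_row_zero, Fin.sum_univ_succ, Fin.succAbove, cofrM]
    ring
  rw [e, Matrix.det_mul, hQd, hNd, mul_one] at h
  exact h

lemma sqrt_det_metric (hz : z ∈ c.dom) : Real.sqrt (c.metric z).det = (c.cofrM z).det := by
  rw [metric_eq_mul hz, Matrix.det_mul, Matrix.det_transpose, Real.sqrt_mul_self (det_cofrM_pos hz).le]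

/-- The dual frame: the components `E^i_a` of the left-invariant vector fields. -/
def frM (c : S3Chart) (z : Fin 3 → ℝ) : Matrix (Fin 3) (Fin 3) ℝ := (c.cofrM z)⁻¹

lemma isUnit_det (hz : z ∈ c.dom) : IsUnit (c.cofrM z).det := (det_cofrM_pos hz).ne'.isUnit

lemma cofrM_mul_frM (hz : z ∈ c.dom) : c.cofrM z * c.frM z = 1 := Matrix.mul_nonsing_inv _ (isUnit_det hz)

lemma frM_mul_cofrM (hz : z ∈ c.dom) : c.frM z * c.cofrM z = 1 := Matrix.nonsing_inv_mul _ (isUnit_det hz)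

lemma metric_inv (hz : z ∈ c.dom) : (c.metric z)⁻¹ = c.frM z * (c.frM z).transpose := by
  rw [metric_eq_mul hz, Matrix.mul_inv_rev, frM, Matrix.transpose_nonsing_inv]

lemma contDiffOn_cofr (a i : Fin 3) : ContDiffOn ℝ ∞ (fun z => c.cofr z a i) c.dom := by
  unfold cofr
  refine ContDiffOn.sum fun A _ => ContDiffOn.mul ?_ ?_
  · exact (contDiffOn_pi.1 ((quatJL a).contDiff.comp_contDiffOn c.contDiff)) A
  · exact contDiffOn_pi.1 (contDiffOn_pd_emb i) A

lemma contDiffOn_metric (i j : Fin 3) : ContDiffOn ℝ ∞ (fun z => c.metric z i j) c.dom := by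
  simp only [metric, Matrix.of_apply]
  exact ContDiffOn.sum fun A _ => (contDiffOn_pi.1 (contDiffOn_pd_emb i) A).mul
    (contDiffOn_pi.1 (contDiffOn_pd_emb j) A)

lemma contDiffOn_frM (i a : Fin 3) : ContDiffOn ℝ ∞ (fun z => c.frM z i a) c.dom := by
  have hc : ∀ a i, ContDiffOn ℝ ∞ (fun z => c.cofrM z a i) c.dom := contDiffOn_cofr
  have hd : ContDiffOn ℝ ∞ (fun z => (c.cofrM z).det) c.dom := by
    simp only [Matrix.det_fin_three]
    have := hc
    fun_prop
  have e : ∀ z, c.frM z i a = ((c.cofrM z).det)⁻¹ * (c.cofrM z).adjugate i a := fun z => by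
    rw [frM, Matrix.inv_def]; simp
  simp only [e]
  refine (hd.inv fun z hz => (det_cofrM_pos hz).ne').mul ?_
  simp only [Matrix.adjugate_fin_three]
  have := hc
  fin_cases i <;> fin_cases a <;> simp <;> fun_prop

/-- The structure equation of the left-invariant coframe. -/
lemma pd_cofr_sub (hz : z ∈ c.dom) (a i j : Fin 3) :
    pd i (fun z => c.cofr z a j) z - pd j (fun z => c.cofr z a i) z
      = -2 * ∑ b, ∑ d, leviCivita a b d * c.cofr z b i * c.cofr z d j := by
  have hX := (contDiffAt_emb hz).differentiableAt (by simp)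
  have hJ : HasFDerivAt (fun z => quatJ a (c.emb z)) ((quatJL a).comp (fderiv ℝ c.emb z)) z :=
    (quatJL a).hasFDerivAt.comp z hX.hasFDerivAt
  have hp : ∀ j, DifferentiableAt ℝ (pd j c.emb) z := fun j =>
    ((contDiffOn_pd_emb j).contDiffAt (c.isOpen_dom.mem_nhds hz)).differentiableAt (by simp)
  -- Product rule for `θ^a_j = ⟨quatJ a X, ∂_j X⟩`, using that `quatJ a` is linear.
  have key : ∀ i j, pd i (fun z => c.cofr z a j) z
      = ∑ A, (quatJ a (pd i c.emb z) A * pd j c.emb z A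
        + quatJ a (c.emb z) A * pd i (pd j c.emb) z A) := fun i j => by
    unfold cofr
    have hs := HasFDerivAt.fun_sum (u := Finset.univ) fun A _ =>
      ((hasFDerivAt_pi'.1 hJ) A).fun_mul ((hasFDerivAt_pi'.1 (hp j).hasFDerivAt) A)
    rw [pd, hs.fderiv, sum_apply]
    refine Finset.sum_congr rfl fun A _ => ?_
    simp [pd]; ring
  rw [key, key]
  -- The terms with `∂_i ∂_j X` cancel in the antisymmetrization; only `⟨quatJ a ∂_i X, ∂_j X⟩ - (i
  -- ↔ j)` is left, and both tangent vectors are now expanded in the frame.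
  simp_rw [pd_comm (contDiffAt_emb hz) j i]
  rw [← Finset.sum_sub_distrib]
  simp only [add_sub_add_right_eq_sub]
  have hpe : ∀ i, pd i c.emb z = fun A => ∑ a, c.cofr z a i * quatJ a (c.emb z) A := fun i =>
    funext (pd_emb_eq hz i)
  rw [hpe i, hpe j]
  have hu := c.unit z hz
  simp only [Fin.sum_univ_four] at hu
  simp only [Fin.sum_univ_four, Fin.sum_univ_three, leviCivita]
  -- The two sides agree up to factors `|X|²`, so the unit constraint is used to eliminate one
  -- square.
  have h0 : c.emb z 0 ^ 2 = 1 - c.emb z 1 ^ 2 - c.emb z 2 ^ 2 - c.emb z 3 ^ 2 := by linarith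
  fin_cases a <;> simp [quatJ] <;> ring_nf <;> rw [h0] <;> ring

end S3Chart

/-! ### Levi-Civita connection and volume form in the left-invariant coframe -/

namespace S3Chart

variable {c : S3Chart} {z : Fin 3 → ℝ}

lemma differentiableAt_cofr (hz : z ∈ c.dom) (a i : Fin 3) :
    DifferentiableAt ℝ (fun z => c.cofr z a i) z :=
  ((contDiffOn_cofr a i).contDiffAt (c.isOpen_dom.mem_nhds hz)).differentiableAt (by simp)

lemma pd_metric (hz : z ∈ c.dom) (k i j : Fin 3) :
    pd k (fun z => c.metric z i j) z = ∑ a, (pd k (fun z => c.cofr z a i) z * c.cofr z a j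
      + c.cofr z a i * pd k (fun z => c.cofr z a j) z) := by
  rw [pd_congr c.isOpen_dom (g := fun z => ∑ a, c.cofr z a i * c.cofr z a j)
    (fun z hz => metric_eq hz i j) k hz]
  have hs := HasFDerivAt.fun_sum (u := Finset.univ) fun a _ =>
    ((differentiableAt_cofr hz a i).hasFDerivAt).fun_mul
      ((differentiableAt_cofr hz a j).hasFDerivAt)
  rw [pd, hs.fderiv, sum_apply]
  refine Finset.sum_congr rfl fun A _ => ?_
  simp [pd]; ring

lemma sum_frM_cofr (hz : z ∈ c.dom) (a b : Fin 3) :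
    ∑ i, c.cofr z a i * c.frM z i b = if a = b then 1 else 0 := by
  have := congrFun₂ (cofrM_mul_frM hz) a b
  rwa [Matrix.mul_apply, Matrix.one_apply] at this

lemma sum_cofr_frM (hz : z ∈ c.dom) (i j : Fin 3) :
    ∑ a, c.frM z i a * c.cofr z a j = if i = j then 1 else 0 := by
  have := congrFun₂ (frM_mul_cofrM hz) i j
  rwa [Matrix.mul_apply, Matrix.one_apply] at this

lemma metric_inv_apply (hz : z ∈ c.dom) (i j : Fin 3) :
    (c.metric z)⁻¹ i j = ∑ b, c.frM z i b * c.frM z j b := by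
  rw [metric_inv hz, Matrix.mul_apply]; rfl

/-- The Levi-Civita connection of the round metric in terms of the left-invariant frame. -/
lemma christoffel_eq (hz : z ∈ c.dom) (k i j : Fin 3) :
    christoffel c.metric z k i j = ∑ a, c.frM z k a * (pd i (fun z => c.cofr z a j) z
      + ∑ b, ∑ d, leviCivita a b d * c.cofr z b i * c.cofr z d j) := by
  -- With `γ = θᵀθ` the Koszul combination is rewritten by the structure equation for the three
  -- index pairs `(i,j)`, `(i,l)`, `(j,l)`, so that only `∂_i θ^a_j` survives as a derivative.
  have hl : ∀ l, pd i (fun z => c.metric z l j) z + pd j (fun z => c.metric z l i) z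
      - pd l (fun z => c.metric z i j) z = 2 * ∑ a, c.cofr z a l *
        (pd i (fun z => c.cofr z a j) z
          + ∑ b, ∑ d, leviCivita a b d * c.cofr z b i * c.cofr z d j) := fun l => by
    simp only [pd_metric hz]
    have s1 := fun a => pd_cofr_sub hz a i j
    have s2 := fun a => pd_cofr_sub hz a i l
    have s3 := fun a => pd_cofr_sub hz a j l
    simp only [Fin.sum_univ_three, leviCivita] at s1 s2 s3 ⊢
    have s10 := s1 0; have s11 := s1 1; have s12 := s1 2
    have s20 := s2 0; have s21 := s2 1; have s22 := s2 2
    have s30 := s3 0; have s31 := s3 1; have s32 := s3 2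
    norm_num at s10 s11 s12 s20 s21 s22 s30 s31 s32 ⊢
    linear_combination (-c.cofr z 0 l) * s10 - c.cofr z 1 l * s11 - c.cofr z 2 l * s12
      + c.cofr z 0 j * s20 + c.cofr z 1 j * s21 + c.cofr z 2 j * s22
      + c.cofr z 0 i * s30 + c.cofr z 1 i * s31 + c.cofr z 2 i * s32
  unfold christoffel
  simp only [hl, metric_inv_apply hz]
  set X : Fin 3 → ℝ := fun a => pd i (fun z => c.cofr z a j) z
          + ∑ b, ∑ d, leviCivita a b d * c.cofr z b i * c.cofr z d j
  change 1 / 2 * ∑ l, (∑ b, c.frM z k b * c.frM z l b) * (2 * ∑ a, c.cofr z a l * X a)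
    = ∑ a, c.frM z k a * X a
  have e : ∀ l, (∑ b, c.frM z k b * c.frM z l b) * (2 * ∑ a, c.cofr z a l * X a)
      = ∑ b, ∑ a, 2 * (c.frM z k b * X a * (c.cofr z a l * c.frM z l b)) := fun l => by
    rw [Finset.sum_mul]
    refine Finset.sum_congr rfl fun b _ => ?_
    rw [Finset.mul_sum, Finset.mul_sum]
    exact Finset.sum_congr rfl fun a _ => by ring
  simp only [e]
  rw [Finset.sum_comm, Finset.mul_sum]
  refine Finset.sum_congr rfl fun b _ => ?_
  rw [Finset.sum_comm]
  simp only [← Finset.mul_sum, sum_frM_cofr hz]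
  simp

lemma christoffel_comm {ι : Type} [Fintype ι] [DecidableEq ι] {G : (ι → ℝ) → Matrix ι ι ℝ}
    (hG : ∀ x i j, G x i j = G x j i) (x : ι → ℝ) (k i j : ι) :
    christoffel G x k i j = christoffel G x k j i := by
  unfold christoffel
  simp only [hG _ i j]
  congr 1
  exact Finset.sum_congr rfl fun l _ => by ring

lemma metric_symm (c : S3Chart) (z : Fin 3 → ℝ) (i j : Fin 3) :
    c.metric z i j = c.metric z j i := by
  simp only [metric, Matrix.of_apply]
  exact Finset.sum_congr rfl fun A _ => by ring

lemma leviCivita_mul_det (N : Matrix (Fin 3) (Fin 3) ℝ) (i j k : Fin 3) :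
    N.det * leviCivita i j k = ∑ a, ∑ b, ∑ d, leviCivita a b d * N a i * N b j * N d k := by
  have h : ∑ a, ∑ b, ∑ d, leviCivita a b d * N a i * N b j * N d k
      = N 0 i * (N 1 j * N 2 k - N 2 j * N 1 k) - N 1 i * (N 0 j * N 2 k - N 2 j * N 0 k)
        + N 2 i * (N 0 j * N 1 k - N 1 j * N 0 k) := by
    simp only [Fin.sum_univ_three, leviCivita]
    norm_num
    ring
  rw [h, Matrix.det_fin_three]
  have h3 : ∀ i : Fin 3, i = 0 ∨ i = 1 ∨ i = 2 := by decide
  rcases h3 i with rfl | rfl | rfl <;> rcases h3 j with rfl | rfl | rfl <;>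
    rcases h3 k with rfl | rfl | rfl <;> norm_num [leviCivita] <;> ring

lemma vol_eq (hz : z ∈ c.dom) (i j k : Fin 3) : vol c.metric z i j k
    = ∑ a, ∑ b, ∑ d, leviCivita a b d * c.cofr z a i * c.cofr z b j * c.cofr z d k := by
  rw [vol, sqrt_det_metric hz, leviCivita_mul_det]; rfl

/-- The volume form with raised indices in terms of the left-invariant frame. -/
lemma volUp_eq (hz : z ∈ c.dom) (i k l : Fin 3) :
    volUp c.metric z i k l
      = ∑ a, ∑ b, ∑ d, leviCivita a b d * c.cofr z a i * c.frM z k b * c.frM z l d := by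
  have key : ∀ b k, ∑ k', c.cofr z b k' * (c.metric z)⁻¹ k' k = c.frM z k b := fun b k => by
    simp only [metric_inv_apply hz, Finset.mul_sum]
    rw [Finset.sum_comm]
    simp only [← mul_assoc, ← Finset.sum_mul, sum_frM_cofr hz]
    simp
  have h1 : ∀ k', ∑ l', vol c.metric z i k' l' * (c.metric z)⁻¹ l' l
      = ∑ a, ∑ b, ∑ d, leviCivita a b d * c.cofr z a i * c.frM z l d * c.cofr z b k' := by
    intro k'
    simp only [vol_eq hz, Finset.sum_mul, ← key _ l]
    rw [Finset.sum_comm]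
    refine Finset.sum_congr rfl fun a _ => ?_
    rw [Finset.sum_comm]
    refine Finset.sum_congr rfl fun b _ => ?_
    rw [Finset.sum_comm]
    refine Finset.sum_congr rfl fun d _ => ?_
    rw [Finset.mul_sum, Finset.sum_mul]
    exact Finset.sum_congr rfl fun l' _ => by ring
  have h2 : ∀ k', ∑ l', vol c.metric z i k' l' * (c.metric z)⁻¹ k' k * (c.metric z)⁻¹ l' l
      = (∑ l', vol c.metric z i k' l' * (c.metric z)⁻¹ l' l) * (c.metric z)⁻¹ k' k := fun k' => by
    rw [Finset.sum_mul]
    exact Finset.sum_congr rfl fun l' _ => by ring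
  unfold volUp
  simp only [h2, h1, Finset.sum_mul, ← key _ k]
  rw [Finset.sum_comm]
  refine Finset.sum_congr rfl fun a _ => ?_
  rw [Finset.sum_comm]
  refine Finset.sum_congr rfl fun b _ => ?_
  rw [Finset.sum_comm]
  refine Finset.sum_congr rfl fun d _ => ?_
  rw [Finset.mul_sum, Finset.sum_mul]
  exact Finset.sum_congr rfl fun l' _ => by ring

/-- In a covariant derivative of `θ^a_i v_a`, the part `∂_k θ^a_i` of this contraction cancels the
term in which the Leibniz rule differentiates the coframe. The `ε` part that is left gives the
constant connection coefficients of `cov1F` and `cov2F`. -/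
lemma sum_christoffel_smul (hz : z ∈ c.dom) (k i : Fin 3) (v : Fin 3 → ℂ) :
    ∑ m, christoffel c.metric z m k i • (∑ b, (c.cofr z b m : ℂ) * v b)
      = ∑ a, ((pd k (fun z => c.cofr z a i) z
          + ∑ b, ∑ d, leviCivita a b d * c.cofr z b k * c.cofr z d i : ℝ) : ℂ) * v a := by
  set X : Fin 3 → ℝ := fun a => pd k (fun z => c.cofr z a i) z
          + ∑ b, ∑ d, leviCivita a b d * c.cofr z b k * c.cofr z d i with hX
  have e : ∀ m, christoffel c.metric z m k i • (∑ b, (c.cofr z b m : ℂ) * v b)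
      = ∑ a, ∑ b, (X a : ℂ) * v b * ((c.cofr z b m * c.frM z m a : ℝ) : ℂ) := fun m => by
    rw [christoffel_eq hz, Complex.real_smul, Complex.ofReal_sum, Finset.sum_mul]
    refine Finset.sum_congr rfl fun a _ => ?_
    rw [Finset.mul_sum]
    refine Finset.sum_congr rfl fun b _ => ?_
    rw [Complex.ofReal_mul, Complex.ofReal_mul]
    change (c.frM z m a : ℂ) * (X a : ℂ) * _ = _
    ring
  simp only [e]
  rw [Finset.sum_comm]
  refine Finset.sum_congr rfl fun a _ => ?_
  rw [Finset.sum_comm]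
  simp only [← Finset.mul_sum, ← Complex.ofReal_sum, sum_frM_cofr hz]
  change _ = (X a : ℂ) * v a
  rw [Finset.sum_eq_single_of_mem a (Finset.mem_univ a) fun b _ hb => by simp [hb]]
  simp

/-! ### Frame components -/

/-- The components of the coframe as smooth functions. -/
def th (c : S3Chart) (a i : Fin 3) : Sm c.U :=
  mkS (fun z => (c.cofr z a i : ℂ)) (contDiffOn_ofReal (contDiffOn_cofr a i))

/-- The components of the frame as smooth functions. -/
def fr (c : S3Chart) (i a : Fin 3) : Sm c.U :=
  mkS (fun z => (c.frM z i a : ℂ)) (contDiffOn_ofReal (contDiffOn_frM i a))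

@[simp] lemma ev_th (u : c.U) (a i : Fin 3) : ev u (c.th a i) = (c.cofr u a i : ℂ) := rfl

@[simp] lemma ev_fr (u : c.U) (i a : Fin 3) : ev u (c.fr i a) = (c.frM u i a : ℂ) := rfl

lemma sum_th_fr (a b : Fin 3) : ∑ i, c.th a i * c.fr i b = if a = b then 1 else 0 :=
  Sm.ext' fun u => by
    have := sum_frM_cofr (c := c) u.2 a b
    simp only [map_sum, map_mul, ev_th, ev_fr]
    exact_mod_cast (congrArg (fun x : ℝ => (x : ℂ)) this).trans (by split_ifs <;> simp)

lemma sum_fr_th (i j : Fin 3) : ∑ a, c.fr i a * c.th a j = if i = j then 1 else 0 :=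
  Sm.ext' fun u => by
    have := sum_cofr_frM (c := c) u.2 i j
    simp only [map_sum, map_mul, ev_th, ev_fr]
    exact_mod_cast (congrArg (fun x : ℝ => (x : ℂ)) this).trans (by split_ifs <;> simp)

/-- The frame vector fields as derivations. -/
def e (c : S3Chart) (a : Fin 3) : Derivation ℂ (Sm c.U) (Sm c.U) := ∑ i, c.fr i a • pdS i

lemma e_apply (a : Fin 3) (f : Sm c.U) : c.e a f = ∑ i, c.fr i a * pdS i f := by
  simp [e, Fin.sum_univ_three]

lemma pdS_eq (k : Fin 3) (f : Sm c.U) : pdS k f = ∑ a, c.th a k * c.e a f := by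
  simp only [e_apply, Finset.mul_sum]
  rw [Finset.sum_comm]
  have : ∀ i, ∑ a, c.th a k * (c.fr i a * pdS i f) = (∑ a, c.fr i a * c.th a k) * pdS i f :=
    fun i => by rw [Finset.sum_mul]; exact Finset.sum_congr rfl fun a _ => by ring
  simp only [this, sum_fr_th]
  simp

/-- The covector field `w` has the frame components `v`. -/
def Rep1 (c : S3Chart) (w : (Fin 3 → ℝ) → Fin 3 → ℂ) (v : Fin 3 → Sm c.U) : Prop :=
  ∀ i, Lift (fun z => w z i) (∑ a, c.th a i * v a)

/-- The 2-tensor field `T` has the frame components `t`. -/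
def Rep2 (c : S3Chart) (T : (Fin 3 → ℝ) → Fin 3 → Fin 3 → ℂ) (t : Fin 3 → Fin 3 → Sm c.U) :
    Prop :=
  ∀ i j, Lift (fun z => T z i j) (∑ a, c.th a i * ∑ b, c.th b j * t a b)

lemma fr_contract (v : Fin 3 → Sm c.U) (b : Fin 3) :
    ∑ i, c.fr i b * ∑ a, c.th a i * v a = v b := by
  simp only [Finset.mul_sum]
  rw [Finset.sum_comm]
  have : ∀ a, ∑ i, c.fr i b * (c.th a i * v a) = (∑ i, c.th a i * c.fr i b) * v a :=
    fun i => by rw [Finset.sum_mul]; exact Finset.sum_congr rfl fun a _ => by ring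
  simp only [this, sum_th_fr]
  simp

lemma th_contract (w : Fin 3 → Sm c.U) (j : Fin 3) :
    ∑ a, c.th a j * ∑ i, c.fr i a * w i = w j := by
  simp only [Finset.mul_sum]
  rw [Finset.sum_comm]
  have : ∀ i, ∑ a, c.th a j * (c.fr i a * w i) = (∑ a, c.fr i a * c.th a j) * w i :=
    fun i => by rw [Finset.sum_mul]; exact Finset.sum_congr rfl fun a _ => by ring
  simp only [this, sum_fr_th]
  simp

lemma exists_rep1 {w : (Fin 3 → ℝ) → Fin 3 → ℂ} (hw : ∀ i, ContDiffOn ℝ ∞ (fun z => w z i) c.dom) :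
    ∃ v, c.Rep1 w v := by
  choose s hs using fun i => exists_lift (U := c.U) (hw i)
  exact ⟨fun a => ∑ i, c.fr i a * s i, fun i => by rw [th_contract]; exact hs i⟩

lemma exists_rep2 {T : (Fin 3 → ℝ) → Fin 3 → Fin 3 → ℂ}
    (hT : ∀ i j, ContDiffOn ℝ ∞ (fun z => T z i j) c.dom) : ∃ t, c.Rep2 T t := by
  choose s hs using fun i j => exists_lift (U := c.U) (hT i j)
  refine ⟨fun a b => ∑ i, c.fr i a * ∑ j, c.fr j b * s i j, fun i j => ?_⟩
  have : ∀ a, ∑ b, c.th b j * ∑ i, c.fr i a * ∑ j, c.fr j b * s i j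
      = ∑ i, c.fr i a * s i j := fun a => by
    simp only [Finset.mul_sum]
    rw [Finset.sum_comm]
    refine Finset.sum_congr rfl fun i _ => ?_
    rw [← th_contract (s i) j, Finset.mul_sum]
    refine Finset.sum_congr rfl fun b _ => ?_
    rw [Finset.mul_sum, Finset.mul_sum]
    exact Finset.sum_congr rfl fun j _ => by ring
  simp only [this, th_contract]
  exact hs i j

/-- The frame is invertible at each point. This and `rep2_inj` turn equalities of tensor fields in a
chart into equalities of frame components. -/
lemma rep1_inj {v v' : Fin 3 → Sm c.U} {w : (Fin 3 → ℝ) → Fin 3 → ℂ} (h : c.Rep1 w v)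
    (h' : c.Rep1 w v') : v = v' := funext fun b => by
  rw [← fr_contract v b, ← fr_contract v' b]
  exact Finset.sum_congr rfl fun i _ => by rw [(h i).unique (h' i)]

lemma rep2_inj {v v' : Fin 3 → Fin 3 → Sm c.U} {w : (Fin 3 → ℝ) → Fin 3 → Fin 3 → ℂ}
    (h : c.Rep2 w v) (h' : c.Rep2 w v') : v = v' := funext₂ fun a b => by
  have : ∀ j, ∑ b, c.th b j * v a b = ∑ b, c.th b j * v' a b := fun j => by
    rw [← fr_contract (fun a => ∑ b, c.th b j * v a b) a,
      ← fr_contract (fun a => ∑ b, c.th b j * v' a b) a]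
    exact Finset.sum_congr rfl fun i _ => by rw [(h i j).unique (h' i j)]
  rw [← fr_contract (v a) b, ← fr_contract (v' a) b]
  exact Finset.sum_congr rfl fun j _ => by rw [this]

end S3Chart

/-! ## Tensor calculus in a frame with `D_a e_b = ε_{abc} e_c` -/

section Frame

variable {R : Type} [CommRing R] [Algebra ℂ R] (e : Fin 3 → Derivation ℂ R R)

/-- The totally antisymmetric symbol as a complex number. -/
def eps (a b d : Fin 3) : ℂ := (leviCivita a b d : ℂ)

/-- Frame components of `D_a v_b`. -/
def cov1F (v : Fin 3 → R) (a b : Fin 3) : R := e a (v b) - ∑ d, eps a b d • v d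

/-- Frame components of `D_a t_{bd}`. -/
def cov2F (t : Fin 3 → Fin 3 → R) (a b d : Fin 3) : R :=
  e a (t b d) - ∑ m, eps a b m • t m d - ∑ m, eps a d m • t b m

/-- Frame components of the gradient. -/
def gradF (f : R) (a : Fin 3) : R := e a f

/-- Frame components of the Hessian. -/
def hessF (f : R) : Fin 3 → Fin 3 → R := cov1F e (gradF e f)

/-- The Laplacian in the frame. -/
def lapF (f : R) : R := ∑ a, hessF e f a a

/-- The divergence of a covector in the frame. -/
def div1F (v : Fin 3 → R) : R := ∑ a, cov1F e v a a

/-- The divergence of a 2-tensor in the frame. -/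
def div2F (t : Fin 3 → Fin 3 → R) (b : Fin 3) : R := ∑ a, cov2F e t a a b

/-- The trace in the frame. -/
def traceF (t : Fin 3 → Fin 3 → R) : R := ∑ a, t a a

/-- Frame components of `D_{(a} v_{b)}`. -/
def symGradF (v : Fin 3 → R) (a b : Fin 3) : R :=
  (1 / 2 : ℂ) • (cov1F e v a b + cov1F e v b a)

/-- Frame components of the metric times a function. -/
def deltaF (f : R) (a b : Fin 3) : R := if a = b then f else 0

/-- Frame components of `D_a D_b f - (1/3) γ_{ab} △ f`. -/
def LopF (f : R) (a b : Fin 3) : R := hessF e f a b - deltaF ((1 / 3 : ℂ) • lapF e f) a b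

/-- Frame components of the curl of a covector. -/
def curlF (v : Fin 3 → R) (a : Fin 3) : R := ∑ b, ∑ d, eps a b d • cov1F e v b d

/-- Frame components of the symmetrized curl of a 2-tensor. -/
def symCurlF (t : Fin 3 → Fin 3 → R) (a b : Fin 3) : R :=
  ∑ k, ∑ l, (eps a k l • cov2F e t k b l + eps b k l • cov2F e t k a l)

end Frame

/-! ### Passage from coordinate components to frame components -/

namespace S3Chart

variable {c : S3Chart} {z : Fin 3 → ℝ}

lemma Rep1.ev_eq {w : (Fin 3 → ℝ) → Fin 3 → ℂ} {v : Fin 3 → Sm c.U} (h : c.Rep1 w v) (u : c.U)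
    (i : Fin 3) : w u i = ev u (∑ a, c.th a i * v a) := h i u

lemma Rep2.ev_eq {T : (Fin 3 → ℝ) → Fin 3 → Fin 3 → ℂ} {t : Fin 3 → Fin 3 → Sm c.U}
    (h : c.Rep2 T t) (u : c.U) (i j : Fin 3) :
    T u i j = ev u (∑ a, c.th a i * ∑ b, c.th b j * t a b) := h i j u

lemma ev_pdS_th (u : c.U) (k a i : Fin 3) :
    ev u (pdS k (c.th a i)) = ((pd k (fun z => c.cofr z a i) u : ℝ) : ℂ) := by
  have h : Lift (fun z => (c.cofr z a i : ℂ)) (c.th a i) := lift_mkS _ _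
  rw [h.ev_pdS k u]
  exact pd_ofReal (differentiableAt_cofr u.2 a i) k

lemma Rep1.cov1 {w : (Fin 3 → ℝ) → Fin 3 → ℂ} {v : Fin 3 → Sm c.U} (h : c.Rep1 w v) :
    c.Rep2 (cov1 c.metric w) (cov1F c.e v) := by
  intro k i u
  have hw : ∀ m, w u m = ∑ b, (c.cofr u b m : ℂ) * ev u (v b) := fun m => by
    rw [h.ev_eq]; simp
  simp only [SchwKY.cov1, ← (h i).ev_pdS k u, hw, sum_christoffel_smul u.2]
  simp only [cov1F, Derivation.leibniz, smul_eq_mul, map_add, map_mul, map_sub, map_smul,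
    ev_pdS_th, ev_th, Fin.sum_univ_three, pdS_eq k (v 0), pdS_eq k (v 1), pdS_eq k (v 2), eps,
    leviCivita]
  push_cast
  norm_num
  ring

lemma Rep2.cov2 {T : (Fin 3 → ℝ) → Fin 3 → Fin 3 → ℂ} {t : Fin 3 → Fin 3 → Sm c.U}
    (h : c.Rep2 T t) (k i j : Fin 3) :
    Lift (fun z => cov2 c.metric T z k i j)
      (∑ a, c.th a k * ∑ b, c.th b i * ∑ d, c.th d j * cov2F c.e t a b d) := by
  intro u
  have hw : ∀ i j, T u i j = ∑ a, (c.cofr u a i : ℂ) * ∑ b, (c.cofr u b j : ℂ) * ev u (t a b) :=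
    fun i j => by rw [h.ev_eq]; simp
  have hw' : ∀ i j, T u i j = ∑ b, (c.cofr u b j : ℂ) * ∑ a, (c.cofr u a i : ℂ) * ev u (t a b) :=
    fun i j => by
      rw [hw]; simp only [Finset.mul_sum]
      rw [Finset.sum_comm]
      exact Finset.sum_congr rfl fun _ _ => Finset.sum_congr rfl fun _ _ => by ring
  simp only [SchwKY.cov2, ← (h i j).ev_pdS k u]
  have e1 := sum_christoffel_smul u.2 k i (fun a => ∑ b, (c.cofr u b j : ℂ) * ev u (t a b))
  simp only [← hw] at e1
  have e2 := sum_christoffel_smul u.2 k j (fun b => ∑ a, (c.cofr u a i : ℂ) * ev u (t a b))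
  simp only [← hw'] at e2
  rw [e1, e2]
  have hp : ∀ a b, pdS k (t a b) = ∑ d, c.th d k * c.e d (t a b) := fun a b => pdS_eq k _
  simp only [cov2F, Derivation.leibniz, smul_eq_mul, map_add, map_mul, map_sub, map_smul,
    ev_pdS_th, ev_th, Fin.sum_univ_three, hp, eps, leviCivita]
  push_cast
  norm_num
  ring

/-- The volume form with raised indices as smooth functions. -/
def volS (c : S3Chart) (i k l : Fin 3) : Sm c.U :=
  ∑ a, ∑ b, ∑ d, eps a b d • (c.th a i * c.fr k b * c.fr l d)

/-- The inverse metric as smooth functions. -/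
def invS (c : S3Chart) (i j : Fin 3) : Sm c.U := ∑ b, c.fr i b * c.fr j b

lemma ev_volS (u : c.U) (i k l : Fin 3) : ev u (c.volS i k l) = (volUp c.metric u i k l : ℂ) := by
  rw [volUp_eq u.2]
  simp only [volS, map_sum, map_smul, map_mul, ev_th, ev_fr, eps, smul_eq_mul]
  push_cast
  exact Finset.sum_congr rfl fun _ _ => Finset.sum_congr rfl fun _ _ =>
    Finset.sum_congr rfl fun _ _ => by ring

lemma ev_invS (u : c.U) (i j : Fin 3) : ev u (c.invS i j) = ((c.metric u)⁻¹ i j : ℝ) := by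
  rw [metric_inv_apply u.2]
  simp [invS]

lemma fr_contract2 (X : Fin 3 → Fin 3 → Sm c.U) (b d : Fin 3) :
    ∑ k, ∑ l, c.fr k b * c.fr l d * (∑ a, c.th a k * ∑ a', c.th a' l * X a a') = X b d := by
  have : ∀ k, ∑ l, c.fr k b * c.fr l d * (∑ a, c.th a k * ∑ a', c.th a' l * X a a')
      = c.fr k b * ∑ a, c.th a k * X a d := fun k => by
    have h1 : ∀ l, c.fr k b * c.fr l d * (∑ a, c.th a k * ∑ a', c.th a' l * X a a')
        = c.fr k b * ∑ a, c.th a k * (c.fr l d * ∑ a', c.th a' l * X a a') := fun l => by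
      rw [mul_assoc, Finset.mul_sum]
      congr 1
      exact Finset.sum_congr rfl fun _ _ => by ring
    simp only [h1, ← Finset.mul_sum]
    rw [Finset.sum_comm]
    simp only [← Finset.mul_sum, fr_contract]
  simp only [this, fr_contract]

lemma volS_contract (X : Fin 3 → Fin 3 → Sm c.U) (i : Fin 3) :
    ∑ k, ∑ l, c.volS i k l * (∑ a, c.th a k * ∑ a', c.th a' l * X a a')
      = ∑ a, c.th a i * ∑ b, ∑ d, eps a b d • X b d := by
  have h1 : ∀ k l, c.volS i k l * (∑ a, c.th a k * ∑ a', c.th a' l * X a a')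
      = ∑ a, ∑ b, ∑ d, c.th a i * (eps a b d • (c.fr k b * c.fr l d *
        (∑ a, c.th a k * ∑ a', c.th a' l * X a a'))) := fun k l => by
    simp only [volS, Finset.sum_mul]
    refine Finset.sum_congr rfl fun a _ => Finset.sum_congr rfl fun b _ =>
      Finset.sum_congr rfl fun d _ => ?_
    simp only [Algebra.smul_def]; ring
  simp only [h1]
  have h2 : ∀ a b d, ∑ k, ∑ l, c.th a i * (eps a b d • (c.fr k b * c.fr l d *
        (∑ a, c.th a k * ∑ a', c.th a' l * X a a'))) = c.th a i * eps a b d • X b d :=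
    fun a b d => by
      simp only [← Finset.mul_sum, ← Finset.smul_sum, fr_contract2]
  have h3 : ∀ a, c.th a i * ∑ b, ∑ d, eps a b d • X b d
      = ∑ b, ∑ d, c.th a i * eps a b d • X b d := fun a => by
    simp only [Finset.mul_sum]
  simp only [h3, ← h2]
  rw [Finset.sum_congr rfl fun k _ => Finset.sum_comm, Finset.sum_comm]
  refine Finset.sum_congr rfl fun a _ => ?_
  rw [Finset.sum_congr rfl fun k _ => Finset.sum_comm, Finset.sum_comm]
  refine Finset.sum_congr rfl fun b _ => ?_
  rw [Finset.sum_congr rfl fun k _ => Finset.sum_comm, Finset.sum_comm]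

lemma invS_contract (X : Fin 3 → Fin 3 → Sm c.U) :
    ∑ k, ∑ l, c.invS k l * (∑ a, c.th a k * ∑ a', c.th a' l * X a a') = ∑ b, X b b := by
  simp only [invS, Finset.sum_mul]
  rw [Finset.sum_congr rfl fun k _ => Finset.sum_comm, Finset.sum_comm]
  exact Finset.sum_congr rfl fun b _ => fr_contract2 X b b

lemma Rep2.volUp_contract {K : (Fin 3 → ℝ) → Fin 3 → Fin 3 → ℂ} {X : Fin 3 → Fin 3 → Sm c.U}
    (h : c.Rep2 K X) : c.Rep1 (fun z i => ∑ k, ∑ l, volUp c.metric z i k l • K z k l)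
      (fun a => ∑ b, ∑ d, eps a b d • X b d) := fun i u => by
  rw [← volS_contract]
  simp only [map_sum, map_mul, ev_volS]
  refine Finset.sum_congr rfl fun k _ => Finset.sum_congr rfl fun l _ => ?_
  rw [Complex.real_smul, h.ev_eq]
  simp only [map_sum, map_mul]

lemma Rep2.inv_contract {K : (Fin 3 → ℝ) → Fin 3 → Fin 3 → ℂ} {X : Fin 3 → Fin 3 → Sm c.U}
    (h : c.Rep2 K X) :
    Lift (fun z => ∑ i, ∑ j, (c.metric z)⁻¹ i j • K z i j) (∑ b, X b b) := fun u => by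
  rw [← invS_contract]
  simp only [map_sum, map_mul, ev_invS]
  refine Finset.sum_congr rfl fun k _ => Finset.sum_congr rfl fun l _ => ?_
  rw [Complex.real_smul, h.ev_eq]
  simp only [map_sum, map_mul]

lemma _root_.SchwKY.Lift.grad {f : (Fin 3 → ℝ) → ℂ} {s : Sm c.U} (h : Lift f s) :
    c.Rep1 (grad f) (gradF c.e s) := fun i u => by
  change SchwKY.pd i f u = _
  rw [h.pd i u, pdS_eq]; rfl

lemma _root_.SchwKY.Lift.hess {f : (Fin 3 → ℝ) → ℂ} {s : Sm c.U} (h : Lift f s) :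
    c.Rep2 (hess c.metric f) (hessF c.e s) := h.grad.cov1

lemma _root_.SchwKY.Lift.lap {f : (Fin 3 → ℝ) → ℂ} {s : Sm c.U} (h : Lift f s) :
    Lift (lap c.metric f) (lapF c.e s) := h.hess.inv_contract

lemma Rep1.div1 {w : (Fin 3 → ℝ) → Fin 3 → ℂ} {v : Fin 3 → Sm c.U} (h : c.Rep1 w v) :
    Lift (div1 c.metric w) (div1F c.e v) := h.cov1.inv_contract

lemma Rep2.trace2 {T : (Fin 3 → ℝ) → Fin 3 → Fin 3 → ℂ} {t : Fin 3 → Fin 3 → Sm c.U}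
    (h : c.Rep2 T t) : Lift (trace2 c.metric T) (traceF t) := h.inv_contract

lemma Rep1.curl {w : (Fin 3 → ℝ) → Fin 3 → ℂ} {v : Fin 3 → Sm c.U} (h : c.Rep1 w v) :
    c.Rep1 (curl c.metric w) (curlF c.e v) := h.cov1.volUp_contract

lemma Rep1.symGrad {w : (Fin 3 → ℝ) → Fin 3 → ℂ} {v : Fin 3 → Sm c.U} (h : c.Rep1 w v) :
    c.Rep2 (symGrad c.metric w) (symGradF c.e v) := fun i j u => by
  have := h.cov1 i j u
  have h2 := h.cov1 j i u
  simp only [SchwKY.symGrad] at this h2 ⊢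
  rw [this, h2, Complex.real_smul]
  simp only [symGradF, map_mul, map_smul, map_add, Fin.sum_univ_three, ev_th, smul_eq_mul]
  push_cast
  ring

lemma rep2_delta {f : (Fin 3 → ℝ) → ℂ} {s : Sm c.U} (h : Lift f s) :
    c.Rep2 (fun z i j => c.metric z i j • f z) (deltaF s) := fun i j u => by
  simp only [metric_eq u.2, Complex.real_smul, h u, deltaF]
  simp [Fin.sum_univ_three]
  ring

lemma Rep2.sub {T T' : (Fin 3 → ℝ) → Fin 3 → Fin 3 → ℂ} {t t' : Fin 3 → Fin 3 → Sm c.U}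
    (h : c.Rep2 T t) (h' : c.Rep2 T' t') :
    c.Rep2 (fun z i j => T z i j - T' z i j) (fun a b => t a b - t' a b) := fun i j u => by
  have h1 := h i j u; have h2 := h' i j u
  simp only at h1 h2 ⊢
  rw [h1, h2]; simp only [mul_sub, Finset.sum_sub_distrib, map_sub]

lemma Rep2.add {T T' : (Fin 3 → ℝ) → Fin 3 → Fin 3 → ℂ} {t t' : Fin 3 → Fin 3 → Sm c.U}
    (h : c.Rep2 T t) (h' : c.Rep2 T' t') :
    c.Rep2 (fun z i j => T z i j + T' z i j) (fun a b => t a b + t' a b) := fun i j u => by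
  have h1 := h i j u; have h2 := h' i j u
  simp only at h1 h2 ⊢
  rw [h1, h2]; simp only [mul_add, Finset.sum_add_distrib, map_add]

lemma Rep1.add {w w' : (Fin 3 → ℝ) → Fin 3 → ℂ} {v v' : Fin 3 → Sm c.U}
    (h : c.Rep1 w v) (h' : c.Rep1 w' v') :
    c.Rep1 (fun z i => w z i + w' z i) (fun a => v a + v' a) := fun i u => by
  have h1 := h i u; have h2 := h' i u
  simp only at h1 h2 ⊢
  rw [h1, h2]; simp only [mul_add, Finset.sum_add_distrib, map_add]

lemma Rep1.const_mul {w : (Fin 3 → ℝ) → Fin 3 → ℂ} {v : Fin 3 → Sm c.U}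
    (h : c.Rep1 w v) (r : ℂ) :
    c.Rep1 (fun z i => r * w z i) (fun a => r • v a) := fun i u => by
  have h1 := h i u
  simp only at h1 ⊢
  rw [h1]; simp only [mul_smul_comm, ← Finset.smul_sum, map_smul, smul_eq_mul]

lemma Rep2.const_mul {T : (Fin 3 → ℝ) → Fin 3 → Fin 3 → ℂ} {t : Fin 3 → Fin 3 → Sm c.U}
    (h : c.Rep2 T t) (r : ℂ) :
    c.Rep2 (fun z i j => r * T z i j) (fun a b => r • t a b) := fun i j u => by
  have h1 := h i j u
  simp only at h1 ⊢
  rw [h1]; simp only [mul_smul_comm, ← Finset.smul_sum, map_smul, smul_eq_mul]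

lemma Rep1.congr {w w' : (Fin 3 → ℝ) → Fin 3 → ℂ} {v v' : Fin 3 → Sm c.U}
    (h : c.Rep1 w v) (hw : ∀ z ∈ c.dom, ∀ i, w' z i = w z i) (hv : ∀ a, v' a = v a) :
    c.Rep1 w' v' := fun i u => by simpa only [hv, hw u u.2 i] using h i u

lemma Rep2.congr {T T' : (Fin 3 → ℝ) → Fin 3 → Fin 3 → ℂ} {t t' : Fin 3 → Fin 3 → Sm c.U}
    (h : c.Rep2 T t) (hw : ∀ z ∈ c.dom, ∀ i j, T' z i j = T z i j)
    (hv : ∀ a b, t' a b = t a b) : c.Rep2 T' t' :=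
  fun i j u => by simpa only [hv, hw u u.2 i j] using h i j u

lemma _root_.SchwKY.Lift.Lop {f : (Fin 3 → ℝ) → ℂ} {s : Sm c.U} (h : Lift f s) :
    c.Rep2 (Lop c.metric f) (LopF c.e s) := by
  refine (h.hess.sub (rep2_delta (h.lap.const_smul (1 / 3)))).congr (fun z _ i j => ?_)
    fun _ _ => rfl
  simp only [SchwKY.Lop, Complex.real_smul]
  push_cast; ring

lemma Rep2.div2 {T : (Fin 3 → ℝ) → Fin 3 → Fin 3 → ℂ} {t : Fin 3 → Fin 3 → Sm c.U}
    (h : c.Rep2 T t) : c.Rep1 (div2 c.metric T) (div2F c.e t) := fun j => by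
  have : c.Rep2 (fun z k i => SchwKY.cov2 c.metric T z k i j)
      (fun a b => ∑ d, c.th d j * cov2F c.e t a b d) := fun k i => h.cov2 k i j
  have h2 := this.inv_contract
  rw [Finset.sum_comm] at h2
  simp only [← Finset.mul_sum] at h2
  exact h2

lemma Rep2.symCurl {T : (Fin 3 → ℝ) → Fin 3 → Fin 3 → ℂ} {t : Fin 3 → Fin 3 → Sm c.U}
    (h : c.Rep2 T t) : c.Rep2 (symCurl c.metric T) (symCurlF c.e t) := by
  have key : ∀ i j, Lift (fun z => ∑ k, ∑ l, volUp c.metric z i k l • SchwKY.cov2 c.metric T z k j l)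
      (∑ a, c.th a i * ∑ b, c.th b j * ∑ k, ∑ l, eps a k l • cov2F c.e t k b l) := fun i j => by
    have h1 : c.Rep2 (fun z k l => SchwKY.cov2 c.metric T z k j l)
        (fun a d => ∑ b, c.th b j * cov2F c.e t a b d) := fun k l u => by
      have := h.cov2 k j l u
      simp only at this ⊢
      rw [this]
      simp only [Fin.sum_univ_three]
      congr 1
      ring
    have h2 := h1.volUp_contract i
    refine fun u => (h2 u).trans ?_
    congr 1
    refine Finset.sum_congr rfl fun a _ => ?_
    simp only [Fin.sum_univ_three, Algebra.smul_def]
    ring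
  intro i j u
  have h1 := key i j u
  have h2 := key j i u
  simp only at h1 h2
  simp only [SchwKY.symCurl, Finset.sum_add_distrib, h1, h2, symCurlF]
  rw [← map_add]
  congr 1
  simp only [mul_add, Finset.sum_add_distrib]
  congr 1
  simp only [Finset.mul_sum]
  rw [Finset.sum_comm]
  simp only [← Finset.mul_sum]
  refine Finset.sum_congr rfl fun _ _ => ?_
  simp only [Finset.mul_sum]
  refine Finset.sum_congr rfl fun _ _ => Finset.sum_congr rfl fun _ _ =>
    Finset.sum_congr rfl fun _ _ => by ring

end S3Chart

/-! ### Differential identities of curl, divergence and symmetrized gradient in the frame -/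

section Frame

variable {R : Type} [CommRing R] [Algebra ℂ R]

lemma sum_eps_smul (a b : Fin 3) (v : Fin 3 → R) : ∑ d, eps a b d • v d
    = ![![0, v 2, -v 1], ![-v 2, 0, v 0], ![v 1, -v 0, 0]] a b := by
  fin_cases a <;> fin_cases b <;> norm_num [eps, leviCivita, Fin.sum_univ_three]

lemma sum_sum_eps_smul (a : Fin 3) (x : Fin 3 → Fin 3 → R) : ∑ b, ∑ d, eps a b d • x b d
    = ![x 1 2 - x 2 1, x 2 0 - x 0 2, x 0 1 - x 1 0] a := by
  fin_cases a <;> norm_num [eps, leviCivita, Fin.sum_univ_three] <;> abel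

/-- The commutation relations of the left-invariant frame. -/
structure FrameComm (e : Fin 3 → Derivation ℂ R R) : Prop where
  c10 : ∀ f, e 1 (e 0 f) = e 0 (e 1 f) - (2 : ℂ) • e 2 f
  c20 : ∀ f, e 2 (e 0 f) = e 0 (e 2 f) + (2 : ℂ) • e 1 f
  c21 : ∀ f, e 2 (e 1 f) = e 1 (e 2 f) - (2 : ℂ) • e 0 f

variable {e : Fin 3 → Derivation ℂ R R}

lemma fin3_cases (a : Fin 3) : a = 0 ∨ a = 1 ∨ a = 2 := by revert a; decide

lemma cov1F_eq (v : Fin 3 → R) (a b : Fin 3) : cov1F e v a b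
    = e a (v b) - ![![0, v 2, -v 1], ![-v 2, 0, v 0], ![v 1, -v 0, 0]] a b := by
  rw [cov1F, sum_eps_smul]

lemma cov2F_eq (t : Fin 3 → Fin 3 → R) (a b d : Fin 3) : cov2F e t a b d
    = e a (t b d) - ![![0, t 2 d, -t 1 d], ![-t 2 d, 0, t 0 d], ![t 1 d, -t 0 d, 0]] a b
      - ![![0, t b 2, -t b 1], ![-t b 2, 0, t b 0], ![t b 1, -t b 0, 0]] a d := by
  rw [cov2F, sum_eps_smul a b (fun m => t m d), sum_eps_smul a d (fun m => t b m)]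

lemma curlF_eq (v : Fin 3 → R) (a : Fin 3) : curlF e v a
    = ![e 1 (v 2) - e 2 (v 1) - (2 : ℂ) • v 0, e 2 (v 0) - e 0 (v 2) - (2 : ℂ) • v 1,
        e 0 (v 1) - e 1 (v 0) - (2 : ℂ) • v 2] a := by
  rw [curlF, sum_sum_eps_smul]
  rcases fin3_cases a with rfl | rfl | rfl <;> simp [cov1F_eq] <;> module

lemma symCurlF_eq (t : Fin 3 → Fin 3 → R) (a b : Fin 3) : symCurlF e t a b
    = ![cov2F e t 1 b 2 - cov2F e t 2 b 1, cov2F e t 2 b 0 - cov2F e t 0 b 2,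
        cov2F e t 0 b 1 - cov2F e t 1 b 0] a
      + ![cov2F e t 1 a 2 - cov2F e t 2 a 1, cov2F e t 2 a 0 - cov2F e t 0 a 2,
        cov2F e t 0 a 1 - cov2F e t 1 a 0] b := by
  simp only [symCurlF, Finset.sum_add_distrib]
  rw [sum_sum_eps_smul a fun k l => cov2F e t k b l, sum_sum_eps_smul b fun k l => cov2F e t k a l]

lemma div1F_eq (v : Fin 3 → R) : div1F e v = e 0 (v 0) + e 1 (v 1) + e 2 (v 2) := by
  simp [div1F, cov1F_eq, Fin.sum_univ_three]

lemma div2F_eq {t : Fin 3 → Fin 3 → R} (ht : ∀ a b, t a b = t b a) (b : Fin 3) :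
    div2F e t b = e 0 (t 0 b) + e 1 (t 1 b) + e 2 (t 2 b) := by
  have h10 := ht 1 0; have h20 := ht 2 0; have h21 := ht 2 1
  simp only [div2F, cov2F_eq, Fin.sum_univ_three]
  rcases fin3_cases b with rfl | rfl | rfl <;> simp [h10, h20, h21] <;> ring

/-- The commutator of two frame derivatives is twice the third, which is exactly the connection term
of the curl. -/
lemma curlF_gradF (h : FrameComm e) (f : R) (a : Fin 3) : curlF e (gradF e f) a = 0 := by
  rcases fin3_cases a with rfl | rfl | rfl <;>
    simp [curlF_eq, gradF, h.c10, h.c20, h.c21]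

lemma symGradF_symm (v : Fin 3 → R) (a b : Fin 3) : symGradF e v a b = symGradF e v b a := by
  rw [symGradF, symGradF, add_comm]

lemma symGradF_eq (v : Fin 3 → R) (a b : Fin 3) :
    symGradF e v a b = (1 / 2 : ℂ) • (e a (v b) + e b (v a)) := by
  rw [symGradF, cov1F_eq, cov1F_eq]
  rcases fin3_cases a with rfl | rfl | rfl <;> rcases fin3_cases b with rfl | rfl | rfl <;>
    simp

lemma symCurlF_symm (t : Fin 3 → Fin 3 → R) (a b : Fin 3) :
    symCurlF e t a b = symCurlF e t b a := by
  rw [symCurlF_eq, symCurlF_eq, add_comm]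

/-- The symmetrized curl of a symmetric tensor. -/
lemma symCurlF_eq_of_symm {t : Fin 3 → Fin 3 → R} (ht : ∀ a b, t a b = t b a) (a b : Fin 3) :
    symCurlF e t a b
    = ![e 1 (t b 2) - e 2 (t b 1), e 2 (t b 0) - e 0 (t b 2), e 0 (t b 1) - e 1 (t b 0)] a
      + ![e 1 (t a 2) - e 2 (t a 1), e 2 (t a 0) - e 0 (t a 2), e 0 (t a 1) - e 1 (t a 0)] b
      - (6 : ℂ) • t a b + if a = b then (2 : ℂ) • (t 0 0 + t 1 1 + t 2 2) else 0 := by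
  have h10 := ht 1 0; have h20 := ht 2 0; have h21 := ht 2 1
  rw [symCurlF_eq]
  simp only [cov2F_eq]
  rcases fin3_cases a with rfl | rfl | rfl <;> rcases fin3_cases b with rfl | rfl | rfl <;>
    simp [h10, h20, h21] <;> module

lemma symm_ext {s t : Fin 3 → Fin 3 → R} (hs : ∀ a b, s a b = s b a) (ht : ∀ a b, t a b = t b a)
    (h00 : s 0 0 = t 0 0) (h01 : s 0 1 = t 0 1) (h02 : s 0 2 = t 0 2) (h11 : s 1 1 = t 1 1)
    (h12 : s 1 2 = t 1 2) (h22 : s 2 2 = t 2 2) (a b : Fin 3) : s a b = t a b := by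
  rcases fin3_cases a with rfl | rfl | rfl <;> rcases fin3_cases b with rfl | rfl | rfl <;>
    first | assumption | (rw [hs, ht]; assumption)

/-- After the derivatives are put in a common order the first- and zeroth-order terms agree as well,
the curvature being constant. This identity governs the pieces `h_{T i}` and the harmonics `T1`,
`T2`. -/
lemma symCurlF_symGradF (h : FrameComm e) (v : Fin 3 → R) (a b : Fin 3) :
    symCurlF e (symGradF e v) a b = symGradF e (curlF e v) a b := by
  refine symm_ext (symCurlF_symm _) (symGradF_symm _) ?_ ?_ ?_ ?_ ?_ ?_ a b <;>
  · rw [symCurlF_eq_of_symm (symGradF_symm _)]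
    simp only [symGradF_eq, curlF_eq]
    simp [h.c10, h.c20, h.c21]
    module

lemma deltaF_symm (f : R) (a b : Fin 3) : deltaF f a b = deltaF f b a := by
  simp only [deltaF, eq_comm]

/-- Before symmetrization one has `ε_{akb} D_k f`, which is antisymmetric in `a, b`. -/
lemma symCurlF_deltaF (f : R) (a b : Fin 3) : symCurlF e (deltaF f) a b = 0 := by
  rw [symCurlF_eq_of_symm (deltaF_symm _)]
  rcases fin3_cases a with rfl | rfl | rfl <;> rcases fin3_cases b with rfl | rfl | rfl <;>
    simp [deltaF] <;> module

lemma div1F_curlF (h : FrameComm e) (v : Fin 3 → R) : div1F e (curlF e v) = 0 := by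
  simp [div1F_eq, curlF_eq, h.c10, h.c20, h.c21]
  module

/-- The trace contracts `ε` with the symmetric indices of `t`. -/
lemma traceF_symCurlF {t : Fin 3 → Fin 3 → R} (ht : ∀ a b, t a b = t b a) :
    traceF (symCurlF e t) = 0 := by
  have h10 := ht 1 0; have h20 := ht 2 0; have h21 := ht 2 1
  simp [traceF, Fin.sum_univ_three, symCurlF_eq_of_symm ht, h10, h20, h21]
  module

/-- No trace condition is needed: reordering the second derivatives of `t` leaves precisely the curl
of its divergence. Hence symmetrized curls of transverse tensors are transverse. -/
lemma div2F_symCurlF (h : FrameComm e) {t : Fin 3 → Fin 3 → R} (ht : ∀ a b, t a b = t b a)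
    (b : Fin 3) : div2F e (symCurlF e t) b = curlF e (div2F e t) b := by
  have h10 := ht 1 0; have h20 := ht 2 0; have h21 := ht 2 1
  rw [div2F_eq (symCurlF_symm _), curlF_eq]
  simp only [div2F_eq ht, symCurlF_eq_of_symm ht]
  rcases fin3_cases b with rfl | rfl | rfl <;>
    simp [h10, h20, h21, h.c10, h.c20, h.c21] <;> module

lemma hessF_symm (h : FrameComm e) (f : R) (a b : Fin 3) : hessF e f a b = hessF e f b a := by
  rw [hessF, cov1F_eq, cov1F_eq]
  rcases fin3_cases a with rfl | rfl | rfl <;> rcases fin3_cases b with rfl | rfl | rfl <;>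
    simp [gradF, h.c10, h.c20, h.c21] <;> module

lemma symGradF_gradF (h : FrameComm e) (f : R) (a b : Fin 3) :
    symGradF e (gradF e f) a b = hessF e f a b := by
  have := hessF_symm h f b a
  change (1 / 2 : ℂ) • (hessF e f a b + hessF e f b a) = _
  rw [this]; module

lemma cov1F_add (v w : Fin 3 → R) (a b : Fin 3) :
    cov1F e (fun a => v a + w a) a b = cov1F e v a b + cov1F e w a b := by
  simp only [cov1F, map_add, smul_add, Finset.sum_add_distrib]; ring

lemma cov1F_smul (r : ℂ) (v : Fin 3 → R) (a b : Fin 3) :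
    cov1F e (fun a => r • v a) a b = r • cov1F e v a b := by
  simp only [cov1F, Derivation.map_smul, smul_sub, Finset.smul_sum, smul_comm r]

lemma cov2F_add (s t : Fin 3 → Fin 3 → R) (a b d : Fin 3) :
    cov2F e (fun a b => s a b + t a b) a b d = cov2F e s a b d + cov2F e t a b d := by
  simp only [cov2F, map_add, smul_add, Finset.sum_add_distrib]; ring

lemma cov2F_smul (r : ℂ) (t : Fin 3 → Fin 3 → R) (a b d : Fin 3) :
    cov2F e (fun a b => r • t a b) a b d = r • cov2F e t a b d := by
  simp only [cov2F, Derivation.map_smul, smul_sub, Finset.smul_sum, smul_comm r]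

lemma curlF_add (v w : Fin 3 → R) (a : Fin 3) :
    curlF e (fun a => v a + w a) a = curlF e v a + curlF e w a := by
  simp only [curlF, cov1F_add, smul_add, Finset.sum_add_distrib]

lemma curlF_smul (r : ℂ) (v : Fin 3 → R) (a : Fin 3) :
    curlF e (fun a => r • v a) a = r • curlF e v a := by
  simp only [curlF, cov1F_smul, Finset.smul_sum, smul_comm r]

lemma symGradF_smul (r : ℂ) (v : Fin 3 → R) (a b : Fin 3) :
    symGradF e (fun a => r • v a) a b = r • symGradF e v a b := by
  simp only [symGradF, cov1F_smul, smul_add, smul_comm r]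

lemma symCurlF_add (s t : Fin 3 → Fin 3 → R) (a b : Fin 3) :
    symCurlF e (fun a b => s a b + t a b) a b = symCurlF e s a b + symCurlF e t a b := by
  simp only [symCurlF, cov2F_add, smul_add, Finset.sum_add_distrib]; ring

lemma symCurlF_smul (r : ℂ) (t : Fin 3 → Fin 3 → R) (a b : Fin 3) :
    symCurlF e (fun a b => r • t a b) a b = r • symCurlF e t a b := by
  simp only [symCurlF, cov2F_smul, Finset.smul_sum, smul_add, smul_comm r]

/-- The Hessian is the symmetrized gradient of a gradient, and gradients have no curl. -/
lemma symCurlF_hessF (h : FrameComm e) (f : R) (a b : Fin 3) : symCurlF e (hessF e f) a b = 0 := by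
  have h1 : hessF e f = symGradF e (gradF e f) := funext₂ fun a b => (symGradF_gradF h f a b).symm
  have h2 : curlF e (gradF e f) = fun _ => 0 := funext (curlF_gradF h f)
  rw [h1, symCurlF_symGradF h, h2]
  simp [symGradF, cov1F]

lemma symCurlF_LopF (h : FrameComm e) (f : R) (a b : Fin 3) : symCurlF e (LopF e f) a b = 0 := by
  have : LopF e f = fun a b => hessF e f a b + (-1 : ℂ) • deltaF ((1 / 3 : ℂ) • lapF e f) a b :=
    funext₂ fun a b => by rw [LopF]; module
  rw [this, symCurlF_add, symCurlF_smul, symCurlF_hessF h, symCurlF_deltaF]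
  simp

end Frame

/-! ### Commutators of the frame in a chart -/

namespace S3Chart

lemma hess_symm (c : S3Chart) {f : (Fin 3 → ℝ) → ℂ} (hf : ContDiffOn ℝ ∞ f c.dom)
    {z : Fin 3 → ℝ} (hz : z ∈ c.dom) (i j : Fin 3) :
    hess c.metric f z i j = hess c.metric f z j i := by
  change pd i (fun z => pd j f z) z - _ = pd j (fun z => pd i f z) z - _
  rw [show pd i (fun z => pd j f z) z = pd j (fun z => pd i f z) z from
    pd_comm (hf.contDiffAt (c.isOpen_dom.mem_nhds hz)) i j]
  simp only [christoffel_comm c.metric_symm z _ i j]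

/-- The brackets are not computed from the coefficients of the frame. The Hessian is symmetric in
coordinates, hence in the frame, and the antisymmetric part of `e_a e_b f - ε_{abd} e_d f` is the
commutation relation. -/
lemma frameComm (c : S3Chart) : FrameComm c.e := by
  have key : ∀ (f : Sm c.U) a b, hessF c.e f a b = hessF c.e f b a := fun f a b => by
    have h := (lift_rep f).hess
    have h' : c.Rep2 (hess c.metric (rep f)) (fun a b => hessF c.e f b a) := fun i j u => by
      have := h.ev_eq u j i
      change hess c.metric (rep f) u i j = _
      rw [hess_symm c (contDiffOn_rep f) u.2, this]
      congr 1
      simp only [Finset.mul_sum]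
      rw [Finset.sum_comm]
      exact Finset.sum_congr rfl fun _ _ => Finset.sum_congr rfl fun _ _ => by ring
    exact congrFun₂ (rep2_inj h h') a b
  constructor
  · intro f
    have := key f 1 0
    simp [hessF, cov1F, gradF, sum_eps_smul] at this
    linear_combination (exp := 1) this + (by module : (2 : ℂ) • c.e 2 f = c.e 2 f + c.e 2 f)
  · intro f
    have := key f 2 0
    simp [hessF, cov1F, gradF, sum_eps_smul] at this
    linear_combination (exp := 1) this - (by module : (2 : ℂ) • c.e 1 f = c.e 1 f + c.e 1 f)
  · intro f
    have := key f 2 1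
    simp [hessF, cov1F, gradF, sum_eps_smul] at this
    linear_combination (exp := 1) this + (by module : (2 : ℂ) • c.e 0 f = c.e 0 f + c.e 0 f)

end S3Chart

/-! ## The symmetry operator on the Schwarzschild spacetime -/

section Spacetime

/-- The inclusion of the sphere coordinates into the spacetime coordinates. -/
def inclZ : (Fin 3 → ℝ) →L[ℝ] (Idx5 → ℝ) :=
  ContinuousLinearMap.pi fun μ => Sum.elim (fun _ => 0) (fun i => ContinuousLinearMap.proj i) μ

/-- The inclusion of the orbit space coordinates into the spacetime coordinates. -/
def inclY : (Fin 2 → ℝ) →L[ℝ] (Idx5 → ℝ) :=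
  ContinuousLinearMap.pi fun μ => Sum.elim (fun i => ContinuousLinearMap.proj i) (fun _ => 0) μ

lemma elim_eq (y : Fin 2 → ℝ) (z : Fin 3 → ℝ) :
    (Sum.elim y z : Idx5 → ℝ) = inclY y + inclZ z := by
  funext μ
  rcases μ with a | i <;> simp [inclY, inclZ]

lemma elim_yOf_zOf (x : Idx5 → ℝ) : Sum.elim (yOf x) (zOf x) = x := by
  funext μ
  rcases μ with a | i <;> simp [yOf, zOf]

lemma inclZ_single (k : Fin 3) : inclZ (Pi.single k 1) = Pi.single (Sum.inr k) 1 := by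
  funext μ
  rcases μ with a | i
  · simp [inclZ]
  · simp [inclZ, Pi.single_apply]

lemma inclY_single (a : Fin 2) : inclY (Pi.single a 1) = Pi.single (Sum.inl a) 1 := by
  funext μ
  rcases μ with b | i
  · simp [inclY, Pi.single_apply]
  · simp [inclY]

variable {E : Type} [NormedAddCommGroup E] [NormedSpace ℝ E]

lemma pd_inr {f : (Idx5 → ℝ) → E} {x : Idx5 → ℝ} (hf : DifferentiableAt ℝ f x) (k : Fin 3) :
    pd (Sum.inr k) f x = pd k (fun z => f (Sum.elim (yOf x) z)) (zOf x) := by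
  have h1 : HasFDerivAt (fun z => (Sum.elim (yOf x) z : Idx5 → ℝ)) inclZ (zOf x) := by
    simp only [elim_eq]
    exact inclZ.hasFDerivAt.const_add _
  have hf' : HasFDerivAt f (fderiv ℝ f x) (Sum.elim (yOf x) (zOf x)) := by
    rw [elim_yOf_zOf]; exact hf.hasFDerivAt
  have h2 := hf'.comp (zOf x) h1
  rw [pd, pd]
  change _ = fderiv ℝ (f ∘ fun z => Sum.elim (yOf x) z) _ _
  rw [h2.fderiv, ContinuousLinearMap.comp_apply, inclZ_single]

lemma pd_inl {f : (Idx5 → ℝ) → E} {x : Idx5 → ℝ} (hf : DifferentiableAt ℝ f x) (a : Fin 2) :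
    pd (Sum.inl a) f x = pd a (fun y => f (Sum.elim y (zOf x))) (yOf x) := by
  have h1 : HasFDerivAt (fun y => (Sum.elim y (zOf x) : Idx5 → ℝ)) inclY (yOf x) := by
    simp only [elim_eq]
    exact inclY.hasFDerivAt.add_const _
  have hf' : HasFDerivAt f (fderiv ℝ f x) (Sum.elim (yOf x) (zOf x)) := by
    rw [elim_yOf_zOf]; exact hf.hasFDerivAt
  have h2 := hf'.comp (yOf x) h1
  rw [pd, pd]
  change _ = fderiv ℝ (f ∘ fun y => Sum.elim y (zOf x)) _ _
  rw [h2.fderiv, ContinuousLinearMap.comp_apply, inclY_single]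

lemma isOpen_regionY (M : ℝ) : IsOpen (regionY M) := by
  have h0 : IsOpen {y : Fin 2 → ℝ | 0 < y 1} := isOpen_lt continuous_const (continuous_apply 1)
  have hc : ContinuousOn (fun y : Fin 2 → ℝ => schwF M (y 1)) {y | 0 < y 1} := by
    unfold schwF
    refine continuousOn_const.sub (continuousOn_const.div (by fun_prop) fun y hy => ?_)
    exact pow_ne_zero 2 (ne_of_gt hy)
  exact hc.isOpen_inter_preimage h0 isOpen_compl_singleton

lemma contDiff_yOf : ContDiff ℝ ∞ yOf := by unfold yOf; fun_prop

lemma contDiff_zOf : ContDiff ℝ ∞ zOf := by unfold zOf; fun_prop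

lemma isOpen_region (M : ℝ) (c : S3Chart) : IsOpen (region M c) :=
  ((isOpen_regionY M).preimage contDiff_yOf.continuous).inter
    (c.isOpen_dom.preimage contDiff_zOf.continuous)

variable {M : ℝ} {c : S3Chart} {x : Idx5 → ℝ}

lemma metric_mul_inv {z : Fin 3 → ℝ} (hz : z ∈ c.dom) : c.metric z * (c.metric z)⁻¹ = 1 := by
  refine Matrix.mul_nonsing_inv _ ?_
  rw [S3Chart.metric_eq_mul hz, Matrix.det_mul, Matrix.det_transpose]
  exact (S3Chart.isUnit_det hz).mul (S3Chart.isUnit_det hz)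

lemma schwMetric_inv (hx : x ∈ region M c) : (schwMetric M c x)⁻¹ =
    Matrix.fromBlocks !![-(schwF M (x (Sum.inl 1)))⁻¹, 0; 0, schwF M (x (Sum.inl 1))] 0 0
      ((x (Sum.inl 1) ^ 2)⁻¹ • (c.metric (zOf x))⁻¹) := by
  have hF : schwF M (x (Sum.inl 1)) ≠ 0 := hx.1.2
  have hr : x (Sum.inl 1) ≠ 0 := ne_of_gt hx.1.1
  apply Matrix.inv_eq_right_inv
  rw [schwMetric, Matrix.fromBlocks_multiply]
  simp only [Matrix.mul_zero, Matrix.zero_mul, add_zero, zero_add, Matrix.smul_mul,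
    Matrix.mul_smul, metric_mul_inv hx.2]
  rw [← Matrix.fromBlocks_one]
  congr 1
  · ext i j; fin_cases i <;> fin_cases j <;> simp [hF]
  · simp
  · rw [smul_smul, inv_mul_cancel₀ (pow_ne_zero 2 hr), one_smul]

/-- The factor `r⁴` of the form is cancelled by the two factors `r⁻²` of the inverse metric, so no
trace of `r` remains. -/
lemma kyUp_inr (hx : x ∈ region M c) (i k l : Fin 3) :
    kyUp M c x (Sum.inr i) (Sum.inr k) (Sum.inr l) = volUp c.metric (zOf x) i k l := by
  have hr : x (Sum.inl 1) ≠ 0 := ne_of_gt hx.1.1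
  simp only [kyUp, volUp, Fintype.sum_sum_type, schwMetric_inv hx, Matrix.fromBlocks_apply₂₂,
    kyForm, zero_mul, Finset.sum_const_zero, zero_add, Matrix.smul_apply, smul_eq_mul]
  refine Finset.sum_congr rfl fun _ _ => Finset.sum_congr rfl fun _ _ => ?_
  field_simp

lemma kyUp_inl (κ τ : Idx5) (a : Fin 2) : kyUp M c x (Sum.inl a) κ τ = 0 := by
  simp [kyUp, kyForm]

lemma kyUp_inr_inl (hx : x ∈ region M c) (i : Fin 3) (a : Fin 2) (τ : Idx5) :
    kyUp M c x (Sum.inr i) (Sum.inl a) τ = 0 := by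
  simp [kyUp, kyForm, schwMetric_inv hx, Fintype.sum_sum_type]

lemma kyUp_inr_inr_inl (hx : x ∈ region M c) (i : Fin 3) (a : Fin 2) (κ : Idx5) :
    kyUp M c x (Sum.inr i) κ (Sum.inl a) = 0 := by
  simp [kyUp, kyForm, schwMetric_inv hx, Fintype.sum_sum_type]

lemma sum_kyUp_smul (hx : x ∈ region M c) (i : Fin 3) (X : Idx5 → Idx5 → ℂ) :
    ∑ κ, ∑ τ, kyUp M c x (Sum.inr i) κ τ • X κ τ
      = ∑ k, ∑ l, volUp c.metric (zOf x) i k l • X (Sum.inr k) (Sum.inr l) := by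
  simp [Fintype.sum_sum_type, kyUp_inr hx, kyUp_inr_inl hx, kyUp_inr_inr_inl hx]

lemma vol_antisymm (G : (Fin 3 → ℝ) → Matrix (Fin 3) (Fin 3) ℝ) (z : Fin 3 → ℝ) (i k l : Fin 3) :
    vol G z i l k = -vol G z i k l := by
  simp only [vol, leviCivita]; ring

lemma vol_antisymm' (G : (Fin 3 → ℝ) → Matrix (Fin 3) (Fin 3) ℝ) (z : Fin 3 → ℝ)
    (i k l : Fin 3) : vol G z k i l = -vol G z i k l := by
  simp only [vol, leviCivita]; ring

lemma volUp_antisymm (G : (Fin 3 → ℝ) → Matrix (Fin 3) (Fin 3) ℝ) (z : Fin 3 → ℝ)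
    (i k l : Fin 3) : volUp G z i l k = -volUp G z i k l := by
  simp only [volUp]
  rw [Finset.sum_comm, ← Finset.sum_neg_distrib]
  refine Finset.sum_congr rfl fun a _ => ?_
  rw [← Finset.sum_neg_distrib]
  refine Finset.sum_congr rfl fun b _ => ?_
  rw [vol_antisymm]; ring

lemma sum_volUp_symm {G : (Fin 3 → ℝ) → Matrix (Fin 3) (Fin 3) ℝ} {z : Fin 3 → ℝ}
    {X : Fin 3 → Fin 3 → ℂ} (hX : ∀ k l, X k l = X l k) (i : Fin 3) :
    ∑ k, ∑ l, volUp G z i k l • X k l = 0 := by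
  have h : ∑ k, ∑ l, volUp G z i k l • X k l = -∑ k, ∑ l, volUp G z i k l • X k l := by
    conv_lhs => rw [Finset.sum_comm]
    rw [← Finset.sum_neg_distrib]
    refine Finset.sum_congr rfl fun a _ => ?_
    rw [← Finset.sum_neg_distrib]
    refine Finset.sum_congr rfl fun b _ => ?_
    rw [volUp_antisymm, hX b a, neg_smul]
  exact self_eq_neg.1 h

/-- Under `ε_i^{kl}` anything symmetric in `k, l` may be dropped. This is how torsion-free
connection terms disappear from the curls. -/
lemma sum_volUp_congr {G : (Fin 3 → ℝ) → Matrix (Fin 3) (Fin 3) ℝ} {z : Fin 3 → ℝ}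
    {X Y : Fin 3 → Fin 3 → ℂ} (hX : ∀ k l, X k l - Y k l = X l k - Y l k) (i : Fin 3) :
    ∑ k, ∑ l, volUp G z i k l • X k l = ∑ k, ∑ l, volUp G z i k l • Y k l := by
  rw [← sub_eq_zero, ← Finset.sum_sub_distrib]
  simp only [← Finset.sum_sub_distrib, ← smul_sub]
  exact sum_volUp_symm hX i

/-- Lowering an index of `ε_i^{kl}` produces `ε_{ij}^l`, whose antisymmetry in `i, j` removes it
from the symmetrized expression for `Z_{ij}`. -/
lemma sum_volUp_metric {z : Fin 3 → ℝ} (hz : z ∈ c.dom) (i j l : Fin 3) :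
    ∑ k, volUp c.metric z i k l * c.metric z k j
      = ∑ l', vol c.metric z i j l' * (c.metric z)⁻¹ l' l := by
  have hinv : ∀ k', ∑ k, (c.metric z)⁻¹ k' k * c.metric z k j = if k' = j then 1 else 0 := by
    intro k'
    have h := mul_eq_one_comm.1 (metric_mul_inv hz)
    have := congrFun₂ h k' j
    rwa [Matrix.mul_apply, Matrix.one_apply] at this
  simp only [volUp, Finset.sum_mul]
  rw [Finset.sum_comm]
  have : ∀ k', ∑ k, ∑ l', vol c.metric z i k' l' * (c.metric z)⁻¹ k' k * (c.metric z)⁻¹ l' l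
        * c.metric z k j
      = (∑ l', vol c.metric z i k' l' * (c.metric z)⁻¹ l' l) * if k' = j then 1 else 0 :=
    fun k' => by
      rw [← hinv, Finset.mul_sum]
      refine Finset.sum_congr rfl fun k _ => ?_
      rw [Finset.sum_mul]
      exact Finset.sum_congr rfl fun l' _ => by ring
  simp only [this]
  simp

lemma schwMetric_symm (x : Idx5 → ℝ) (μ ν : Idx5) : schwMetric M c x μ ν = schwMetric M c x ν μ := by
  rcases μ with a | i <;> rcases ν with b | j
  · fin_cases a <;> fin_cases b <;> simp [schwMetric]
  · simp [schwMetric]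
  · simp [schwMetric]
  · simp [schwMetric, S3Chart.metric_symm c (zOf x) i j]

lemma differentiableAt_schw_inr (hx : x ∈ region M c) (i j : Fin 3) :
    DifferentiableAt ℝ (fun x => schwMetric M c x (Sum.inr i) (Sum.inr j)) x := by
  have h : DifferentiableAt ℝ (fun z => c.metric z i j) (zOf x) :=
    ((S3Chart.contDiffOn_metric i j).contDiffAt (c.isOpen_dom.mem_nhds hx.2)).differentiableAt
      (by simp)
  have h2 : DifferentiableAt ℝ zOf x := (contDiff_zOf.differentiable (by simp)) x
  have h3 := h.comp x h2
  simp only [schwMetric, Matrix.fromBlocks_apply₂₂, Matrix.smul_apply, smul_eq_mul]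
  exact DifferentiableAt.mul (by fun_prop) h3

lemma pd_inr_schw_inr (hx : x ∈ region M c) (k i j : Fin 3) :
    pd (Sum.inr k) (fun x => schwMetric M c x (Sum.inr i) (Sum.inr j)) x
      = x (Sum.inl 1) ^ 2 * pd k (fun z => c.metric z i j) (zOf x) := by
  rw [pd_inr (differentiableAt_schw_inr hx i j)]
  have h : DifferentiableAt ℝ (fun z => c.metric z i j) (zOf x) :=
    ((S3Chart.contDiffOn_metric i j).contDiffAt (c.isOpen_dom.mem_nhds hx.2)).differentiableAt
      (by simp)
  change pd k (fun z => x (Sum.inl 1) ^ 2 * c.metric z i j) (zOf x) = _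
  rw [pd, fderiv_const_mul h]
  rfl

lemma pd_inl_schw_inr (hx : x ∈ region M c) (a : Fin 2) (i j : Fin 3) :
    pd (Sum.inl a) (fun x => schwMetric M c x (Sum.inr i) (Sum.inr j)) x
      = (if a = 1 then 2 * x (Sum.inl 1) else 0) * c.metric (zOf x) i j := by
  rw [pd_inl (differentiableAt_schw_inr hx i j)]
  change pd a (fun y => y 1 ^ 2 * c.metric (zOf x) i j) (yOf x) = _
  have h1 : HasFDerivAt (fun y : Fin 2 → ℝ => y 1)
      (ContinuousLinearMap.proj 1 : (Fin 2 → ℝ) →L[ℝ] ℝ) (yOf x) := hasFDerivAt_apply 1 _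
  rw [pd, ((h1.pow 2).mul_const _).fderiv]
  fin_cases a <;> simp [yOf, mul_comm]

lemma pd_inr_schw_inl (k : Fin 3) (a b : Fin 2) :
    pd (Sum.inr k) (fun x => schwMetric M c x (Sum.inl a) (Sum.inl b)) x = 0 := by
  -- The point is not assumed to lie off the horizon, so differentiability can fail; `fderiv` is
  -- then zero by convention and the conclusion still holds.
  by_cases hd : DifferentiableAt ℝ (fun x => schwMetric M c x (Sum.inl a) (Sum.inl b)) x
  · rw [pd_inr hd]
    change pd k (fun _ => (!![-schwF M (x (Sum.inl 1)), 0; 0, (schwF M (x (Sum.inl 1)))⁻¹] :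
      Matrix (Fin 2) (Fin 2) ℝ) a b) _ = 0
    simp [pd]
  · rw [pd, fderiv_zero_of_not_differentiableAt hd]; rfl

lemma pd_schw_mixed (μ : Idx5) (a : Fin 2) (i : Fin 3) :
    pd μ (fun x => schwMetric M c x (Sum.inl a) (Sum.inr i)) x = 0 := by
  simp [pd, schwMetric]

lemma pd_schw_mixed' (μ : Idx5) (a : Fin 2) (i : Fin 3) :
    pd μ (fun x => schwMetric M c x (Sum.inr i) (Sum.inl a)) x = 0 := by
  simp [pd, schwMetric]

lemma christoffel_inr_inr_inr (hx : x ∈ region M c) (m k j : Fin 3) :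
    christoffel (schwMetric M c) x (Sum.inr m) (Sum.inr k) (Sum.inr j)
      = christoffel c.metric (zOf x) m k j := by
  have hr : x (Sum.inl 1) ≠ 0 := ne_of_gt hx.1.1
  simp only [christoffel, Fintype.sum_sum_type, schwMetric_inv hx, Matrix.fromBlocks_apply₂₁,
    Matrix.fromBlocks_apply₂₂, Matrix.zero_apply, zero_mul, Finset.sum_const_zero, zero_add,
    pd_inr_schw_inr hx, Matrix.smul_apply, smul_eq_mul]
  congr 1
  refine Finset.sum_congr rfl fun l _ => ?_
  field_simp

/-- Only the proportionality to `γ_{kj}` matters for `Z`. The coefficient comes from `∂_r r²` and is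
left unspecified. -/
lemma exists_christoffel_inl_inr_inr (hx : x ∈ region M c) :
    ∃ q : Fin 2 → ℝ, ∀ b k j, christoffel (schwMetric M c) x (Sum.inl b) (Sum.inr k) (Sum.inr j)
      = q b * c.metric (zOf x) k j := by
  refine ⟨fun b => 1 / 2 * ∑ a, (!![-(schwF M (x (Sum.inl 1)))⁻¹, 0; 0, schwF M (x (Sum.inl 1))] :
      Matrix (Fin 2) (Fin 2) ℝ) b a * -(if a = 1 then 2 * x (Sum.inl 1) else 0), fun b k j => ?_⟩
  simp only [christoffel, Fintype.sum_sum_type, schwMetric_inv hx, Matrix.fromBlocks_apply₁₁,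
    Matrix.fromBlocks_apply₁₂, Matrix.zero_apply, zero_mul, Finset.sum_const_zero, add_zero,
    pd_schw_mixed, pd_inl_schw_inr hx, zero_sub, Fin.sum_univ_two]
  ring

lemma christoffel_inl_inr_inl (hx : x ∈ region M c) (b a : Fin 2) (k : Fin 3) :
    christoffel (schwMetric M c) x (Sum.inl b) (Sum.inr k) (Sum.inl a) = 0 := by
  simp [christoffel, Fintype.sum_sum_type, schwMetric_inv hx, pd_schw_mixed, pd_schw_mixed',
    pd_inr_schw_inl]

/-- Again only the shape `δ^m_k` is used: it produces a term proportional to `h_{kl}`, symmetric in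
`k, l`. -/
lemma exists_christoffel_inr_inr_inl (hx : x ∈ region M c) :
    ∃ p : Fin 2 → ℝ, ∀ a m k, christoffel (schwMetric M c) x (Sum.inr m) (Sum.inr k) (Sum.inl a)
      = p a * if m = k then 1 else 0 := by
  have hr : x (Sum.inl 1) ≠ 0 := ne_of_gt hx.1.1
  refine ⟨fun a => 1 / 2 * (x (Sum.inl 1) ^ 2)⁻¹ * (if a = 1 then 2 * x (Sum.inl 1) else 0),
    fun a m k => ?_⟩
  have hinv : ∑ l, (c.metric (zOf x))⁻¹ m l * c.metric (zOf x) l k = if m = k then 1 else 0 := by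
    have h := mul_eq_one_comm.1 (metric_mul_inv hx.2)
    have := congrFun₂ h m k
    rwa [Matrix.mul_apply, Matrix.one_apply] at this
  rw [← hinv]
  simp only [christoffel, Fintype.sum_sum_type, schwMetric_inv hx, Matrix.fromBlocks_apply₂₁,
    Matrix.fromBlocks_apply₂₂, Matrix.zero_apply, zero_mul, Finset.sum_const_zero, zero_add,
    pd_schw_mixed, pd_schw_mixed', pd_inl_schw_inr hx, sub_zero, Matrix.smul_apply, smul_eq_mul]
  rw [Finset.mul_sum, Finset.mul_sum]
  exact Finset.sum_congr rfl fun l _ => by ring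

/-- The components of `Z[h]`. -/
theorem Zop_eq {h : (Idx5 → ℝ) → Idx5 → Idx5 → ℂ} (hh : ContDiffOn ℝ ∞ h (region M c))
    (hs : ∀ x ∈ region M c, ∀ μ ν, h x μ ν = h x ν μ) (hx : x ∈ region M c) (μ ν : Idx5) :
    Zop M c h x μ ν = blocks (fun _ _ => 0)
      (fun a i => curl c.metric
        (fun z l => h (Sum.elim (yOf x) z) (Sum.inl a) (Sum.inr l)) (zOf x) i)
      (fun i j => symCurl c.metric
        (fun z k l => h (Sum.elim (yOf x) z) (Sum.inr k) (Sum.inr l)) (zOf x) i j) μ ν := by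
  have hd : ∀ μ ν, DifferentiableAt ℝ (fun x => h x μ ν) x := fun μ ν => by
    have := (hh.contDiffAt ((isOpen_region M c).mem_nhds hx)).differentiableAt (by simp)
    exact differentiableAt_pi.1 (differentiableAt_pi.1 this μ) ν
  have hG : ∀ x μ ν, schwMetric M c x μ ν = schwMetric M c x ν μ := schwMetric_symm
  have hγ := S3Chart.metric_symm c
  obtain ⟨q, hq⟩ := exists_christoffel_inl_inr_inr hx
  obtain ⟨p, hp⟩ := exists_christoffel_inr_inr_inl hx
  have hsplit : ∀ i μ, ∑ κ, ∑ τ, kyUp M c x (Sum.inr i) κ τ • cov2 (schwMetric M c) h x κ μ τ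
      = _ := fun i μ => sum_kyUp_smul hx i fun κ τ => cov2 (schwMetric M c) h x κ μ τ
  have hai : ∀ a i, ∑ κ, ∑ τ, kyUp M c x (Sum.inr i) κ τ
        • cov2 (schwMetric M c) h x κ (Sum.inl a) τ
      = curl c.metric (fun z l => h (Sum.elim (yOf x) z) (Sum.inl a) (Sum.inr l)) (zOf x) i := by
    intro a i
    rw [hsplit, curl]
    -- The terms of `∇_k h_{al}` beyond `D_k h_{al}` are a Christoffel contraction with lower
    -- indices `k, l` and a multiple of `h_{kl}`, both symmetric.
    refine sum_volUp_congr (fun k l => ?_) i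
    simp only [cov2, cov1, elim_yOf_zOf, pd_inr (hd _ _)]
    have hc1 := fun m => S3Chart.christoffel_comm hG x m (Sum.inr l) (Sum.inr k)
    have hc2 := fun m => S3Chart.christoffel_comm hγ (zOf x) m l k
    simp only [hc1, hc2]
    have hsym := hs x hx (Sum.inr l) (Sum.inr k)
    simp only [Fintype.sum_sum_type, christoffel_inl_inr_inl hx, hp]
    simp [hsym]
    ring
  have hij : ∀ i j, ∑ κ, ∑ τ, kyUp M c x (Sum.inr i) κ τ
        • cov2 (schwMetric M c) h x κ (Sum.inr j) τ
      = ∑ k, ∑ l, volUp c.metric (zOf x) i k l • cov2 c.metric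
          (fun z k l => h (Sum.elim (yOf x) z) (Sum.inr k) (Sum.inr l)) (zOf x) k j l
        - ∑ l, (∑ l', vol c.metric (zOf x) i j l' * (c.metric (zOf x))⁻¹ l' l)
          • ∑ b, q b • h x (Sum.inl b) (Sum.inr l) := by
    intro i j
    have h1 : ∑ l, (∑ l', vol c.metric (zOf x) i j l' * (c.metric (zOf x))⁻¹ l' l)
          • ∑ b, q b • h x (Sum.inl b) (Sum.inr l)
        = ∑ k, ∑ l, volUp c.metric (zOf x) i k l
          • (c.metric (zOf x) k j • ∑ b, q b • h x (Sum.inl b) (Sum.inr l)) := by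
      rw [Finset.sum_comm]
      refine Finset.sum_congr rfl fun l _ => ?_
      rw [← sum_volUp_metric hx.2, Finset.sum_smul]
      simp only [smul_smul]
    rw [hsplit, h1, ← Finset.sum_sub_distrib]
    simp only [← Finset.sum_sub_distrib, ← smul_sub]
    -- Of the two terms carrying `h_{b·}`, the one with `γ_{kl}` is symmetric and drops; the one
    -- with `γ_{kj}` is the correction subtracted in `hij`.
    refine sum_volUp_congr (fun k l => ?_) i
    simp only [cov2, elim_yOf_zOf, pd_inr (hd _ _)]
    have hc1 := fun m => S3Chart.christoffel_comm hG x m (Sum.inr l) (Sum.inr k)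
    have hc2 := fun m => S3Chart.christoffel_comm hγ (zOf x) m l k
    simp only [hc1, hc2]
    simp only [Fintype.sum_sum_type, hq, christoffel_inr_inr_inr hx, Finset.smul_sum, smul_smul,
      mul_comm (c.metric (zOf x) _ _)]
    ring
  rcases μ with a | i <;> rcases ν with b | j
  · simp [Zop, blocks, kyUp_inl]
  · simp only [Zop, kyUp_inl, zero_smul, zero_add, blocks, hai]
  · simp only [Zop, kyUp_inl, zero_smul, add_zero, blocks, hai]
  · simp only [Zop, Finset.sum_add_distrib, blocks, hij, symCurl]
    -- The corrections for `(i, j)` and `(j, i)` are opposite, so they cancel in the symmetrization.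
    have : ∀ l', vol c.metric (zOf x) j i l' = -vol c.metric (zOf x) i j l' := fun l' =>
      vol_antisymm' _ _ _ _ _
    simp only [this, neg_mul, Finset.sum_neg_distrib, neg_smul]
    ring

/-- On covectors the curl is `⋆d`. -/
theorem curl_eq_hodge (w : (Fin 3 → ℝ) → Fin 3 → ℂ) (z : Fin 3 → ℝ) (i : Fin 3) :
    curl c.metric w z i = hodge c.metric (extD w) z i := by
  rw [hodge, curl, Finset.smul_sum]
  simp only [Finset.smul_sum, smul_comm (1 / 2 : ℝ)]
  refine sum_volUp_congr (fun k l => ?_) i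
  have hc := fun m => S3Chart.christoffel_comm c.metric_symm z m l k
  simp only [cov1, extD, Complex.real_smul, hc]
  push_cast
  ring

end Spacetime

/-! ## Smooth dependence on the orbit space coordinates -/

section Parametric

variable {E : Type} [NormedAddCommGroup E] [NormedSpace ℝ E] {S : Set (Fin 2 → ℝ)}
  {c : S3Chart}

/-- Admissibility asks for smoothness jointly in `y` and `z`. It must survive differentiation in `z`
alone, with `y` as a parameter. -/
lemma contDiffOn_pd_param {F : (Fin 2 → ℝ) → (Fin 3 → ℝ) → E} (hS : IsOpen S)
    (h : ContDiffOn ℝ ∞ (fun q : (Fin 2 → ℝ) × (Fin 3 → ℝ) => F q.1 q.2) (S ×ˢ c.dom))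
    (k : Fin 3) :
    ContDiffOn ℝ ∞ (fun q : (Fin 2 → ℝ) × (Fin 3 → ℝ) => pd k (F q.1) q.2) (S ×ˢ c.dom) := by
  intro q hq
  have hq' := h.contDiffAt ((hS.prod c.isOpen_dom).mem_nhds hq)
  have h1 : ContDiffAt ℝ ∞ (Function.uncurry fun (q : (Fin 2 → ℝ) × (Fin 3 → ℝ)) z => F q.1 z)
      (q, q.2) :=
    ContDiffAt.comp (g := fun q : (Fin 2 → ℝ) × (Fin 3 → ℝ) => F q.1 q.2)
      (f := fun p : ((Fin 2 → ℝ) × (Fin 3 → ℝ)) × (Fin 3 → ℝ) => (p.1.1, p.2)) (q, q.2) hq'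
      (by fun_prop)
  exact ((ContDiffAt.fderiv (m := ∞) h1 contDiffAt_snd (by simp)).clm_apply
    contDiffAt_const).contDiffWithinAt

lemma ContDiffOn.slice {F : (Fin 2 → ℝ) → (Fin 3 → ℝ) → E} {U : Set (Fin 3 → ℝ)}
    (h : ContDiffOn ℝ ∞ (fun q : (Fin 2 → ℝ) × (Fin 3 → ℝ) => F q.1 q.2) (S ×ˢ U))
    {y : Fin 2 → ℝ} (hy : y ∈ S) : ContDiffOn ℝ ∞ (F y) U :=
  h.comp (f := fun z => (y, z)) (contDiff_const.prodMk contDiff_id).contDiffOn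
    fun _ hz => ⟨hy, hz⟩

lemma ContDiffOn.ofZ {f : (Fin 3 → ℝ) → E} {U : Set (Fin 3 → ℝ)} (h : ContDiffOn ℝ ∞ f U) :
    ContDiffOn ℝ ∞ (fun q : (Fin 2 → ℝ) × (Fin 3 → ℝ) => f q.2) (S ×ˢ U) :=
  h.comp contDiff_snd.contDiffOn fun _ hq => hq.2

lemma ContDiffOn.ofY {f : (Fin 2 → ℝ) → E} {U : Set (Fin 3 → ℝ)} (h : ContDiffOn ℝ ∞ f S) :
    ContDiffOn ℝ ∞ (fun q : (Fin 2 → ℝ) × (Fin 3 → ℝ) => f q.1) (S ×ˢ U) :=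
  h.comp contDiff_fst.contDiffOn fun _ hq => hq.1

lemma contDiffOn_metric_inv (i j : Fin 3) :
    ContDiffOn ℝ ∞ (fun z => (c.metric z)⁻¹ i j) c.dom :=
  (ContDiffOn.sum (t := c.dom) (f := fun b z => c.frM z i b * c.frM z j b) (s := Finset.univ)
    fun b _ => (S3Chart.contDiffOn_frM i b).mul (S3Chart.contDiffOn_frM j b)).congr
    fun z hz => by rw [S3Chart.metric_inv_apply hz]

lemma contDiffOn_christoffel (m i j : Fin 3) :
    ContDiffOn ℝ ∞ (fun z => christoffel c.metric z m i j) c.dom := by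
  unfold christoffel
  have hp : ∀ k i j, ContDiffOn ℝ ∞ (fun z => pd k (fun z => c.metric z i j) z) c.dom :=
    fun k i j => contDiffOn_pd c.isOpen_dom (S3Chart.contDiffOn_metric i j) k
  exact contDiffOn_const.mul (ContDiffOn.sum fun l _ => (contDiffOn_metric_inv m l).mul
    (((hp _ _ _).add (hp _ _ _)).sub (hp _ _ _)))

lemma contDiffOn_volUp (i k l : Fin 3) :
    ContDiffOn ℝ ∞ (fun z => volUp c.metric z i k l) c.dom := by
  refine (ContDiffOn.sum (t := c.dom) (s := Finset.univ) (f := fun a z => ∑ b, ∑ d,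
    leviCivita a b d * c.cofr z a i * c.frM z k b * c.frM z l d) fun a _ => ?_).congr
    fun z hz => by rw [S3Chart.volUp_eq hz]
  exact ContDiffOn.sum fun b _ => ContDiffOn.sum fun d _ =>
    ((contDiffOn_const.mul (S3Chart.contDiffOn_cofr a i)).mul (S3Chart.contDiffOn_frM k b)).mul
      (S3Chart.contDiffOn_frM l d)

lemma contDiffOn_cov1 (hS : IsOpen S) {W : (Fin 2 → ℝ) → (Fin 3 → ℝ) → Fin 3 → ℂ}
    (h : ∀ i, ContDiffOn ℝ ∞ (fun q : (Fin 2 → ℝ) × (Fin 3 → ℝ) => W q.1 q.2 i) (S ×ˢ c.dom))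
    (k i : Fin 3) : ContDiffOn ℝ ∞ (fun q : (Fin 2 → ℝ) × (Fin 3 → ℝ) =>
      cov1 c.metric (W q.1) q.2 k i) (S ×ˢ c.dom) :=
  (contDiffOn_pd_param (F := fun y z => W y z i) hS (h i) k).sub (ContDiffOn.sum fun m _ =>
    ((contDiffOn_christoffel m k i).ofZ).smul (h m))

lemma contDiffOn_cov2 (hS : IsOpen S) {T : (Fin 2 → ℝ) → (Fin 3 → ℝ) → Fin 3 → Fin 3 → ℂ}
    (h : ∀ i j, ContDiffOn ℝ ∞ (fun q : (Fin 2 → ℝ) × (Fin 3 → ℝ) => T q.1 q.2 i j)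
      (S ×ˢ c.dom)) (k i j : Fin 3) :
    ContDiffOn ℝ ∞ (fun q : (Fin 2 → ℝ) × (Fin 3 → ℝ) => cov2 c.metric (T q.1) q.2 k i j)
      (S ×ˢ c.dom) :=
  ((contDiffOn_pd_param (F := fun y z => T y z i j) hS (h i j) k).sub (ContDiffOn.sum fun m _ =>
    ((contDiffOn_christoffel m k i).ofZ).smul (h m j))).sub (ContDiffOn.sum fun m _ =>
    ((contDiffOn_christoffel m k j).ofZ).smul (h i m))

lemma contDiffOn_curl (hS : IsOpen S) {W : (Fin 2 → ℝ) → (Fin 3 → ℝ) → Fin 3 → ℂ}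
    (h : ∀ i, ContDiffOn ℝ ∞ (fun q : (Fin 2 → ℝ) × (Fin 3 → ℝ) => W q.1 q.2 i) (S ×ˢ c.dom))
    (i : Fin 3) : ContDiffOn ℝ ∞ (fun q : (Fin 2 → ℝ) × (Fin 3 → ℝ) =>
      curl c.metric (W q.1) q.2 i) (S ×ˢ c.dom) :=
  ContDiffOn.sum fun k _ => ContDiffOn.sum fun l _ =>
    ((contDiffOn_volUp i k l).ofZ).smul (contDiffOn_cov1 hS h k l)

lemma contDiffOn_symCurl (hS : IsOpen S) {T : (Fin 2 → ℝ) → (Fin 3 → ℝ) → Fin 3 → Fin 3 → ℂ}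
    (h : ∀ i j, ContDiffOn ℝ ∞ (fun q : (Fin 2 → ℝ) × (Fin 3 → ℝ) => T q.1 q.2 i j)
      (S ×ˢ c.dom)) (i j : Fin 3) :
    ContDiffOn ℝ ∞ (fun q : (Fin 2 → ℝ) × (Fin 3 → ℝ) => symCurl c.metric (T q.1) q.2 i j)
      (S ×ˢ c.dom) :=
  ContDiffOn.sum fun k _ => ContDiffOn.sum fun l _ =>
    (((contDiffOn_volUp i k l).ofZ).smul (contDiffOn_cov2 hS h k j l)).add
      (((contDiffOn_volUp j k l).ofZ).smul (contDiffOn_cov2 hS h k i l))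

lemma contDiffOn_symGrad (hS : IsOpen S) {W : (Fin 2 → ℝ) → (Fin 3 → ℝ) → Fin 3 → ℂ}
    (h : ∀ i, ContDiffOn ℝ ∞ (fun q : (Fin 2 → ℝ) × (Fin 3 → ℝ) => W q.1 q.2 i) (S ×ˢ c.dom))
    (i j : Fin 3) : ContDiffOn ℝ ∞ (fun q : (Fin 2 → ℝ) × (Fin 3 → ℝ) =>
      symGrad c.metric (W q.1) q.2 i j) (S ×ˢ c.dom) :=
  ((contDiffOn_cov1 hS h i j).add (contDiffOn_cov1 hS h j i)).const_smul (1 / 2 : ℝ)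

lemma contDiffOn_Lop (hS : IsOpen S) {φ : (Fin 2 → ℝ) → (Fin 3 → ℝ) → ℂ}
    (h : ContDiffOn ℝ ∞ (fun q : (Fin 2 → ℝ) × (Fin 3 → ℝ) => φ q.1 q.2) (S ×ˢ c.dom))
    (i j : Fin 3) : ContDiffOn ℝ ∞ (fun q : (Fin 2 → ℝ) × (Fin 3 → ℝ) =>
      Lop c.metric (φ q.1) q.2 i j) (S ×ˢ c.dom) := by
  have hg : ∀ i, ContDiffOn ℝ ∞ (fun q : (Fin 2 → ℝ) × (Fin 3 → ℝ) => grad (φ q.1) q.2 i)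
      (S ×ˢ c.dom) := fun i => contDiffOn_pd_param hS h i
  have hh : ∀ i j, ContDiffOn ℝ ∞ (fun q : (Fin 2 → ℝ) × (Fin 3 → ℝ) =>
      hess c.metric (φ q.1) q.2 i j) (S ×ˢ c.dom) := fun i j =>
    contDiffOn_cov1 (W := fun y => grad (φ y)) hS hg i j
  exact (hh i j).sub ((contDiffOn_const.mul (S3Chart.contDiffOn_metric i j).ofZ).smul
    (ContDiffOn.sum fun k _ => ContDiffOn.sum fun l _ =>
      ((contDiffOn_metric_inv k l).ofZ).smul (hh k l)))

end Parametric

/-! ## The action on the pieces -/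

lemma cov2_congr {ι : Type} [Fintype ι] [DecidableEq ι] {G : (ι → ℝ) → Matrix ι ι ℝ}
    {s : Set (ι → ℝ)} (hs : IsOpen s) {T T' : (ι → ℝ) → ι → ι → ℂ}
    (h : ∀ x ∈ s, ∀ i j, T x i j = T' x i j) {x : ι → ℝ} (hx : x ∈ s) (k i j : ι) :
    cov2 G T x k i j = cov2 G T' x k i j := by
  simp only [cov2, h x hx]
  rw [pd_congr hs (f := fun x => T x i j) (g := fun x => T' x i j) (fun x hx => h x hx i j) k hx]

lemma Zop_congr {M : ℝ} {c : S3Chart} {h h' : (Idx5 → ℝ) → Idx5 → Idx5 → ℂ}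
    (hh : ∀ x ∈ region M c, ∀ μ ν, h x μ ν = h' x μ ν) {x : Idx5 → ℝ} (hx : x ∈ region M c)
    (μ ν : Idx5) : Zop M c h x μ ν = Zop M c h' x μ ν := by
  simp only [Zop, cov2_congr (isOpen_region M c) hh hx]

namespace Pieces

variable {M : ℝ} {c : S3Chart} {p : Pieces (Fin 3)}

open S3Chart

/-- Frame components of the pieces at a fixed point of the orbit space. -/
lemma Admissible.exists_rep (hp : p.Admissible M c) {y : Fin 2 → ℝ} (hy : y ∈ regionY M) :
    ∃ (s : Fin 2 → Sm c.U) (l f : Sm c.U) (v : Fin 2 → Fin 3 → Sm c.U) (w : Fin 3 → Sm c.U)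
      (t : Fin 3 → Fin 3 → Sm c.U),
      (∀ a, Lift (fun z => p.sa y z a) (s a)) ∧ Lift (p.sL y) l ∧ Lift (p.sT y) f ∧
      (∀ a, c.Rep1 (fun z => p.va y z a) (v a)) ∧ c.Rep1 (p.vi y) w ∧ c.Rep2 (p.tij y) t ∧
      (∀ a, div1F c.e (v a) = 0) ∧ div1F c.e w = 0 ∧ (∀ a b, t a b = t b a) ∧
      (∀ a, div2F c.e t a = 0) ∧ traceF t = 0 := by
  obtain ⟨⟨-, hsa, hsL, hsT, hva, hvi, htij⟩, hadm⟩ := hp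
  choose s hs using fun a => exists_lift (U := c.U) (contDiffOn_pi.1 (hsa.slice hy) a)
  obtain ⟨l, hl⟩ := exists_lift (U := c.U) (hsL.slice hy)
  obtain ⟨f, hf⟩ := exists_lift (U := c.U) (hsT.slice hy)
  choose v hv using fun a => exists_rep1 (c := c) (w := fun z => p.va y z a) fun i =>
    contDiffOn_pi.1 (contDiffOn_pi.1 (hva.slice hy) a) i
  obtain ⟨w, hw⟩ := exists_rep1 (c := c) (w := p.vi y) fun i => contDiffOn_pi.1 (hvi.slice hy) i
  obtain ⟨t, ht⟩ := exists_rep2 (c := c) (T := p.tij y) fun i j =>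
    contDiffOn_pi.1 (contDiffOn_pi.1 (htij.slice hy) i) j
  refine ⟨s, l, f, v, w, t, hs, hl, hf, hv, hw, ht, fun a => ?_, ?_, ?_, ?_, ?_⟩
  · exact Sm.ext' fun u => by
      rw [← (hv a).div1 u, map_zero]; exact (hadm y hy u u.2).2.2.1 a
  · exact Sm.ext' fun u => by
      rw [← hw.div1 u, map_zero]; exact (hadm y hy u u.2).2.2.2.1
  · have h' : c.Rep2 (p.tij y) (fun a b => t b a) := fun i j u => by
      change p.tij y u i j = _
      rw [(hadm y hy u u.2).2.1 i j, ht.ev_eq]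
      congr 1
      simp only [Finset.mul_sum]
      rw [Finset.sum_comm]
      exact Finset.sum_congr rfl fun _ _ => Finset.sum_congr rfl fun _ _ => by ring
    exact fun a b => congrFun₂ (rep2_inj ht h') a b
  · have h' : c.Rep1 (div2 c.metric (p.tij y)) (fun _ => 0) := fun j u => by
      change div2 c.metric (p.tij y) u j = _
      rw [(hadm y hy u u.2).2.2.2.2.1 j]; simp
    exact fun a => congrFun (rep1_inj ht.div2 h') a
  · exact Sm.ext' fun u => by
      rw [← ht.trace2 u, map_zero]; exact (hadm y hy u u.2).2.2.2.2.2

lemma Rep2.symm_of {T : (Fin 3 → ℝ) → Fin 3 → Fin 3 → ℂ} {t : Fin 3 → Fin 3 → Sm c.U}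
    (h : c.Rep2 T t) (ht : ∀ a b, t a b = t b a) {z : Fin 3 → ℝ} (hz : z ∈ c.dom) (i j : Fin 3) :
    T z i j = T z j i := by
  rw [h.ev_eq ⟨z, hz⟩, h.ev_eq ⟨z, hz⟩]
  congr 1
  simp only [Finset.mul_sum]
  rw [Finset.sum_comm]
  exact Finset.sum_congr rfl fun a _ => Finset.sum_congr rfl fun b _ => by rw [ht a b]; ring

/-- Transversality of the new pieces is div curl = 0 and div symCurl = curl div, with `div t = 0`;
tracelessness holds because the symmetrized curl of a symmetric tensor is always traceless. -/
lemma Admissible.image (hp : p.Admissible M c) : (p.image c).Admissible M c := by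
  have hY := isOpen_regionY M
  refine ⟨⟨contDiffOn_const, contDiffOn_const, contDiffOn_const, contDiffOn_const, ?_, ?_, ?_⟩,
    fun y hy z hz => ?_⟩
  · exact contDiffOn_pi.2 fun a => contDiffOn_pi.2 fun i =>
      contDiffOn_curl (W := fun y z => p.va y z a) hY
        (fun i => contDiffOn_pi.1 (contDiffOn_pi.1 hp.1.2.2.2.2.1 a) i) i
  · exact contDiffOn_pi.2 fun i => contDiffOn_curl (W := fun y z => p.vi y z) hY
      (fun i => contDiffOn_pi.1 hp.1.2.2.2.2.2.1 i) i
  · exact contDiffOn_pi.2 fun i => contDiffOn_pi.2 fun j =>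
      contDiffOn_symCurl (T := fun y z => p.tij y z) hY
        (fun i j => contDiffOn_pi.1 (contDiffOn_pi.1 hp.1.2.2.2.2.2.2 i) j) i j
  · obtain ⟨s, l, f, v, w, t, hs, hl, hf, hv, hw, ht, dv, dw, ts, dt, tt⟩ := hp.exists_rep hy
    have fc := c.frameComm
    refine ⟨fun _ _ => rfl, fun i j => ?_, fun a => ?_, ?_, fun j => ?_, ?_⟩
    · exact Rep2.symm_of ht.symCurl (symCurlF_symm t) hz i j
    · have := (hv a).curl.div1 ⟨z, hz⟩
      rwa [div1F_curlF fc, map_zero] at this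
    · have := hw.curl.div1 ⟨z, hz⟩
      rwa [div1F_curlF fc, map_zero] at this
    · have h0 : div2F c.e t = fun _ => 0 := funext dt
      have := ht.symCurl.div2.ev_eq ⟨z, hz⟩ j
      simp only [div2F_symCurlF fc ts, h0] at this
      exact this.trans (by simp [curlF, cov1F])
    · have := ht.symCurl.trace2 ⟨z, hz⟩
      rwa [traceF_symCurlF ts, map_zero] at this

lemma mapsTo_region : Set.MapsTo (fun x : Idx5 → ℝ => (yOf x, zOf x)) (region M c)
    (regionY M ×ˢ c.dom) := fun _ hx => hx

lemma contDiffOn_comp_yz {f : (Fin 2 → ℝ) × (Fin 3 → ℝ) → ℂ}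
    (hf : ContDiffOn ℝ ∞ f (regionY M ×ˢ c.dom)) :
    ContDiffOn ℝ ∞ (fun x : Idx5 → ℝ => f (yOf x, zOf x)) (region M c) :=
  hf.comp (contDiff_yOf.prodMk contDiff_zOf).contDiffOn mapsTo_region

lemma Admissible.contDiffOn_toTensor (hp : p.Admissible M c) :
    ContDiffOn ℝ ∞ (p.toTensor c) (region M c) := by
  have hY := isOpen_regionY M
  obtain ⟨⟨hab, hsa, hsL, hsT, hva, hvi, htij⟩, -⟩ := hp
  have hai : ∀ a i, ContDiffOn ℝ ∞ (fun q : (Fin 2 → ℝ) × (Fin 3 → ℝ) =>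
      grad (fun z => p.sa q.1 z a) q.2 i + p.va q.1 q.2 a i) (regionY M ×ˢ c.dom) := fun a i =>
    (contDiffOn_pd_param (F := fun y z => p.sa y z a) hY (contDiffOn_pi.1 hsa a) i).add
      (contDiffOn_pi.1 (contDiffOn_pi.1 hva a) i)
  have hij : ∀ i j, ContDiffOn ℝ ∞ (fun q : (Fin 2 → ℝ) × (Fin 3 → ℝ) => p.tij q.1 q.2 i j
      + (2 : ℝ) • symGrad c.metric (p.vi q.1) q.2 i j + c.metric q.2 i j • p.sL q.1 q.2
      + Lop c.metric (p.sT q.1) q.2 i j) (regionY M ×ˢ c.dom) := fun i j =>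
    (((contDiffOn_pi.1 (contDiffOn_pi.1 htij i) j).add
      ((contDiffOn_symGrad (W := p.vi) hY (fun i => contDiffOn_pi.1 hvi i) i j).const_smul (2 : ℝ))).add
      ((contDiffOn_metric i j).ofZ.smul hsL)).add (contDiffOn_Lop hY hsT i j)
  refine contDiffOn_pi.2 fun μ => contDiffOn_pi.2 fun ν => ?_
  rcases μ with a | i <;> rcases ν with b | j
  · exact contDiffOn_comp_yz (contDiffOn_pi.1 (contDiffOn_pi.1 hab a) b)
  · exact contDiffOn_comp_yz (hai a j)
  · exact contDiffOn_comp_yz (hai b i)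
  · exact contDiffOn_comp_yz (hij i j)

/-- Frame components of the sphere block of `toTensor`. -/
lemma rep_toTensor {l f : Sm c.U} {w : Fin 3 → Sm c.U} {t : Fin 3 → Fin 3 → Sm c.U}
    {y : Fin 2 → ℝ} (hl : Lift (p.sL y) l) (hf : Lift (p.sT y) f) (hw : c.Rep1 (p.vi y) w)
    (ht : c.Rep2 (p.tij y) t) :
    c.Rep2 (fun z i j => p.tij y z i j + (2 : ℝ) • symGrad c.metric (p.vi y) z i j
      + c.metric z i j • p.sL y z + Lop c.metric (p.sT y) z i j)
      (fun a b => t a b + (2 : ℂ) • symGradF c.e w a b + deltaF l a b + LopF c.e f a b) :=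
  (((ht.add (hw.symGrad.const_mul 2)).add (rep2_delta hl)).add hf.Lop).congr
    (fun z _ i j => by simp only [Complex.real_smul, Complex.ofReal_ofNat]) fun _ _ => rfl

lemma LopF_symm (f : Sm c.U) (a b : Fin 3) : LopF c.e f a b = LopF c.e f b a := by
  rw [LopF, LopF, hessF_symm c.frameComm, deltaF_symm]

lemma Admissible.toTensor_symm (hp : p.Admissible M c) {x : Idx5 → ℝ} (hx : x ∈ region M c)
    (μ ν : Idx5) : p.toTensor c x μ ν = p.toTensor c x ν μ := by
  obtain ⟨s, l, f, v, w, t, hs, hl, hf, hv, hw, ht, dv, dw, ts, dt, tt⟩ := hp.exists_rep hx.1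
  rcases μ with a | i <;> rcases ν with b | j
  · exact (hp.2 _ hx.1 _ hx.2).1 a b
  · rfl
  · rfl
  · refine Rep2.symm_of (rep_toTensor hl hf hw ht) (fun a b => ?_) hx.2 i j
    rw [ts, symGradF_symm, deltaF_symm, LopF_symm]

/-- The symmetry operator acts on the vector and tensor pieces. -/
theorem Zop_toTensor (hp : p.Admissible M c) {x : Idx5 → ℝ} (hx : x ∈ region M c) (μ ν : Idx5) :
    Zop M c (p.toTensor c) x μ ν = (p.image c).toTensor c x μ ν := by
  rw [Zop_eq hp.contDiffOn_toTensor (fun x hx => hp.toTensor_symm hx) hx]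
  obtain ⟨s, l, f, v, w, t, hs, hl, hf, hv, hw, ht, dv, dw, ts, dt, tt⟩ := hp.exists_rep hx.1
  have fc := c.frameComm
  have hai : ∀ a i, curl c.metric (fun z l => p.toTensor c (Sum.elim (yOf x) z) (Sum.inl a)
      (Sum.inr l)) (zOf x) i = grad (fun _ => 0) (zOf x) i
        + curl c.metric (fun z => p.va (yOf x) z a) (zOf x) i := by
    intro a i
    have h1 := ((hs a).grad.add (hv a)).curl.ev_eq ⟨zOf x, hx.2⟩ i
    have h2 := (hv a).curl.ev_eq ⟨zOf x, hx.2⟩ i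
    simp only [curlF_add, curlF_gradF fc, zero_add] at h1
    refine h1.trans (h2.symm.trans ?_)
    simp [grad, pd]
  rcases μ with a | i <;> rcases ν with b | j
  · rfl
  · exact hai a j
  · exact hai b i
  · have h0 : Lift (U := c.U) (fun _ => (0 : ℂ)) 0 := fun u => by simp
    have h1 := (rep_toTensor hl hf hw ht).symCurl.ev_eq ⟨zOf x, hx.2⟩ i j
    have h2 := (rep_toTensor (p := p.image c) (y := yOf x) h0 h0 hw.curl ht.symCurl).ev_eq
      ⟨zOf x, hx.2⟩ i j
    refine h1.trans (Eq.trans ?_ h2.symm)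
    congr 1
    refine Finset.sum_congr rfl fun a _ => ?_
    congr 1
    refine Finset.sum_congr rfl fun b _ => ?_
    congr 1
    have h3 : LopF c.e 0 a b = 0 := by simp [LopF, hessF, cov1F, gradF, deltaF, lapF]
    have h4 : deltaF (0 : Sm c.U) a b = 0 := by simp [deltaF]
    -- Term by term: `t` goes to its symmetrized curl, `symGrad w` to `symGrad (curl w)`, and the
    -- terms with `γ` and `L` are annihilated.
    rw [symCurlF_add, symCurlF_add, symCurlF_add, symCurlF_smul, symCurlF_symGradF fc,
      symCurlF_deltaF, symCurlF_LopF fc, h3, h4]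

lemma Admissible.scalarPart (hp : p.Admissible M c) : p.scalarPart.Admissible M c := by
  obtain ⟨⟨hab, hsa, hsL, hsT, hva, hvi, htij⟩, hadm⟩ := hp
  refine ⟨⟨hab, hsa, hsL, hsT, contDiffOn_const, contDiffOn_const, contDiffOn_const⟩,
    fun y hy z hz => ⟨(hadm y hy z hz).1, fun _ _ => rfl, fun a => ?_, ?_, fun j => ?_, ?_⟩⟩ <;>
  simp [Pieces.scalarPart, div1, div2, trace2, cov1, cov2, pd]

/-- The scalar pieces are annihilated by the symmetry operator. -/
theorem Zop_scalarPart (hp : p.Admissible M c) {x : Idx5 → ℝ} (hx : x ∈ region M c)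
    (μ ν : Idx5) : Zop M c (p.scalarPart.toTensor c) x μ ν = 0 := by
  -- The vector and tensor pieces of the image are curls of zero fields, and it has no scalar
  -- pieces.
  rw [Zop_toTensor hp.scalarPart hx]
  rcases μ with a | i <;> rcases ν with b | j <;>
  simp [toTensor, blocks, Pieces.scalarPart, Pieces.image, ofVT, curl, symCurl, cov1, cov2, pd,
    grad, symGrad, Lop, lap, hess]

end Pieces

/-! ## Modes -/

namespace S3Chart

variable {c : S3Chart} {z : Fin 3 → ℝ}

lemma cov1_congr {w w' : (Fin 3 → ℝ) → Fin 3 → ℂ} (h : ∀ z ∈ c.dom, ∀ i, w z i = w' z i)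
    (hz : z ∈ c.dom) (k i : Fin 3) : cov1 c.metric w z k i = cov1 c.metric w' z k i := by
  simp only [cov1, h z hz]
  rw [pd_congr c.isOpen_dom (f := fun x => w x i) (g := fun x => w' x i) (fun x hx => h x hx i) k hz]

lemma curl_const_mul {w : (Fin 3 → ℝ) → Fin 3 → ℂ} (hw : ContDiffOn ℝ ∞ w c.dom)
    (hz : z ∈ c.dom) (r : ℂ) (i : Fin 3) :
    curl c.metric (fun z i => r * w z i) z i = r * curl c.metric w z i := by
  obtain ⟨v, hv⟩ := exists_rep1 (c := c) fun i => contDiffOn_pi.1 hw i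
  have h1 := (hv.const_mul r).curl.ev_eq ⟨z, hz⟩ i
  have h2 := (hv.curl.const_mul r).ev_eq ⟨z, hz⟩ i
  exact h1.trans (Eq.trans (by simp only [curlF_smul]) h2.symm)

lemma symGrad_const_mul {w : (Fin 3 → ℝ) → Fin 3 → ℂ} (hw : ContDiffOn ℝ ∞ w c.dom)
    (hz : z ∈ c.dom) (r : ℂ) (i j : Fin 3) :
    symGrad c.metric (fun z i => r * w z i) z i j = r * symGrad c.metric w z i j := by
  obtain ⟨v, hv⟩ := exists_rep1 (c := c) fun i => contDiffOn_pi.1 hw i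
  have h1 := (hv.const_mul r).symGrad.ev_eq ⟨z, hz⟩ i j
  have h2 := (hv.symGrad.const_mul r).ev_eq ⟨z, hz⟩ i j
  exact h1.trans (Eq.trans (by simp only [symGradF_smul]) h2.symm)

lemma symCurl_const_mul {T : (Fin 3 → ℝ) → Fin 3 → Fin 3 → ℂ} (hT : ContDiffOn ℝ ∞ T c.dom)
    (hz : z ∈ c.dom) (r : ℂ) (i j : Fin 3) :
    symCurl c.metric (fun z i j => r * T z i j) z i j = r * symCurl c.metric T z i j := by
  obtain ⟨t, ht⟩ := exists_rep2 (c := c) (T := T) fun i j =>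
    contDiffOn_pi.1 (contDiffOn_pi.1 hT i) j
  have h1 := (ht.const_mul r).symCurl.ev_eq ⟨z, hz⟩ i j
  have h2 := (ht.symCurl.const_mul r).ev_eq ⟨z, hz⟩ i j
  exact h1.trans (Eq.trans (by simp only [symCurlF_smul]) h2.symm)

lemma div1_const_mul {w : (Fin 3 → ℝ) → Fin 3 → ℂ} (hw : ContDiffOn ℝ ∞ w c.dom)
    (hz : z ∈ c.dom) (r : ℂ) :
    div1 c.metric (fun z i => r * w z i) z = r * div1 c.metric w z := by
  obtain ⟨v, hv⟩ := exists_rep1 (c := c) fun i => contDiffOn_pi.1 hw i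
  have h1 := (hv.const_mul r).div1 ⟨z, hz⟩
  have h2 := (hv.div1.const_smul r) ⟨z, hz⟩
  exact h1.trans (Eq.trans (by simp only [div1F, cov1F_smul, Finset.smul_sum]) h2.symm)

lemma div2_const_mul {T : (Fin 3 → ℝ) → Fin 3 → Fin 3 → ℂ} (hT : ContDiffOn ℝ ∞ T c.dom)
    (hz : z ∈ c.dom) (r : ℂ) (j : Fin 3) :
    div2 c.metric (fun z i j => r * T z i j) z j = r * div2 c.metric T z j := by
  obtain ⟨t, ht⟩ := exists_rep2 (c := c) (T := T) fun i j =>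
    contDiffOn_pi.1 (contDiffOn_pi.1 hT i) j
  have h1 := (ht.const_mul r).div2.ev_eq ⟨z, hz⟩ j
  have h2 := (ht.div2.const_mul r).ev_eq ⟨z, hz⟩ j
  exact h1.trans (Eq.trans (by simp only [div2F, cov2F_smul, Finset.smul_sum]) h2.symm)

lemma grad_const_mul {f : (Fin 3 → ℝ) → ℂ} (hf : ContDiffOn ℝ ∞ f c.dom)
    (hz : z ∈ c.dom) (r : ℂ) (i : Fin 3) : grad (fun z => r * f z) z i = r * grad f z i := by
  have := (hf.contDiffAt (c.isOpen_dom.mem_nhds hz)).differentiableAt (by simp)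
  rw [grad, grad, pd, pd, fderiv_const_mul this]; rfl

lemma Lop_const_mul {f : (Fin 3 → ℝ) → ℂ} (hf : ContDiffOn ℝ ∞ f c.dom)
    (hz : z ∈ c.dom) (r : ℂ) (i j : Fin 3) :
    Lop c.metric (fun z => r * f z) z i j = r * Lop c.metric f z i j := by
  obtain ⟨s, hs⟩ := exists_lift (U := c.U) hf
  have h1 := (hs.const_smul r).Lop.ev_eq ⟨z, hz⟩ i j
  have h2 := (hs.Lop.const_mul r).ev_eq ⟨z, hz⟩ i j
  refine h1.trans (Eq.trans ?_ h2.symm)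
  have hh : ∀ a b, hessF c.e (r • s) a b = r • hessF c.e s a b := fun a b => by
    have : gradF c.e (r • s) = fun a => r • gradF c.e s a :=
      funext fun a => by simp only [gradF, Derivation.map_smul]
    rw [hessF, this, cov1F_smul]; rfl
  have : ∀ a b, LopF c.e (r • s) a b = r • LopF c.e s a b := fun a b => by
    simp only [LopF, lapF, hh, deltaF, smul_sub, ← Finset.smul_sum]
    split_ifs
    · rw [smul_comm]
    · simp
  simp only [this]

end S3Chart

namespace Pieces

variable {M : ℝ} {c : S3Chart}

open S3Chart

/-- Pieces matter only over the region and the chart domain. This allows curls of fields multiplied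
by functions of `y` to be replaced by their factored form, which agrees only there. -/
lemma Admissible.ofVT_congr {va va' : (Fin 2 → ℝ) → (Fin 3 → ℝ) → Fin 2 → Fin 3 → ℂ}
    {vi vi' : (Fin 2 → ℝ) → (Fin 3 → ℝ) → Fin 3 → ℂ}
    {tij tij' : (Fin 2 → ℝ) → (Fin 3 → ℝ) → Fin 3 → Fin 3 → ℂ}
    (h : (ofVT va vi tij).Admissible M c)
    (h1 : ∀ y ∈ regionY M, ∀ z ∈ c.dom, ∀ a i, va' y z a i = va y z a i)
    (h2 : ∀ y ∈ regionY M, ∀ z ∈ c.dom, ∀ i, vi' y z i = vi y z i)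
    (h3 : ∀ y ∈ regionY M, ∀ z ∈ c.dom, ∀ i j, tij' y z i j = tij y z i j) :
    (ofVT va' vi' tij').Admissible M c ∧ ∀ x ∈ region M c, ∀ μ ν,
      (ofVT va' vi' tij').toTensor c x μ ν = (ofVT va vi tij).toTensor c x μ ν := by
  obtain ⟨⟨s1, s2, s3, s4, s5, s6, s7⟩, hadm⟩ := h
  refine ⟨⟨⟨s1, s2, s3, s4, ?_, ?_, ?_⟩, fun y hy z hz => ⟨fun _ _ => rfl, fun i j => ?_,
    fun a => ?_, ?_, fun j => ?_, ?_⟩⟩, fun x hx μ ν => ?_⟩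
  · exact s5.congr fun q hq => funext₂ fun a i => h1 q.1 hq.1 q.2 hq.2 a i
  · exact s6.congr fun q hq => funext fun i => h2 q.1 hq.1 q.2 hq.2 i
  · exact s7.congr fun q hq => funext₂ fun i j => h3 q.1 hq.1 q.2 hq.2 i j
  · exact (h3 y hy z hz i j).trans (((hadm y hy z hz).2.1 i j).trans (h3 y hy z hz j i).symm)
  · have := (hadm y hy z hz).2.2.1 a
    simp only [div1, ofVT] at this ⊢
    rw [← this]
    simp only [cov1_congr (w := fun z => va' y z a) (fun z hz i => h1 y hy z hz a i) hz]
  · have := (hadm y hy z hz).2.2.2.1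
    simp only [div1, ofVT] at this ⊢
    rw [← this]
    simp only [cov1_congr (w := vi' y) (fun z hz i => h2 y hy z hz i) hz]
  · have := (hadm y hy z hz).2.2.2.2.1 j
    simp only [div2, ofVT] at this ⊢
    rw [← this]
    simp only [cov2_congr c.isOpen_dom (T := tij' y) (fun z hz i j => h3 y hy z hz i j) hz]
  · have := (hadm y hy z hz).2.2.2.2.2
    simp only [trace2, ofVT] at this ⊢
    rw [← this]
    simp only [h3 y hy z hz]
  · have hsg : ∀ i j, symGrad c.metric (vi' (yOf x)) (zOf x) i j
        = symGrad c.metric (vi (yOf x)) (zOf x) i j := fun i j => by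
      simp only [symGrad, cov1_congr (w := vi' (yOf x)) (fun z hz i => h2 _ hx.1 z hz i) hx.2]
    rcases μ with a | i <;> rcases ν with b | j <;>
      simp only [toTensor, blocks, ofVT, h1 _ hx.1 _ hx.2, h3 _ hx.1 _ hx.2, hsg]

end Pieces

open Pieces S3Chart

variable {M : ℝ} {c : S3Chart}

lemma contDiff_radius : ContDiff ℝ ∞ (fun y : Fin 2 → ℝ => ((y 1 : ℝ) : ℂ)) :=
  Complex.ofRealCLM.contDiff.comp (contDiff_apply ℝ ℝ 1)

/-- Scalar modes are annihilated by the symmetry operator. -/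
theorem Zop_scalarMode {S : (Fin 3 → ℝ) → ℂ} {κ : ℝ} (hev : κ ≠ 0)
    (hS : ContDiffOn ℝ ∞ S c.dom) (hlap : ∀ z ∈ c.dom, lap c.metric S z + (κ ^ 2) • S z = 0)
    {fab : (Fin 2 → ℝ) → Fin 2 → Fin 2 → ℂ} {fa : (Fin 2 → ℝ) → Fin 2 → ℂ}
    {HL HT : (Fin 2 → ℝ) → ℂ} (hfab : ContDiffOn ℝ ∞ fab (regionY M))
    (hfa : ContDiffOn ℝ ∞ fa (regionY M)) (hHL : ContDiffOn ℝ ∞ HL (regionY M))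
    (hHT : ContDiffOn ℝ ∞ HT (regionY M)) (hsym : ∀ y ∈ regionY M, ∀ a b, fab y a b = fab y b a)
    {x : Idx5 → ℝ} (hx : x ∈ region M c) (μ ν : Idx5) :
    Zop M c (scalarMode c κ S fab fa HL HT) x μ ν = 0 := by
  -- The mode as purely scalar pieces: `h_a = -(r/κ) f_a S`, `h_L = 2r² H_L S`, `h_T = (2r²/κ²) H_T
  -- S`.
  set p : Pieces (Fin 3) :=
    { ab := fun y z a b => fab y a b * S z
      sa := fun y z a => ((y 1 : ℂ) * (-(1 / κ : ℝ) : ℂ) * fa y a) * S z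
      sL := fun y z => (2 * (y 1 : ℂ) ^ 2 * HL y) * S z
      sT := fun y z => (2 * (y 1 : ℂ) ^ 2 * (1 / κ ^ 2 : ℝ) * HT y) * S z
      va := fun _ _ _ _ => 0
      vi := fun _ _ _ => 0
      tij := fun _ _ _ _ => 0 } with hpdef
  have hr : ContDiffOn ℝ ∞ (fun y : Fin 2 → ℝ => ((y 1 : ℝ) : ℂ)) (regionY M) :=
    contDiff_radius.contDiffOn
  have hp : p.Admissible M c := by
    refine ⟨⟨?_, ?_, ?_, ?_, contDiffOn_const, contDiffOn_const, contDiffOn_const⟩,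
      fun y hy z hz => ⟨fun a b => by simp only [hpdef, hsym y hy a b], fun _ _ => rfl,
        fun a => ?_, ?_, fun j => ?_, ?_⟩⟩
    · exact contDiffOn_pi.2 fun a => contDiffOn_pi.2 fun b =>
        (ContDiffOn.ofY (contDiffOn_pi.1 (contDiffOn_pi.1 hfab a) b)).mul hS.ofZ
    · exact contDiffOn_pi.2 fun a =>
        (ContDiffOn.ofY ((hr.mul contDiffOn_const).mul (contDiffOn_pi.1 hfa a))).mul hS.ofZ
    · exact (ContDiffOn.ofY ((contDiffOn_const.mul (hr.pow 2)).mul hHL)).mul hS.ofZ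
    · exact (ContDiffOn.ofY (((contDiffOn_const.mul (hr.pow 2)).mul contDiffOn_const).mul
        hHT)).mul hS.ofZ
    all_goals simp [hpdef, div1, div2, trace2, cov1, cov2, pd]
  have hsp : p.scalarPart = p := rfl
  rw [← Zop_scalarPart hp hx μ ν, hsp]
  refine Zop_congr (fun x hx μ ν => ?_) hx μ ν
  have hai : ∀ a i, yOf x 1 • (fa (yOf x) a * ((-(1 / κ)) • grad S (zOf x) i))
      = grad (fun z => p.sa (yOf x) z a) (zOf x) i + 0 := fun a i => by
    rw [hpdef, grad_const_mul hS hx.2, Complex.real_smul, Complex.real_smul]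
    push_cast; ring
  rcases μ with a | i <;> rcases ν with b | j
  · rfl
  · exact hai a j
  · exact hai b i
  · have h1 := Lop_const_mul hS hx.2 (2 * (yOf x 1 : ℂ) ^ 2 * (1 / κ ^ 2 : ℝ) * HT (yOf x)) i j
    -- By the eigenvalue equation, `κ⁻² L_{ij} S = κ⁻² D_i D_j S + (1/3) γ_{ij} S`, so the trace
    -- term of the mode is already contained in `L_{ij} h_T`.
    have hl := eq_neg_of_add_eq_zero_left (hlap _ hx.2)
    simp only [scalarMode, toTensor, blocks, hpdef, h1]
    simp only [Lop, hl, symGrad, cov1, pd, Complex.real_smul]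
    have hc : (κ : ℂ) ≠ 0 := by exact_mod_cast hev
    simp
    field_simp

/-- The symmetry operator on vector modes. -/
theorem Zop_vectorMode {V : (Fin 3 → ℝ) → Fin 3 → ℂ} {κ : ℝ} (hV : ContDiffOn ℝ ∞ V c.dom)
    (hdiv : ∀ z ∈ c.dom, div1 c.metric V z = 0) {fa : (Fin 2 → ℝ) → Fin 2 → ℂ}
    {HT : (Fin 2 → ℝ) → ℂ} (hfa : ContDiffOn ℝ ∞ fa (regionY M))
    (hHT : ContDiffOn ℝ ∞ HT (regionY M)) {q : Pieces (Fin 3)} (hq : q = Pieces.ofVT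
      (fun y z a i => y 1 • (fa y a * curl c.metric V z i))
      (fun y z i => (-(y 1 ^ 2 / κ)) • (HT y * curl c.metric V z i)) (fun _ _ _ _ => 0)) :
    q.Admissible M c ∧ ∀ x ∈ region M c, ∀ μ ν,
      Zop M c (vectorMode c κ V fa HT) x μ ν = q.toTensor c x μ ν := by
  -- Since `2 D_{(i} h_{T j)}` enters the decomposition, the factor `2r²` of the mode leaves `h_{T
  -- i} = -(r²/κ) H_T V_i`.
  set p : Pieces (Fin 3) := ofVT (fun y z a i => ((y 1 : ℂ) * fa y a) * V z i)
    (fun y z i => ((-(y 1 : ℂ) ^ 2 * (1 / κ : ℝ)) * HT y) * V z i) (fun _ _ _ _ => 0) with hpdef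
  have hr : ContDiffOn ℝ ∞ (fun y : Fin 2 → ℝ => ((y 1 : ℝ) : ℂ)) (regionY M) :=
    contDiff_radius.contDiffOn
  have hp : p.Admissible M c := by
    refine ⟨⟨contDiffOn_const, contDiffOn_const, contDiffOn_const, contDiffOn_const, ?_, ?_,
      contDiffOn_const⟩, fun y hy z hz => ⟨fun _ _ => rfl, fun _ _ => rfl, fun a => ?_, ?_,
        fun j => ?_, ?_⟩⟩
    · exact contDiffOn_pi.2 fun a => contDiffOn_pi.2 fun i =>
        (ContDiffOn.ofY (hr.mul (contDiffOn_pi.1 hfa a))).mul (contDiffOn_pi.1 hV i).ofZ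
    · exact contDiffOn_pi.2 fun i =>
        (ContDiffOn.ofY (((hr.pow 2).neg.mul contDiffOn_const).mul hHT)).mul
          (contDiffOn_pi.1 hV i).ofZ
    · exact (div1_const_mul hV hz _).trans (by rw [hdiv z hz, mul_zero])
    · exact (div1_const_mul hV hz _).trans (by rw [hdiv z hz, mul_zero])
    · simp [hpdef, ofVT, div2, cov2, pd]
    · simp [hpdef, ofVT, trace2]
  obtain ⟨h1, h2⟩ := hp.image.ofVT_congr
    (va' := fun y z a i => y 1 • (fa y a * curl c.metric V z i))
    (vi' := fun y z i => (-(y 1 ^ 2 / κ)) • (HT y * curl c.metric V z i))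
    (tij' := fun _ _ _ _ => 0)
    (fun y hy z hz a i => ((curl_const_mul hV hz _ i).trans (by
      rw [Complex.real_smul]; ring)).symm)
    (fun y hy z hz i => ((curl_const_mul hV hz _ i).trans (by
      rw [Complex.real_smul]; push_cast; ring)).symm)
    (fun y hy z hz i j => by simp [hpdef, ofVT, symCurl, cov2, pd])
  rw [hq]
  refine ⟨h1, fun x hx μ ν => ?_⟩
  rw [h2 x hx μ ν]
  refine Eq.trans (Zop_congr (fun x hx μ ν => ?_) hx μ ν) (Zop_toTensor hp hx μ ν)
  have hai : ∀ a i, yOf x 1 • (fa (yOf x) a * V (zOf x) i)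
      = grad (fun z => 0) (zOf x) i + ((yOf x 1 : ℂ) * fa (yOf x) a) * V (zOf x) i :=
    fun a i => by
      simp [grad, pd, Complex.real_smul, mul_assoc]
  rcases μ with a | i <;> rcases ν with b | j
  · rfl
  · exact hai a j
  · exact hai b i
  · have h1 := symGrad_const_mul hV hx.2 ((-(yOf x 1 : ℂ) ^ 2 * (1 / κ : ℝ)) * HT (yOf x)) i j
    simp only [vectorMode, toTensor, blocks, hpdef, ofVT, h1]
    simp [Complex.real_smul, Lop, lap, hess, cov1, grad, pd]
    ring

/-- The symmetry operator on tensor modes. -/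
theorem Zop_tensorMode {T : (Fin 3 → ℝ) → Fin 3 → Fin 3 → ℂ} (hT : ContDiffOn ℝ ∞ T c.dom)
    (hTT : ∀ z ∈ c.dom, (∀ i j, T z i j = T z j i) ∧ (∀ j, div2 c.metric T z j = 0) ∧
      trace2 c.metric T z = 0)
    {HT : (Fin 2 → ℝ) → ℂ} (hHT : ContDiffOn ℝ ∞ HT (regionY M)) {q : Pieces (Fin 3)}
    (hq : q = Pieces.ofVT (fun _ _ _ _ => 0) (fun _ _ _ => 0)
      (fun y z i j => (2 * y 1 ^ 2) • (HT y * symCurl c.metric T z i j))) :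
    q.Admissible M c ∧ ∀ x ∈ region M c, ∀ μ ν,
      Zop M c (tensorMode T HT) x μ ν = q.toTensor c x μ ν := by
  set p : Pieces (Fin 3) := ofVT (fun _ _ _ _ => 0) (fun _ _ _ => 0)
    (fun y z i j => (2 * (y 1 : ℂ) ^ 2 * HT y) * T z i j) with hpdef
  have hr : ContDiffOn ℝ ∞ (fun y : Fin 2 → ℝ => ((y 1 : ℝ) : ℂ)) (regionY M) :=
    contDiff_radius.contDiffOn
  have hp : p.Admissible M c := by
    refine ⟨⟨contDiffOn_const, contDiffOn_const, contDiffOn_const, contDiffOn_const,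
      contDiffOn_const, contDiffOn_const, ?_⟩, fun y hy z hz => ⟨fun _ _ => rfl, fun i j => ?_,
        fun a => ?_, ?_, fun j => ?_, ?_⟩⟩
    · exact contDiffOn_pi.2 fun i => contDiffOn_pi.2 fun j =>
        (ContDiffOn.ofY ((contDiffOn_const.mul (hr.pow 2)).mul hHT)).mul
          (contDiffOn_pi.1 (contDiffOn_pi.1 hT i) j).ofZ
    · simp only [hpdef, ofVT, (hTT z hz).1 i j]
    · simp [hpdef, ofVT, div1, cov1, pd]
    · simp [hpdef, ofVT, div1, cov1, pd]
    · exact (div2_const_mul hT hz _ j).trans (by rw [(hTT z hz).2.1 j, mul_zero])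
    · have := (hTT z hz).2.2
      simp only [trace2, hpdef, ofVT, Complex.real_smul] at this ⊢
      refine Eq.trans ?_ ((congrArg (fun s => 2 * (y 1 : ℂ) ^ 2 * HT y * s) this).trans (mul_zero _))
      rw [Finset.mul_sum]
      refine Finset.sum_congr rfl fun i _ => ?_
      rw [Finset.mul_sum]
      exact Finset.sum_congr rfl fun j _ => by ring
  obtain ⟨h1, h2⟩ := hp.image.ofVT_congr (va' := fun _ _ _ _ => 0) (vi' := fun _ _ _ => 0)
    (tij' := fun y z i j => (2 * y 1 ^ 2) • (HT y * symCurl c.metric T z i j))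
    (fun y hy z hz a i => by simp [hpdef, ofVT, curl, cov1, pd])
    (fun y hy z hz i => by simp [hpdef, ofVT, curl, cov1, pd])
    (fun y hy z hz i j => ((symCurl_const_mul hT hz _ i j).trans (by
      rw [Complex.real_smul]; push_cast; ring)).symm)
  rw [hq]
  refine ⟨h1, fun x hx μ ν => ?_⟩
  rw [h2 x hx μ ν]
  refine Eq.trans (Zop_congr (fun x hx μ ν => ?_) hx μ ν) (Zop_toTensor hp hx μ ν)
  rcases μ with a | i <;> rcases ν with b | j
  · rfl
  · simp [tensorMode, toTensor, blocks, hpdef, ofVT, grad, pd]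
  · simp [tensorMode, toTensor, blocks, hpdef, ofVT, grad, pd]
  · simp [tensorMode, toTensor, blocks, hpdef, ofVT, symGrad, Complex.real_smul, Lop, lap, hess,
      cov1, grad, pd, mul_assoc]

/-! ## Tensor fields on the whole sphere -/

section Pullback

variable {ι κ : Type} [Fintype ι] [DecidableEq ι] [Fintype κ] [DecidableEq κ]
  {U : Opens (ι → ℝ)} {V : Opens (κ → ℝ)} {g : (ι → ℝ) → κ → ℝ}

/-- The pull-back of smooth functions. -/
def pullS (hg : ContDiffOn ℝ ∞ g U) (hm : ∀ u ∈ U, g u ∈ V) : Sm V →ₗ[ℂ] Sm U where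
  toFun b := ⟨fun u => ev ⟨g u, hm u u.2⟩ b, rep b ∘ g, (contDiffOn_rep b).comp hg hm,
    fun u => (lift_rep b ⟨g u, hm u u.2⟩).symm⟩
  map_add' _ _ := rfl
  map_smul' _ _ := rfl

variable {hg : ContDiffOn ℝ ∞ g U} {hm : ∀ u ∈ U, g u ∈ V}

@[simp] lemma ev_pullS (u : U) (b : Sm V) : ev u (pullS hg hm b) = ev ⟨g u, hm u u.2⟩ b := rfl

lemma lift_pullS {f : (κ → ℝ) → ℂ} {b : Sm V} (h : Lift f b) :
    Lift (fun z => f (g z)) (pullS hg hm b) := fun u => h ⟨g u, hm u u.2⟩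

/-- The directional derivative of an element of `Sm V`. -/
def dirD (v : V) (w : κ → ℝ) (b : Sm V) : ℂ := ∑ k, (w k : ℂ) * ev v (pdS k b)

lemma fderiv_apply_eq_dirD {f : (κ → ℝ) → ℂ} {b : Sm V} (h : Lift f b) (v : V) (w : κ → ℝ) :
    fderiv ℝ f v w = dirD v w b := by
  conv_lhs => rw [← Finset.univ_sum_single w]
  rw [map_sum, dirD]
  refine Finset.sum_congr rfl fun k _ => ?_
  rw [h.ev_pdS k v, pd, ← Complex.real_smul, ← map_smul]
  congr 1
  funext j
  by_cases hj : j = k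
  · subst hj; simp
  · simp [hj]

lemma dirD_pullS (u : U) (w : ι → ℝ) (b : Sm V) :
    dirD u w (pullS hg hm b) = dirD ⟨g u, hm u u.2⟩ (fderiv ℝ g u w) b := by
  have hgd : DifferentiableAt ℝ g u :=
    (hg.contDiffAt (U.isOpen.mem_nhds u.2)).differentiableAt (by simp)
  rw [← fderiv_apply_eq_dirD (lift_rep b), ← fderiv_apply_eq_dirD (lift_pullS (lift_rep b))]
  change fderiv ℝ (rep b ∘ g) u w = _
  have hb : DifferentiableAt ℝ (rep b) (g u) := (lift_rep b).differentiableAt ⟨g u, hm u u.2⟩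
  rw [fderiv_comp (u : ι → ℝ) hb hgd]
  rfl

end Pullback

/-- The punctured space `ℝ⁴ ∖ {0}`. -/
def punctured : Opens (Fin 4 → ℝ) := ⟨{n | n ≠ 0}, isOpen_ne⟩

/-- The components of the left-invariant vector fields as smooth functions. -/
def quatS (a : Fin 3) (A : Fin 4) : Sm punctured :=
  mkS (fun x => (quatJ a x A : ℂ)) (contDiffOn_ofReal
    (((contDiff_apply ℝ ℝ A).comp (quatJL a).contDiff).contDiffOn))

@[simp] lemma ev_quatS (x : punctured) (a : Fin 3) (A : Fin 4) :
    ev x (quatS a A) = (quatJ a x A : ℂ) := rfl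

/-- The left-invariant vector fields on `ℝ⁴ ∖ {0}` as derivations. -/
def quatD (a : Fin 3) : Derivation ℂ (Sm punctured) (Sm punctured) := ∑ A, quatS a A • pdS A

lemma quatD_apply (a : Fin 3) (b : Sm punctured) : quatD a b = ∑ A, quatS a A * pdS A b := by
  simp [quatD, Fin.sum_univ_four]

lemma ev_quatD (x : punctured) (a : Fin 3) (b : Sm punctured) :
    ev x (quatD a b) = dirD x (quatJ a x) b := by
  simp [quatD_apply, dirD]

/-- The coordinate functions. -/
def coordS (A : Fin 4) : Sm punctured :=
  mkS (fun x => (x A : ℂ)) (contDiffOn_ofReal (contDiff_apply ℝ ℝ A).contDiffOn)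

lemma pdS_coordS (A B : Fin 4) : pdS A (coordS B) = if A = B then 1 else 0 := Sm.ext' fun u => by
  have h : Lift (fun x : Fin 4 → ℝ => (x B : ℂ)) (coordS B) := lift_mkS _ _
  have h1 : HasFDerivAt (fun y : Fin 4 → ℝ => y B)
      (ContinuousLinearMap.proj B : (Fin 4 → ℝ) →L[ℝ] ℝ) u := hasFDerivAt_apply B _
  rw [h.ev_pdS, pd_ofReal h1.differentiableAt, pd, h1.fderiv]
  by_cases hAB : A = B
  · subst hAB; simp
  · simp [hAB, Ne.symm hAB]

lemma quatS_eq (a : Fin 3) (A : Fin 4) : quatS a A =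
    ![![-coordS 1, coordS 0, coordS 3, -coordS 2], ![-coordS 2, -coordS 3, coordS 0, coordS 1],
      ![-coordS 3, coordS 2, -coordS 1, coordS 0]] a A := Sm.ext' fun u => by
  rw [ev_quatS]
  fin_cases a <;> fin_cases A <;> simp [quatJ, coordS]

/-- The fields are linear in the Cartesian coordinates and their brackets are those of the imaginary
quaternions, so the relations hold on all of `ℝ⁴ ∖ {0}` and not only on the sphere. -/
lemma quatD_frameComm : FrameComm quatD := by
  have e : ∀ A B (f : Sm punctured), pdS A (pdS B f) = pdS B (pdS A f) := pdS_comm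
  constructor <;> intro f <;>
  · simp only [quatD_apply, quatS_eq, Fin.sum_univ_four, Matrix.cons_val]
    simp only [map_add, map_neg, Derivation.leibniz, smul_eq_mul, pdS_coordS,
      e 1 0, e 2 0, e 3 0, e 2 1, e 3 1, e 3 2]
    simp [Algebra.smul_def, map_ofNat]
    ring

namespace S3Chart

variable (c : S3Chart)

lemma emb_mem (z : Fin 3 → ℝ) (hz : z ∈ c.U) : c.emb z ∈ punctured := fun h => by
  have := c.unit z hz
  rw [h] at this
  simp at this

/-- Restriction to the sphere, in a chart, of functions on `ℝ⁴ ∖ {0}`. -/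
def restr : Sm punctured →ₗ[ℂ] Sm c.U := pullS c.contDiff c.emb_mem

variable {c}

lemma ev_restr (u : c.U) (b : Sm punctured) :
    ev u (c.restr b) = ev ⟨c.emb u, c.emb_mem u u.2⟩ b := rfl

lemma dirD_restr (u : c.U) (w : Fin 3 → ℝ) (b : Sm punctured) : dirD u w (c.restr b)
    = dirD ⟨c.emb u, c.emb_mem u u.2⟩ (fderiv ℝ c.emb u w) b :=
  dirD_pullS (hg := c.contDiff) (hm := c.emb_mem) u w b

/-- `quatJ a` is tangent to the sphere and the coframe expresses `∂_i X` through it. The chart frame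
is thus the restriction of the global one, and frame identities can be moved between the two. -/
lemma restr_quatD (a : Fin 3) (b : Sm punctured) : c.restr (quatD a b) = c.e a (c.restr b) := by
  have key : ∀ i, pdS i (c.restr b) = ∑ a, c.th a i * c.restr (quatD a b) := fun i =>
    Sm.ext' fun u => by
      have h1 : ev u (pdS i (c.restr b)) = dirD u (Pi.single i 1) (c.restr b) := by
        rw [dirD, Finset.sum_eq_single i (fun j _ hj => by simp [hj]) (by simp)]
        simp
      have h2 : fderiv ℝ c.emb u (Pi.single i 1)
          = fun A => ∑ a, c.cofr u a i * quatJ a (c.emb u) A := funext (pd_emb_eq u.2 i)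
      rw [h1, dirD_restr, h2]
      simp only [map_sum, map_mul, ev_th, ev_restr, ev_quatD, dirD]
      push_cast
      simp only [Finset.mul_sum, Finset.sum_mul]
      rw [Finset.sum_comm]
      exact Finset.sum_congr rfl fun _ _ => Finset.sum_congr rfl fun _ _ => by ring
  rw [e_apply]
  simp only [key, fr_contract]

end S3Chart

/-! ### Frame operators commute with linear maps that intertwine the frames -/

section Naturality

variable {R R' : Type} [CommRing R] [Algebra ℂ R] [CommRing R'] [Algebra ℂ R']
  {e : Fin 3 → Derivation ℂ R R} {e' : Fin 3 → Derivation ℂ R' R'} {P : R →ₗ[ℂ] R'}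

lemma map_cov1F (hP : ∀ a b, P (e a b) = e' a (P b)) (v : Fin 3 → R) (a b : Fin 3) :
    P (cov1F e v a b) = cov1F e' (fun a => P (v a)) a b := by
  simp only [cov1F, map_sub, hP, map_sum, map_smul]

lemma map_cov2F (hP : ∀ a b, P (e a b) = e' a (P b)) (t : Fin 3 → Fin 3 → R) (a b d : Fin 3) :
    P (cov2F e t a b d) = cov2F e' (fun a b => P (t a b)) a b d := by
  simp only [cov2F, map_sub, hP, map_sum, map_smul]

lemma map_gradF (hP : ∀ a b, P (e a b) = e' a (P b)) (f : R) (a : Fin 3) :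
    P (gradF e f a) = gradF e' (P f) a := hP a f

lemma map_curlF (hP : ∀ a b, P (e a b) = e' a (P b)) (v : Fin 3 → R) (a : Fin 3) :
    P (curlF e v a) = curlF e' (fun a => P (v a)) a := by
  simp only [curlF, map_sum, map_smul, map_cov1F hP]

lemma map_div1F (hP : ∀ a b, P (e a b) = e' a (P b)) (v : Fin 3 → R) :
    P (div1F e v) = div1F e' (fun a => P (v a)) := by
  simp only [div1F, map_sum, map_cov1F hP]

lemma map_div2F (hP : ∀ a b, P (e a b) = e' a (P b)) (t : Fin 3 → Fin 3 → R) (b : Fin 3) :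
    P (div2F e t b) = div2F e' (fun a b => P (t a b)) b := by
  simp only [div2F, map_sum, map_cov2F hP]

lemma map_symGradF (hP : ∀ a b, P (e a b) = e' a (P b)) (v : Fin 3 → R) (a b : Fin 3) :
    P (symGradF e v a b) = symGradF e' (fun a => P (v a)) a b := by
  simp only [symGradF, map_smul, map_add, map_cov1F hP]

lemma map_symCurlF (hP : ∀ a b, P (e a b) = e' a (P b)) (t : Fin 3 → Fin 3 → R) (a b : Fin 3) :
    P (symCurlF e t a b) = symCurlF e' (fun a b => P (t a b)) a b := by
  simp only [symCurlF, map_sum, map_smul, map_add, map_cov2F hP]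

lemma map_hessF (hP : ∀ a b, P (e a b) = e' a (P b)) (f : R) (a b : Fin 3) :
    P (hessF e f a b) = hessF e' (P f) a b := by
  simp only [hessF, map_cov1F hP, map_gradF hP]

lemma map_deltaF (f : R) (a b : Fin 3) : P (deltaF f a b) = deltaF (P f) a b := by
  simp only [deltaF, apply_ite P, map_zero]

lemma map_LopF (hP : ∀ a b, P (e a b) = e' a (P b)) (f : R) (a b : Fin 3) :
    P (LopF e f a b) = LopF e' (P f) a b := by
  simp only [LopF, map_sub, map_hessF hP, map_deltaF, map_smul, lapF, map_sum]

lemma map_traceF (t : Fin 3 → Fin 3 → R) : P (traceF t) = traceF (fun a b => P (t a b)) := by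
  simp only [traceF, map_sum]

end Naturality

/-! ### Homogeneous extension -/

/-- The radial projection of `ℝ⁴ ∖ {0}` to the unit sphere. -/
def radialProj (x : Fin 4 → ℝ) : Fin 4 → ℝ := (Real.sqrt (∑ A, x A ^ 2))⁻¹ • x

lemma sum_sq_pos {x : Fin 4 → ℝ} (hx : x ≠ 0) : 0 < ∑ A, x A ^ 2 := by
  obtain ⟨A, hA⟩ := Function.ne_iff.1 hx
  exact Finset.sum_pos' (fun _ _ => sq_nonneg _) ⟨A, Finset.mem_univ A, by
    have : x A ≠ 0 := hA
    positivity⟩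

lemma sum_sq_radialProj {x : Fin 4 → ℝ} (hx : x ≠ 0) : ∑ A, radialProj x A ^ 2 = 1 := by
  have h := sum_sq_pos hx
  simp only [radialProj, Pi.smul_apply, smul_eq_mul, mul_pow, ← Finset.mul_sum, inv_pow,
    Real.sq_sqrt h.le]
  exact inv_mul_cancel₀ h.ne'

lemma radialProj_of_unit {x : Fin 4 → ℝ} (hx : ∑ A, x A ^ 2 = 1) : radialProj x = x := by
  simp [radialProj, hx]

lemma radialProj_ne {x : Fin 4 → ℝ} (hx : x ≠ 0) : radialProj x ≠ 0 := fun h => by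
  have := sum_sq_radialProj hx
  rw [h] at this
  simp at this

lemma hasFDerivAt_sum_sq (x v : Fin 4 → ℝ) :
    ∃ f' : (Fin 4 → ℝ) →L[ℝ] ℝ, HasFDerivAt (fun x : Fin 4 → ℝ => ∑ A, x A ^ 2) f' x ∧
      f' v = 2 * ∑ A, x A * v A := by
  have hA : ∀ A, HasFDerivAt (fun x : Fin 4 → ℝ => x A)
    (ContinuousLinearMap.proj A : (Fin 4 → ℝ) →L[ℝ] ℝ) x := fun A => hasFDerivAt_apply A x
  refine ⟨_, HasFDerivAt.fun_sum (u := Finset.univ) fun A _ => (hA A).pow 2, ?_⟩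
  rw [sum_apply, Finset.mul_sum]
  exact Finset.sum_congr rfl fun A _ => by simp; ring

lemma contDiffOn_radialProj : ContDiffOn ℝ ∞ radialProj punctured := by
  have h : ContDiff ℝ ∞ (fun x : Fin 4 → ℝ => ∑ A, x A ^ 2) := by fun_prop
  exact ((h.contDiffOn.sqrt fun x hx => (sum_sq_pos hx).ne').inv fun x hx =>
    (Real.sqrt_pos.2 (sum_sq_pos hx)).ne').smul contDiffOn_id

/-- The radius is constant along `quatJ a x`, so only the factor `x` is differentiated, and
linearity of `quatJ a` moves the scaling inside. Hence degree-zero extension commutes with the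
frame. -/
lemma fderiv_radialProj {x : Fin 4 → ℝ} (hx : x ≠ 0) (a : Fin 3) :
    fderiv ℝ radialProj x (quatJ a x) = quatJ a (radialProj x) := by
  obtain ⟨f', hf, hv⟩ := hasFDerivAt_sum_sq x (quatJ a x)
  have hs := (hf.sqrt (sum_sq_pos hx).ne')
  have hne := (Real.sqrt_pos.2 (sum_sq_pos hx)).ne'
  have hi := (hasDerivAt_inv hne).comp_hasFDerivAt x hs
  have h2 := hi.smul (hasFDerivAt_id x)
  have h3 : HasFDerivAt radialProj _ x := h2
  rw [h3.fderiv]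
  have h0 : f' (quatJ a x) = 0 := by rw [hv, quatJ_orthogonal, mul_zero]
  simp [radialProj, quatJ_smul, h0]

/-- The extension of functions on the sphere to functions on `ℝ⁴ ∖ {0}` of degree zero. -/
def homog : Sm punctured →ₗ[ℂ] Sm punctured :=
  pullS contDiffOn_radialProj fun _ hu => radialProj_ne hu

lemma ev_homog (x : punctured) (b : Sm punctured) :
    ev x (homog b) = ev ⟨radialProj x, radialProj_ne x.2⟩ b := rfl

lemma homog_quatD (a : Fin 3) (b : Sm punctured) : homog (quatD a b) = quatD a (homog b) :=
  Sm.ext' fun u => by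
    have h : dirD u (quatJ a u) (homog b) = dirD ⟨radialProj u, radialProj_ne u.2⟩
        (fderiv ℝ radialProj u (quatJ a u)) b := dirD_pullS u _ b
    rw [ev_quatD, h, ev_homog, ev_quatD, fderiv_radialProj u.2]

lemma ev_homog_of_unit {x : punctured} (hx : ∑ A, (x : Fin 4 → ℝ) A ^ 2 = 1)
    (b : Sm punctured) : ev x (homog b) = ev x b := by
  rw [ev_homog]
  congr 2
  exact Subtype.ext (radialProj_of_unit hx)

/-! ### Charts through every point -/

/-- The hyperspherical chart followed by a double transposition of the coordinates of `ℝ⁴`. -/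
def hyperChart' : S3Chart where
  dom := hyperDom
  emb z := ![hyperEmb z 1, hyperEmb z 0, hyperEmb z 3, hyperEmb z 2]
  isOpen_dom := isOpen_hyperDom
  contDiff := by
    have := contDiff_pi.1 contDiff_hyperEmb
    refine ContDiff.contDiffOn (contDiff_pi.2 fun A => ?_)
    fin_cases A <;> simp [this]
  unit := fun z _ => by
    have := hyperEmb_unit z
    simp only [Fin.sum_univ_four, Matrix.cons_val] at this ⊢
    linarith
  oriented := fun z hz => by
    have h := hyperEmb_oriented z hz
    have hd : DifferentiableAt ℝ hyperEmb z := (contDiff_hyperEmb.differentiable (by simp)) z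
    have hp : ∀ i, pd i (fun z => ![hyperEmb z 1, hyperEmb z 0, hyperEmb z 3, hyperEmb z 2]) z
        = ![pd i hyperEmb z 1, pd i hyperEmb z 0, pd i hyperEmb z 3, pd i hyperEmb z 2] := by
      intro i
      have hd' : DifferentiableAt ℝ
          (fun z => ![hyperEmb z 1, hyperEmb z 0, hyperEmb z 3, hyperEmb z 2]) z := by
        refine differentiableAt_pi.2 fun A => ?_
        have := differentiableAt_pi.1 hd
        fin_cases A <;> simp [this]
      funext A
      rw [← S3Chart.pd_apply hd']
      fin_cases A <;> simp [S3Chart.pd_apply hd]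
    rw [hp, hp, hp]
    convert h using 1
    simp [Matrix.det_succ_row_zero, Fin.sum_univ_succ, Fin.succAbove]
    ring

/-- The chart misses exactly the circle `n 1 = n 2 = 0`, where `sin χ sin ϑ = 0`. -/
lemma exists_hyperEmb {n : Fin 4 → ℝ} (hn : ∑ A, n A ^ 2 = 1) (h : n 1 ≠ 0 ∨ n 2 ≠ 0) :
    ∃ z ∈ hyperDom, hyperEmb z = n := by
  simp only [Fin.sum_univ_four] at hn
  have hpos : 0 < n 1 ^ 2 + n 2 ^ 2 := by
    rcases h with h | h
    · have := sq_nonneg (n 2); have : 0 < n 1 ^ 2 := by positivity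
      linarith
    · have := sq_nonneg (n 1); have : 0 < n 2 ^ 2 := by positivity
      linarith
  have h0 : n 0 ^ 2 < 1 := by nlinarith [sq_nonneg (n 3)]
  obtain ⟨h0l, h0r⟩ := abs_lt.1 ((sq_lt_one_iff_abs_lt_one _).1 h0)
  set s := Real.sqrt (1 - n 0 ^ 2) with hs
  have hsp : 0 < s := Real.sqrt_pos.2 (by linarith)
  have hs2 : s ^ 2 = 1 - n 0 ^ 2 := Real.sq_sqrt (by linarith)
  have h3 : (n 3 / s) ^ 2 < 1 := by
    rw [div_pow, hs2, div_lt_one (by linarith)]; linarith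
  obtain ⟨h3l, h3r⟩ := abs_lt.1 ((sq_lt_one_iff_abs_lt_one _).1 h3)
  -- The azimuth is `arg w`, and `‖w‖` is `sin χ sin ϑ`.
  set w : ℂ := ⟨n 1, n 2⟩ with hw
  have hwn : ‖w‖ = Real.sqrt (n 1 ^ 2 + n 2 ^ 2) := by
    rw [Complex.norm_def, Complex.normSq_apply]; congr 1; simp [hw]; ring
  have hwpos : 0 < ‖w‖ := by rw [hwn]; exact Real.sqrt_pos.2 hpos
  have hw0 : w ≠ 0 := norm_pos_iff.1 hwpos
  have hst : s * Real.sqrt (1 - (n 3 / s) ^ 2) = ‖w‖ := by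
    rw [hwn]
    have : n 1 ^ 2 + n 2 ^ 2 = s ^ 2 * (1 - (n 3 / s) ^ 2) := by
      field_simp; linarith
    rw [this, Real.sqrt_mul (sq_nonneg s), Real.sqrt_sq hsp.le]
  refine ⟨![Real.arccos (n 0), Real.arccos (n 3 / s), Complex.arg w], ⟨?_, ?_⟩, ?_⟩
  · exact ⟨Real.arccos_pos.2 h0r, Real.arccos_lt_pi.2 h0l⟩
  · exact ⟨Real.arccos_pos.2 h3r, Real.arccos_lt_pi.2 h3l⟩
  · have hc : ‖w‖ * Real.cos (Complex.arg w) = n 1 := by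
      rw [Complex.cos_arg hw0]; field_simp; rfl
    have hsn : ‖w‖ * Real.sin (Complex.arg w) = n 2 := by
      rw [Complex.sin_arg]; field_simp; rfl
    funext A
    fin_cases A
    · simp [hyperEmb, Real.cos_arccos h0l.le h0r.le]
    · simp only [hyperEmb, Matrix.cons_val, Fin.mk_one, Real.sin_arccos]
      rw [← mul_assoc, ← hs, hst, hc]
    · simp only [hyperEmb, Matrix.cons_val, Fin.reduceFinMk, Real.sin_arccos]
      rw [← mul_assoc, ← hs, hst, hsn]
    · simp only [hyperEmb, Matrix.cons_val, Fin.reduceFinMk, Real.sin_arccos]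
      rw [← hs, Real.cos_arccos h3l.le h3r.le]
      field_simp

/-- The circles missed by the two hyperspherical charts are disjoint. A double transposition is an
even permutation, so the second chart is positively oriented too. -/
lemma exists_chart {n : Fin 4 → ℝ} (hn : ∑ A, n A ^ 2 = 1) :
    ∃ c : S3Chart, ∃ z ∈ c.dom, c.emb z = n := by
  by_cases h : n 1 ≠ 0 ∨ n 2 ≠ 0
  · obtain ⟨z, hz, rfl⟩ := exists_hyperEmb hn h
    exact ⟨hyperChart, z, hz, rfl⟩
  · push Not at h
    obtain ⟨z, hz, he⟩ := exists_hyperEmb (n := ![n 1, n 0, n 3, n 2])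
      (by simp only [Fin.sum_univ_four, Matrix.cons_val] at hn ⊢; linarith)
      (by
        simp only [Matrix.cons_val]
        by_contra h'
        push Not at h'
        simp [Fin.sum_univ_four, h.1, h.2, h'.1, h'.2] at hn)
    refine ⟨hyperChart', z, hz, ?_⟩
    change ![hyperEmb z 1, hyperEmb z 0, hyperEmb z 3, hyperEmb z 2] = n
    rw [he]
    funext A
    fin_cases A <;> simp

/-- A function of degree zero is determined by its values on the unit sphere, which the charts
cover. -/
lemma homog_eq_zero {b : Sm punctured} (h : ∀ c : S3Chart, c.restr b = 0) : homog b = 0 :=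
  Sm.ext' fun x => by
    obtain ⟨c, z, hz, he⟩ := exists_chart (sum_sq_radialProj x.2)
    have h1 := congrArg (ev (⟨z, hz⟩ : c.U)) (h c)
    rw [S3Chart.ev_restr, map_zero] at h1
    rw [ev_homog, map_zero, ← h1]
    congr 2
    exact Subtype.ext he.symm

/-! ### Integration against a radial cut-off -/

/-- A bump function of one variable around `1`. -/
def bumpOne : ContDiffBump (1 : ℝ) := ⟨1 / 4, 1 / 2, by norm_num, by norm_num⟩

/-- A radial cut-off supported away from the origin. -/
def cutoff (x : Fin 4 → ℝ) : ℝ := bumpOne (∑ A, x A ^ 2)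

lemma contDiff_cutoff : ContDiff ℝ ∞ cutoff :=
  bumpOne.contDiff.comp (by fun_prop)

lemma cutoff_nonneg (x : Fin 4 → ℝ) : 0 ≤ cutoff x := bumpOne.nonneg

lemma cutoff_of_unit {x : Fin 4 → ℝ} (hx : ∑ A, x A ^ 2 = 1) : cutoff x ≠ 0 := by
  have : (0 : ℝ) < bumpOne 1 := bumpOne.pos_of_mem_ball (by simp [bumpOne])
  rw [cutoff, hx]
  exact this.ne'

lemma cutoff_eq_zero {x : Fin 4 → ℝ} (h : 1 / 2 ≤ |∑ A, x A ^ 2 - 1|) : cutoff x = 0 :=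
  bumpOne.zero_of_le_dist (by rw [Real.dist_eq]; exact h)

/-- The cut-off is radial and `quatJ a x` is orthogonal to `x`. -/
lemma cutoff_quatJ (x : Fin 4 → ℝ) (a : Fin 3) : fderiv ℝ cutoff x (quatJ a x) = 0 := by
  obtain ⟨f', hf, hv⟩ := hasFDerivAt_sum_sq x (quatJ a x)
  have hb : HasDerivAt bumpOne (deriv bumpOne (∑ A, x A ^ 2)) (∑ A, x A ^ 2) :=
    ((bumpOne.contDiff (n := 1)).differentiable (by simp) _).hasDerivAt
  have h : HasFDerivAt cutoff _ x := hb.comp_hasFDerivAt x hf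
  rw [h.fderiv]
  simp [hv, quatJ_orthogonal]

/-- The product of a function with the cut-off. -/
def cutFun (b : Sm punctured) (x : Fin 4 → ℝ) : ℂ := cutoff x * rep b x

lemma cutFun_zero_nhds (b : Sm punctured) : ∀ᶠ x in nhds (0 : Fin 4 → ℝ), cutFun b x = 0 := by
  have hc : Continuous fun x : Fin 4 → ℝ => ∑ A, x A ^ 2 := by fun_prop
  have : ∀ᶠ x in nhds (0 : Fin 4 → ℝ), ∑ A, x A ^ 2 < 1 / 2 :=
    hc.continuousAt.eventually_lt continuousAt_const (by simp)
  filter_upwards [this] with x hx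
  rw [cutFun, cutoff_eq_zero, Complex.ofReal_zero, zero_mul]
  rw [abs_sub_comm]
  exact le_trans (by linarith) (le_abs_self _)

/-- The puncture does no harm: the cut-off vanishes near the origin, so the product is smooth on all
of `ℝ⁴`, and integration by parts applies there. -/
lemma contDiff_cutFun (b : Sm punctured) : ContDiff ℝ ∞ (cutFun b) := by
  rw [contDiff_iff_contDiffAt]
  intro x
  by_cases hx : x = 0
  · subst hx
    exact (contDiffAt_const (c := (0 : ℂ))).congr_of_eventuallyEq (cutFun_zero_nhds b)
  · exact ((contDiffOn_ofReal contDiff_cutoff.contDiffOn).mul (contDiffOn_rep b)).contDiffAt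
      (punctured.isOpen.mem_nhds hx)

lemma hasCompactSupport_cutoff : HasCompactSupport cutoff := by
  refine HasCompactSupport.intro (isCompact_closedBall (0 : Fin 4 → ℝ) 2) fun x hx => ?_
  have h2 : 2 < ‖x‖ := by simpa using hx
  obtain ⟨A, hA⟩ : ∃ A, 2 < |x A| := by
    by_contra! h
    exact absurd h2 (not_lt.2 ((pi_norm_le_iff_of_nonneg (by norm_num)).2 h))
  have h4 : 4 < x A ^ 2 := by
    rw [← sq_abs]; nlinarith
  have h5 : x A ^ 2 ≤ ∑ A, x A ^ 2 :=
    Finset.single_le_sum (f := fun A => x A ^ 2) (fun _ _ => sq_nonneg _) (Finset.mem_univ A)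
  exact cutoff_eq_zero (le_trans (by linarith) (le_abs_self _))

lemma hasCompactSupport_cutFun (b : Sm punctured) : HasCompactSupport (cutFun b) :=
  (hasCompactSupport_cutoff.comp_left (g := ((↑) : ℝ → ℂ)) (by simp)).mul_right

lemma cutFun_apply (b : Sm punctured) {x : Fin 4 → ℝ} (hx : x ∈ punctured) :
    cutFun b x = cutoff x * ev ⟨x, hx⟩ b := by rw [cutFun, lift_rep b ⟨x, hx⟩]

lemma cutFun_of_not_mem (b : Sm punctured) {x : Fin 4 → ℝ} (hx : ¬ x ∈ punctured) :
    cutFun b x = 0 := by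
  have : x = 0 := by
    by_contra h
    exact hx h
  rw [this]
  exact (cutFun_zero_nhds b).self_of_nhds

lemma integrable_cutFun (b : Sm punctured) : MeasureTheory.Integrable (cutFun b) :=
  (contDiff_cutFun b).continuous.integrable_of_hasCompactSupport (hasCompactSupport_cutFun b)

/-- Integration against the cut-off. -/
def integ : Sm punctured →ₗ[ℂ] ℂ where
  toFun b := ∫ x, cutFun b x
  map_add' a b := by
    rw [← MeasureTheory.integral_add (integrable_cutFun a) (integrable_cutFun b)]
    congr 1
    funext x
    by_cases hx : x ∈ punctured
    · simp only [cutFun_apply _ hx, map_add, mul_add]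
    · simp only [cutFun_of_not_mem _ hx, add_zero]
  map_smul' r b := by
    rw [RingHom.id_apply, smul_eq_mul, ← MeasureTheory.integral_const_mul]
    congr 1
    funext x
    by_cases hx : x ∈ punctured
    · simp only [cutFun_apply _ hx, map_smul, smul_eq_mul]; ring
    · simp only [cutFun_of_not_mem _ hx, mul_zero]

lemma fderiv_cutFun (a : Fin 3) (b : Sm punctured) (x : Fin 4 → ℝ) :
    fderiv ℝ (cutFun b) x (quatJ a x) = cutFun (quatD a b) x := by
  by_cases hx : x ∈ punctured
  · have h1 : HasFDerivAt (fun x => (cutoff x : ℂ)) _ x :=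
      (Complex.ofRealCLM.hasFDerivAt).comp x
        ((contDiff_cutoff.differentiable (by simp)) x).hasFDerivAt
    have h2 := ((lift_rep b).differentiableAt ⟨x, hx⟩).hasFDerivAt
    have h3 : HasFDerivAt (cutFun b) _ x := h1.mul h2
    rw [h3.fderiv, cutFun_apply _ hx, ev_quatD, ← fderiv_apply_eq_dirD (lift_rep b)]
    simp [cutoff_quatJ]
  · have : fderiv ℝ (cutFun b) x = 0 := by
      have h0 : x = 0 := by
        by_contra h
        exact hx h
      rw [h0, Filter.EventuallyEq.fderiv_eq (f := fun _ => (0 : ℂ)) (cutFun_zero_nhds b)]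
      simp
    rw [this, cutFun_of_not_mem _ hx]
    rfl

lemma quatJ_single (a : Fin 3) (A : Fin 4) : quatJ a (Pi.single A 1) A = 0 := by
  fin_cases a <;> fin_cases A <;> simp [quatJ]

/-- Invariance of the integral. The matrix of `quatJ a` has zero diagonal, so integrating by parts
in each coordinate differentiates a coefficient independent of that coordinate; the cut-off is
annihilated by the field, and compact support excludes boundary terms. -/
lemma integ_quatD (a : Fin 3) (b : Sm punctured) : integ (quatD a b) = 0 := by
  have hA : ∀ A, ∫ x, (quatJ a x A : ℂ) * fderiv ℝ (cutFun b) x (Pi.single A 1) = 0 := fun A => by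
    have hJ : ∀ x, HasFDerivAt (fun x : Fin 4 → ℝ => (quatJ a x A : ℂ))
        (Complex.ofRealCLM.comp ((ContinuousLinearMap.proj A).comp (quatJL a))) x := fun x =>
      (Complex.ofRealCLM.comp ((ContinuousLinearMap.proj A).comp (quatJL a))).hasFDerivAt
    have hJ0 : ∀ x, fderiv ℝ (fun x : Fin 4 → ℝ => (quatJ a x A : ℂ)) x (Pi.single A 1) = 0 :=
      fun x => by
        rw [(hJ x).fderiv]
        change ((quatJ a (Pi.single A 1) A : ℝ) : ℂ) = 0
        rw [quatJ_single, Complex.ofReal_zero]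
    have hJc : Continuous fun x : Fin 4 → ℝ => (quatJ a x A : ℂ) :=
      continuous_iff_continuousAt.2 fun x => (hJ x).continuousAt
    have hd : Continuous fun x => fderiv ℝ (cutFun b) x (Pi.single A 1) :=
      ((contDiff_cutFun b).continuous_fderiv (by simp)).clm_apply continuous_const
    have hs : HasCompactSupport fun x => fderiv ℝ (cutFun b) x (Pi.single A 1) :=
      (hasCompactSupport_cutFun b).fderiv_apply ℝ _
    rw [integral_mul_fderiv_eq_neg_fderiv_mul_of_integrable]
    · simp [hJ0]
    · simp [hJ0]
    · exact (hJc.mul hd).integrable_of_hasCompactSupport hs.mul_left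
    · exact (hJc.mul (contDiff_cutFun b).continuous).integrable_of_hasCompactSupport
        (hasCompactSupport_cutFun b).mul_left
    · exact fun x _ => (hJ x).differentiableAt
    · exact fun x _ => ((contDiff_cutFun b).differentiable (by simp)) x
  have hint : ∀ A, MeasureTheory.Integrable
      fun x => (quatJ a x A : ℂ) * fderiv ℝ (cutFun b) x (Pi.single A 1) := fun A => by
    have hJc : Continuous fun x : Fin 4 → ℝ => (quatJ a x A : ℂ) :=
      (Complex.ofRealCLM.comp ((ContinuousLinearMap.proj A).comp (quatJL a))).continuous
    have hd : Continuous fun x => fderiv ℝ (cutFun b) x (Pi.single A 1) :=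
      ((contDiff_cutFun b).continuous_fderiv (by simp)).clm_apply continuous_const
    have hs : HasCompactSupport fun x => fderiv ℝ (cutFun b) x (Pi.single A 1) :=
      (hasCompactSupport_cutFun b).fderiv_apply ℝ _
    exact (hJc.mul hd).integrable_of_hasCompactSupport hs.mul_left
  change ∫ x, cutFun (quatD a b) x = 0
  have : ∀ x, cutFun (quatD a b) x
      = ∑ A, (quatJ a x A : ℂ) * fderiv ℝ (cutFun b) x (Pi.single A 1) := fun x => by
    rw [← fderiv_cutFun, ← Finset.univ_sum_single (quatJ a x), map_sum]
    refine Finset.sum_congr rfl fun A _ => ?_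
    rw [Finset.univ_sum_single, ← Complex.real_smul, ← map_smul]
    congr 1
    funext B
    by_cases hB : B = A
    · subst hB; simp
    · simp [hB]
  simp only [this]
  rw [MeasureTheory.integral_finsetSum _ fun A _ => hint A]
  simp [hA]

lemma contDiffOn_conj {s : Set (Fin 4 → ℝ)} {f : (Fin 4 → ℝ) → ℂ} (hf : ContDiffOn ℝ ∞ f s) :
    ContDiffOn ℝ ∞ (fun x => starRingEnd ℂ (f x)) s :=
  Complex.conjCLE.contDiff.comp_contDiffOn hf

/-- Complex conjugation. -/
def conjS : Sm punctured →+* Sm punctured where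
  toFun b := mkS (fun x => starRingEnd ℂ (rep b x))
    (contDiffOn_conj (contDiffOn_rep b))
  map_one' := Sm.ext' fun u => (congrArg (starRingEnd ℂ) (lift_rep (1 : Sm punctured) u)).trans
    (by simp)
  map_zero' := Sm.ext' fun u => (congrArg (starRingEnd ℂ) (lift_rep (0 : Sm punctured) u)).trans
    (by simp)
  map_add' a b := Sm.ext' fun u => by
    rw [map_add, ev_mkS, ev_mkS, ev_mkS, lift_rep (a + b) u, lift_rep a u, lift_rep b u, map_add,
      map_add]
  map_mul' a b := Sm.ext' fun u => by
    rw [map_mul, ev_mkS, ev_mkS, ev_mkS, lift_rep (a * b) u, lift_rep a u, lift_rep b u, map_mul,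
      map_mul]

lemma ev_conjS (u : punctured) (b : Sm punctured) : ev u (conjS b) = starRingEnd ℂ (ev u b) := by
  rw [← lift_rep b u]; rfl

lemma conjS_quatD (a : Fin 3) (b : Sm punctured) : conjS (quatD a b) = quatD a (conjS b) :=
  Sm.ext' fun u => by
    have hl : Lift (fun x => starRingEnd ℂ (rep b x)) (conjS b) := fun _ => rfl
    rw [ev_conjS, ev_quatD, ev_quatD, ← fderiv_apply_eq_dirD (lift_rep b),
      ← fderiv_apply_eq_dirD hl]
    have h2 := ((lift_rep b).differentiableAt u).hasFDerivAt
    have h3 : HasFDerivAt (fun x => starRingEnd ℂ (rep b x)) _ (u : Fin 4 → ℝ) :=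
      (Complex.conjCLE.toContinuousLinearMap.hasFDerivAt).comp (u : Fin 4 → ℝ) h2
    rw [h3.fderiv]
    rfl

lemma homog_homog (b : Sm punctured) : homog (homog b) = homog b := Sm.ext' fun u => by
  rw [ev_homog u, ev_homog_of_unit (sum_sq_radialProj u.2), ev_homog]

/-- Positive definiteness of the hermitian form given by the integral. -/
lemma eq_zero_of_integ {ι : Type} [Fintype ι] {b : ι → Sm punctured} (hb : ∀ i, homog (b i) = b i)
    (h : integ (∑ i, conjS (b i) * b i) = 0) (i : ι) : b i = 0 := by
  have hcut : ∀ x, cutFun (∑ i, conjS (b i) * b i) x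
      = ((cutoff x * ∑ i, Complex.normSq (rep (b i) x) : ℝ) : ℂ) := fun x => by
    by_cases hx : x ∈ punctured
    · rw [cutFun_apply _ hx]
      simp only [map_sum, map_mul, ev_conjS, Complex.normSq_eq_conj_mul_self, Complex.ofReal_mul,
        Complex.ofReal_sum, lift_rep (b _) ⟨x, hx⟩]
    · rw [cutFun_of_not_mem _ hx]
      have h0 : x = 0 := by
        by_contra h
        exact hx h
      have : cutoff x = 0 := cutoff_eq_zero (by simp [h0]; norm_num)
      simp [this]
  set f : (Fin 4 → ℝ) → ℝ := fun x => cutoff x * ∑ i, Complex.normSq (rep (b i) x) with hf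
  have hfr : f = fun x => (cutFun (∑ i, conjS (b i) * b i) x).re := by
    funext x; rw [hcut, Complex.ofReal_re]
  have hfc : Continuous f := by
    rw [hfr]
    exact Complex.continuous_re.comp (contDiff_cutFun _).continuous
  have hfs : HasCompactSupport f := hasCompactSupport_cutoff.mul_right
  have hfn : 0 ≤ f := fun x =>
    mul_nonneg (cutoff_nonneg x) (Finset.sum_nonneg fun _ _ => Complex.normSq_nonneg _)
  have hI : ∫ x, f x = 0 := by
    have h' : ∫ x, cutFun (∑ i, conjS (b i) * b i) x = 0 := h
    simp only [hcut] at h'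
    have h2 : ∫ x, ((f x : ℝ) : ℂ) = 0 := h'
    rw [integral_complex_ofReal] at h2
    exact Complex.ofReal_eq_zero.1 h2
  -- A continuous nonnegative function of compact support with zero integral vanishes identically.
  have hf0 : ∀ x, f x = 0 := fun x => by
    by_contra hx
    exact (hfc.integral_pos_of_hasCompactSupport_nonneg_nonzero (μ := MeasureTheory.volume)
      hfs hfn hx).ne' hI
  refine Sm.ext' fun u => ?_
  -- The cut-off is nonzero only near the unit sphere, but by homogeneity it is enough to evaluate
  -- at the radial projection.
  rw [← hb i, ev_homog, map_zero, ← lift_rep (b i) ⟨radialProj u, radialProj_ne u.2⟩]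
  have h1 := (mul_eq_zero.1 (hf0 (radialProj u))).resolve_left
    (cutoff_of_unit (sum_sq_radialProj u.2))
  rw [Finset.sum_eq_zero_iff_of_nonneg fun _ _ => Complex.normSq_nonneg _] at h1
  exact Complex.normSq_eq_zero.1 (h1 i (Finset.mem_univ i))

/-! ### Uniqueness of the decomposition -/

lemma integ_mul_quatD (a : Fin 3) (f g : Sm punctured) :
    integ (f * quatD a g) = -integ (quatD a f * g) := by
  have := integ_quatD a (f * g)
  rw [Derivation.leibniz, map_add, smul_eq_mul, smul_eq_mul, mul_comm g] at this
  exact eq_neg_of_add_eq_zero_left this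

/-- A harmonic function on the sphere is locally constant. -/
lemma quatD_eq_zero {f : Sm punctured} (hf : homog f = f) (h : ∑ a, quatD a (quatD a f) = 0)
    (a : Fin 3) : quatD a f = 0 := by
  refine eq_zero_of_integ (b := fun a => quatD a f) (fun a => by rw [homog_quatD, hf]) ?_ a
  -- Green's identity: the square norm of the gradient is minus the pairing of `f` with its
  -- Laplacian.
  have : ∀ a, integ (conjS (quatD a f) * quatD a f)
      = - integ (conjS f * quatD a (quatD a f)) := fun a => by
    rw [integ_mul_quatD a (conjS f), conjS_quatD, neg_neg]
  rw [map_sum]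
  simp only [this]
  rw [Finset.sum_neg_distrib, ← map_sum, ← Finset.mul_sum, h, mul_zero, map_zero, neg_zero]

section Frame

variable {R : Type} [CommRing R] [Algebra ℂ R] {e : Fin 3 → Derivation ℂ R R}

/-- On the unit sphere the divergence of `symGrad w` is half of `(△ + 2) w` when `div w = 0`, and
this is divergence free again. The proof eliminates `e_2 w_2` by transversality. -/
lemma sum_sum_symGradF (h : FrameComm e) {w : Fin 3 → R} (hw : div1F e w = 0) :
    ∑ a, ∑ b, e b (e a (symGradF e w a b)) = 0 := by
  have h0 : e 2 (w 2) = - e 0 (w 0) - e 1 (w 1) := by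
    rw [div1F_eq] at hw
    linear_combination hw
  simp [Fin.sum_univ_three, symGradF_eq, h.c10, h.c20, h.c21, h0]
  module

lemma traceF_LopF (f : R) : traceF (LopF e f) = 0 := by
  simp only [traceF, LopF, lapF, deltaF, Fin.sum_univ_three, if_true]
  module

lemma LopF_symm (h : FrameComm e) (f : R) (a b : Fin 3) : LopF e f a b = LopF e f b a := by
  rw [LopF, LopF, hessF_symm h, deltaF_symm]

lemma traceF_symGradF (v : Fin 3 → R) : traceF (symGradF e v) = div1F e v := by
  simp [traceF, symGradF_eq, div1F_eq, Fin.sum_univ_three]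
  module

end Frame

/-- The adjoint of `L` on symmetric traceless tensors is the double divergence: tracelessness
removes the Laplacian term, symmetry removes the connection term, and two integrations by parts do
the rest. -/
lemma integ_LopF_mul {f : Sm punctured} {x : Fin 3 → Fin 3 → Sm punctured}
    (hx : ∀ a b, x a b = x b a) (htr : traceF x = 0) :
    integ (∑ a, ∑ b, conjS (LopF quatD f a b) * x a b)
      = integ (conjS f * ∑ a, ∑ b, quatD b (quatD a (x a b))) := by
  have h1 : ∑ a, ∑ b, conjS (LopF quatD f a b) * x a b
      = ∑ a, ∑ b, quatD a (quatD b (conjS f)) * x a b := by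
    have h10 := hx 1 0; have h20 := hx 2 0; have h21 := hx 2 1
    have h22 : x 2 2 = - x 0 0 - x 1 1 := by
      rw [traceF, Fin.sum_univ_three] at htr
      linear_combination htr
    simp only [LopF, hessF, cov1F_eq, gradF, Fin.sum_univ_three, deltaF, map_sub, conjS_quatD,
      h10, h20, h21, h22]
    simp [conjS_quatD]
    ring
  rw [h1, Finset.mul_sum]
  simp only [Finset.mul_sum, map_sum]
  refine Finset.sum_congr rfl fun a _ => Finset.sum_congr rfl fun b _ => ?_
  rw [integ_mul_quatD b, integ_mul_quatD a, neg_neg]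

/-- The pieces of a decomposition of zero. -/
lemma pieces_eq_zero {t : Fin 3 → Fin 3 → Sm punctured} {w : Fin 3 → Sm punctured}
    {l f : Sm punctured} (ht : ∀ a b, homog (t a b) = t a b) (hf : homog f = f) (hsymm : ∀ a b, t a b = t b a) (htr : traceF t = 0)
    (hdiv : ∀ b, div2F quatD t b = 0) (hdw : div1F quatD w = 0)
    (h : ∀ a b, t a b + (2 : ℂ) • symGradF quatD w a b + deltaF l a b + LopF quatD f a b = 0) :
    l = 0 ∧ (∀ a b, LopF quatD f a b = 0) ∧ (∀ a b, symGradF quatD w a b = 0) ∧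
      ∀ a b, t a b = 0 := by
  -- In the trace only `3 l` survives: `t` and `L f` are traceless, and `symGrad w` has trace `div w
  -- = 0`.
  have hl : l = 0 := by
    have h3 : traceF t + (2 : ℂ) • traceF (symGradF quatD w) + (3 : ℂ) • l
        + traceF (LopF quatD f) = 0 := by
      have h0 := h 0 0; have h1 := h 1 1; have h2 := h 2 2
      simp only [deltaF, if_true] at h0 h1 h2
      have e3 : (3 : ℂ) • l = l + l + l := by module
      simp only [traceF, Fin.sum_univ_three, smul_add, e3]
      linear_combination h0 + h1 + h2
    rw [htr, traceF_symGradF, hdw, traceF_LopF] at h3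
    simpa using h3
  subst hl
  have h' : ∀ a b, LopF quatD f a b = -(t a b + (2 : ℂ) • symGradF quatD w a b) := fun a b => by
    have := h a b
    simp only [deltaF, ite_self, add_zero] at this
    exact eq_neg_of_add_eq_zero_right this
  -- `L f` is paired with itself. Its double divergence vanishes because it equals `-(t + 2 symGrad
  -- w)`, whose two terms both have zero double divergence.
  have hN : ∀ a b, LopF quatD f a b = 0 := by
    have := eq_zero_of_integ (ι := Fin 3 × Fin 3) (b := fun i => LopF quatD f i.1 i.2)
      (fun i => by rw [map_LopF homog_quatD, hf]) ?_
    · exact fun a b => this (a, b)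
    rw [Fintype.sum_prod_type,
      integ_LopF_mul (LopF_symm quatD_frameComm f) (traceF_LopF f)]
    have h2 : ∑ a, ∑ b, quatD b (quatD a (LopF quatD f a b)) = 0 := by
      have h3 : ∑ a, ∑ b, quatD b (quatD a (t a b)) = 0 := by
        rw [Finset.sum_comm]
        refine Finset.sum_eq_zero fun b _ => ?_
        have := hdiv b
        rw [div2F_eq hsymm] at this
        rw [← map_sum, Fin.sum_univ_three, this, map_zero]
      simp only [h', map_neg, map_add, Derivation.map_smul, Finset.sum_neg_distrib,
        Finset.sum_add_distrib, ← Finset.smul_sum, h3, sum_sum_symGradF quatD_frameComm hdw,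
        smul_zero, add_zero, neg_zero]
    rw [h2, mul_zero, map_zero]
  have hS : ∀ a b, t a b = -(quatD a (w b) + quatD b (w a)) := fun a b => by
    have h1 := h' a b
    rw [hN, symGradF_eq, smul_smul] at h1
    norm_num at h1
    linear_combination h1
  -- Now `t = -2 symGrad w`, and a transverse `t` is orthogonal to every symmetrized gradient, in
  -- particular to itself.
  have ht0 : ∀ a b, t a b = 0 := by
    have := eq_zero_of_integ (ι := Fin 3 × Fin 3) (b := fun i => t i.1 i.2)
      (fun i => ht i.1 i.2) ?_
    · exact fun a b => this (a, b)
    rw [Fintype.sum_prod_type]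
    have h1 : ∀ a b, integ (quatD a (conjS (w b)) * t a b)
        = - integ (conjS (w b) * quatD a (t a b)) := fun a b => by
      rw [integ_mul_quatD, neg_neg]
    have h2 : ∑ b, ∑ a, integ (quatD a (conjS (w b)) * t a b) = 0 := by
      refine Finset.sum_eq_zero fun b _ => ?_
      have := hdiv b
      rw [div2F_eq hsymm] at this
      simp only [h1, Finset.sum_neg_distrib]
      rw [← map_sum, ← Finset.mul_sum, Fin.sum_univ_three, this, mul_zero, map_zero, neg_zero]
    have h3 : ∀ a b, integ (conjS (t a b) * t a b) = -(integ (quatD a (conjS (w b)) * t a b)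
        + integ (quatD b (conjS (w a)) * t b a)) := fun a b => by
      rw [← map_add, ← map_neg, hsymm b a]
      congr 1
      conv_lhs => rw [show conjS (t a b) = _ from congrArg conjS (hS a b)]
      rw [map_neg, map_add, conjS_quatD, conjS_quatD]
      ring
    simp only [map_sum, h3, Finset.sum_neg_distrib, Finset.sum_add_distrib]
    rw [h2, Finset.sum_comm, h2, add_zero, neg_zero]
  refine ⟨rfl, hN, fun a b => ?_, ht0⟩
  have := h' a b
  rw [hN, ht0, zero_add, zero_eq_neg] at this
  simpa using this

lemma restr_homog (c : S3Chart) (b : Sm punctured) : c.restr (homog b) = c.restr b :=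
  Sm.ext' fun u => by rw [S3Chart.ev_restr, S3Chart.ev_restr, ev_homog_of_unit (c.unit u u.2)]

/-- This passes identities known in every chart to the global algebra, where integration is
available. -/
lemma eq_of_restr {b b' : Sm punctured} (hb : homog b = b) (hb' : homog b' = b')
    (h : ∀ c : S3Chart, c.restr b = c.restr b') : b = b' := by
  rw [← sub_eq_zero, ← hb, ← hb', ← map_sub]
  exact homog_eq_zero fun c => by rw [map_sub, h c, sub_self]

section Frame

variable {R : Type} [CommRing R] [Algebra ℂ R] {e : Fin 3 → Derivation ℂ R R}

lemma symGradF_add (v w : Fin 3 → R) (a b : Fin 3) :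
    symGradF e (fun a => v a + w a) a b = symGradF e v a b + symGradF e w a b := by
  simp only [symGradF, cov1F_add]; module

lemma div1F_add (v w : Fin 3 → R) : div1F e (fun a => v a + w a) = div1F e v + div1F e w := by
  simp only [div1F, cov1F_add, Finset.sum_add_distrib]

lemma div1F_smul (r : ℂ) (v : Fin 3 → R) : div1F e (fun a => r • v a) = r • div1F e v := by
  simp only [div1F, cov1F_smul, Finset.smul_sum]

lemma div2F_add (s t : Fin 3 → Fin 3 → R) (b : Fin 3) :
    div2F e (fun a b => s a b + t a b) b = div2F e s b + div2F e t b := by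
  simp only [div2F, cov2F_add, Finset.sum_add_distrib]

lemma div2F_smul (r : ℂ) (t : Fin 3 → Fin 3 → R) (b : Fin 3) :
    div2F e (fun a b => r • t a b) b = r • div2F e t b := by
  simp only [div2F, cov2F_smul, Finset.smul_sum]

lemma traceF_add (s t : Fin 3 → Fin 3 → R) :
    traceF (fun a b => s a b + t a b) = traceF s + traceF t := by
  simp only [traceF, Finset.sum_add_distrib]

lemma traceF_smul (r : ℂ) (t : Fin 3 → Fin 3 → R) :
    traceF (fun a b => r • t a b) = r • traceF t := by
  simp only [traceF, Finset.smul_sum]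

end Frame

/-- Uniqueness of the pieces of the image, in the global frame. -/
lemma sphere_pieces_unique {t t' : Fin 3 → Fin 3 → Sm punctured} {w w' : Fin 3 → Sm punctured}
    {l' f' : Sm punctured} (ht : ∀ a b, homog (t a b) = t a b)
    (ht' : ∀ a b, homog (t' a b) = t' a b) (hf' : homog f' = f') (ts : ∀ a b, t a b = t b a)
    (dt : ∀ b, div2F quatD t b = 0) (ts' : ∀ a b, t' a b = t' b a)
    (dt' : ∀ b, div2F quatD t' b = 0) (tt' : traceF t' = 0) (dw' : div1F quatD w' = 0)
    (h : ∀ a b, t' a b + (2 : ℂ) • symGradF quatD w' a b + deltaF l' a b + LopF quatD f' a b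
      = symCurlF quatD t a b + (2 : ℂ) • symGradF quatD (curlF quatD w) a b) :
    l' = 0 ∧ (∀ a b, LopF quatD f' a b = 0) ∧
      (∀ a b, symGradF quatD w' a b = symGradF quatD (curlF quatD w) a b) ∧
      ∀ a b, t' a b = symCurlF quatD t a b := by
  have fc := quatD_frameComm
  -- Applied to the difference of the two decompositions. No homogeneity of `w` is required.
  obtain ⟨l0, f0, w0, t0⟩ := pieces_eq_zero
    (t := fun a b => t' a b + (-1 : ℂ) • symCurlF quatD t a b)
    (w := fun a => w' a + (-1 : ℂ) • curlF quatD w a) (l := l') (f := f')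
    (fun a b => by
      rw [map_add, map_smul, map_symCurlF homog_quatD]; simp only [ht, ht'])
    hf' (fun a b => by rw [ts', symCurlF_symm])
    (by rw [traceF_add, traceF_smul, traceF_symCurlF ts, tt']; simp)
    (fun b => by
      have h0 : div2F quatD t = fun _ => 0 := funext dt
      rw [div2F_add, div2F_smul, div2F_symCurlF fc ts, dt', h0]
      simp [curlF, cov1F])
    (by rw [div1F_add, div1F_smul, div1F_curlF fc, dw']; simp)
    (fun a b => by
      rw [symGradF_add, symGradF_smul]
      have := h a b
      rw [← sub_eq_zero] at this
      rw [← this]; module)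
  refine ⟨l0, f0, fun a b => ?_, fun a b => ?_⟩
  · have h1 := w0 a b
    rw [symGradF_add, symGradF_smul] at h1
    rw [← sub_eq_zero, ← h1]; module
  · have h1 := t0 a b
    rw [← sub_eq_zero, ← h1]; module

/-! ### Global frame components and uniqueness over the whole sphere -/

namespace Pieces

open S3Chart

variable {M : ℝ} {p : Pieces (Fin 4)}

lemma lift_pull {f : (Fin 4 → ℝ) → ℂ} {s : Sm punctured} (h : Lift f s) (c : S3Chart) :
    Lift (fun z => f (c.emb z)) (c.restr (homog s)) := fun u => by
  rw [restr_homog, ev_restr]; exact h ⟨c.emb u, c.emb_mem u u.2⟩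

/-- A pulled-back covector is determined by its contractions with the tangent fields `quatJ a`; its
radial component and its values off the sphere are irrelevant. The contraction can therefore be made
homogeneous of degree zero. -/
lemma rep1_pull {f : (Fin 4 → ℝ) → Fin 4 → ℂ} {s : Fin 4 → Sm punctured}
    (h : ∀ A, Lift (fun x => f x A) (s A)) (c : S3Chart) :
    c.Rep1 (fun z i => ∑ A, pd i c.emb z A • f (c.emb z) A)
      (fun a => c.restr (homog (∑ A, quatS a A * s A))) := fun i u => by
  have hs : ∀ A, f (c.emb u) A = ev ⟨c.emb u, c.emb_mem u u.2⟩ (s A) := fun A =>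
    h A ⟨c.emb u, c.emb_mem u u.2⟩
  simp only [pd_emb_eq u.2, restr_homog, map_sum, map_mul, ev_restr, hs, ev_quatS, ev_th,
    Complex.real_smul, Complex.ofReal_sum, Complex.ofReal_mul, Finset.sum_mul, Finset.mul_sum]
  rw [Finset.sum_comm]
  exact Finset.sum_congr rfl fun _ _ => Finset.sum_congr rfl fun _ _ => by ring

lemma rep2_pull {f : (Fin 4 → ℝ) → Fin 4 → Fin 4 → ℂ} {s : Fin 4 → Fin 4 → Sm punctured}
    (h : ∀ A B, Lift (fun x => f x A B) (s A B)) (c : S3Chart) :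
    c.Rep2 (fun z i j => ∑ A, ∑ B, (pd i c.emb z A * pd j c.emb z B) • f (c.emb z) A B)
      (fun a b => c.restr (homog (∑ A, quatS a A * ∑ B, quatS b B * s A B))) := fun i j u => by
  have h1 := fun A => rep1_pull (f := fun x B => f x A B) (h A) c j u
  have h2 := rep1_pull (f := fun x A => ∑ B, pd j c.emb u B • f x A B)
    (s := fun A => ∑ B, (pd j c.emb u B : ℂ) • s A B)
    (fun A v => by
      rw [map_sum]
      exact Finset.sum_congr rfl fun B _ => by
        rw [map_smul, smul_eq_mul, Complex.real_smul, ← h A B v]) c i u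
  have h3 : ∀ z, ∑ A, ∑ B, (pd i c.emb z A * pd j c.emb z B) • f (c.emb z) A B
      = ∑ A, pd i c.emb z A • ∑ B, pd j c.emb z B • f (c.emb z) A B := fun z => by
    simp only [Finset.smul_sum, mul_smul]
  refine (h3 u).trans (h2.trans ?_)
  simp only [restr_homog, map_sum, map_mul, ev_restr, ev_quatS, ev_th, map_smul, smul_eq_mul] at h1 ⊢
  refine Finset.sum_congr rfl fun a _ => ?_
  congr 1
  have h4 : ∀ A, ∑ B, (pd j c.emb u B : ℂ) * ev ⟨c.emb u, c.emb_mem u u.2⟩ (s A B)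
      = ∑ b, (c.cofr u b j : ℂ) * ∑ B, (quatJ b (c.emb u) B : ℂ)
        * ev ⟨c.emb u, c.emb_mem u u.2⟩ (s A B) := fun A => by
    rw [← h1 A]
    exact Finset.sum_congr rfl fun B _ => by
      rw [Complex.real_smul]
      exact congrArg _ (h A B ⟨c.emb u, c.emb_mem u u.2⟩).symm
  simp only [h4, Finset.mul_sum]
  rw [Finset.sum_comm]
  refine Finset.sum_congr rfl fun b _ => ?_
  refine Finset.sum_congr rfl fun A _ => ?_
  refine Finset.sum_congr rfl fun B _ => ?_
  ring

/-- Global frame components of the pieces at a fixed point of the orbit space. -/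
lemma GlobAdmissible.exists_rep (hp : p.GlobAdmissible M) {y : Fin 2 → ℝ} (hy : y ∈ regionY M) :
    ∃ (s : Fin 2 → Sm punctured) (l f : Sm punctured) (v : Fin 2 → Fin 3 → Sm punctured)
      (w : Fin 3 → Sm punctured) (t : Fin 3 → Fin 3 → Sm punctured),
      (∀ c : S3Chart, (∀ a, Lift (fun z => (p.pull c).sa y z a) (c.restr (s a))) ∧
        Lift ((p.pull c).sL y) (c.restr l) ∧ Lift ((p.pull c).sT y) (c.restr f) ∧
        (∀ a, c.Rep1 (fun z => (p.pull c).va y z a) (fun b => c.restr (v a b))) ∧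
        c.Rep1 ((p.pull c).vi y) (fun b => c.restr (w b)) ∧
        c.Rep2 ((p.pull c).tij y) (fun a b => c.restr (t a b))) ∧
      (∀ a, homog (s a) = s a) ∧ homog l = l ∧ homog f = f ∧ (∀ a b, homog (v a b) = v a b) ∧
      (∀ a, homog (w a) = w a) ∧ (∀ a b, homog (t a b) = t a b) ∧
      (∀ a, div1F quatD (v a) = 0) ∧ div1F quatD w = 0 ∧ (∀ a b, t a b = t b a) ∧
      (∀ a, div2F quatD t a = 0) ∧ traceF t = 0 := by
  obtain ⟨⟨-, hsa, hsL, hsT, hva, hvi, htij⟩, hadm⟩ := hp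
  have slice : ∀ {F : (Fin 2 → ℝ) → (Fin 4 → ℝ) → ℂ}, ContDiffOn ℝ ∞
      (fun q : (Fin 2 → ℝ) × (Fin 4 → ℝ) => F q.1 q.2) (regionY M ×ˢ {n | n ≠ 0}) →
      ∃ s : Sm punctured, Lift (F y) s := fun h =>
    exists_lift (U := punctured) (h.comp (f := fun z => (y, z))
      (contDiff_const.prodMk contDiff_id).contDiffOn fun _ hz => ⟨hy, hz⟩)
  choose s hs using fun a => slice (F := fun y z => p.sa y z a) (contDiffOn_pi.1 hsa a)
  obtain ⟨l, hl⟩ := slice hsL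
  obtain ⟨f, hf⟩ := slice hsT
  choose v hv using fun a A => slice (F := fun y z => p.va y z a A)
    (contDiffOn_pi.1 (contDiffOn_pi.1 hva a) A)
  choose w hw using fun A => slice (F := fun y z => p.vi y z A) (contDiffOn_pi.1 hvi A)
  choose t ht using fun A B => slice (F := fun y z => p.tij y z A B)
    (contDiffOn_pi.1 (contDiffOn_pi.1 htij A) B)
  have rv := fun (c : S3Chart) a => rep1_pull (f := fun x => p.va y x a) (hv a) c
  have rw' := fun (c : S3Chart) => rep1_pull (f := p.vi y) hw c
  have rt := fun (c : S3Chart) => rep2_pull (f := p.tij y) ht c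
  have hq := fun (c : S3Chart) a b => restr_quatD (c := c) a b
  refine ⟨fun a => homog (s a), homog l, homog f, _, _, _,
    fun c => ⟨fun a => lift_pull (hs a) c, lift_pull hl c, lift_pull hf c, rv c, rw' c, rt c⟩,
    fun a => homog_homog _, homog_homog _, homog_homog _, fun _ _ => homog_homog _,
    fun _ => homog_homog _, fun _ _ => homog_homog _, fun a => ?_, ?_, fun a b => ?_, fun a => ?_, ?_⟩
  · refine eq_of_restr ?_ (map_zero _) fun c => ?_
    · rw [map_div1F homog_quatD]; simp only [homog_homog]
    · rw [map_div1F (hq c), map_zero]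
      obtain ⟨s', l', f', v', w', t', hs', hl', hf', hv', hw', ht', dv, dw, ts, dt, tt⟩ :=
        (hadm c).exists_rep hy
      rw [← dv a]
      exact congrArg _ (rep1_inj (rv c a) (hv' a))
  · refine eq_of_restr ?_ (map_zero _) fun c => ?_
    · rw [map_div1F homog_quatD]; simp only [homog_homog]
    · rw [map_div1F (hq c), map_zero]
      obtain ⟨s', l', f', v', w', t', hs', hl', hf', hv', hw', ht', dv, dw, ts, dt, tt⟩ :=
        (hadm c).exists_rep hy
      rw [← dw]
      exact congrArg _ (rep1_inj (rw' c) hw')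
  · refine eq_of_restr (homog_homog _) (homog_homog _) fun c => ?_
    obtain ⟨s', l', f', v', w', t', hs', hl', hf', hv', hw', ht', dv, dw, ts, dt, tt⟩ :=
      (hadm c).exists_rep hy
    have h := rep2_inj (rt c) ht'
    exact (congrFun₂ h a b).trans ((ts a b).trans (congrFun₂ h b a).symm)
  · refine eq_of_restr ?_ (map_zero _) fun c => ?_
    · rw [map_div2F homog_quatD]; simp only [homog_homog]
    · rw [map_div2F (hq c), map_zero]
      obtain ⟨s', l', f', v', w', t', hs', hl', hf', hv', hw', ht', dv, dw, ts, dt, tt⟩ :=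
        (hadm c).exists_rep hy
      rw [← dt a]
      exact congrArg (fun t => div2F c.e t a) (rep2_inj (rt c) ht')
  · refine eq_of_restr ?_ (map_zero _) fun c => ?_
    · rw [map_traceF]; simp only [homog_homog]
    · rw [map_traceF, map_zero]
      obtain ⟨s', l', f', v', w', t', hs', hl', hf', hv', hw', ht', dv, dw, ts, dt, tt⟩ :=
        (hadm c).exists_rep hy
      rw [← tt]
      exact congrArg _ (rep2_inj (rt c) ht')

/-- Every decomposition of the image over the whole sphere is given by the image of the pieces. -/
theorem unique_of_glob {q : Pieces (Fin 4)} (hp : p.GlobAdmissible M) (hq : q.GlobAdmissible M)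
    (h : ∀ c : S3Chart, ∀ x ∈ region M c, ∀ μ ν,
      (q.pull c).toTensor c x μ ν = Zop M c ((p.pull c).toTensor c) x μ ν)
    (c : S3Chart) {y : Fin 2 → ℝ} (hy : y ∈ regionY M) {z : Fin 3 → ℝ} (hz : z ∈ c.dom) :
    (∀ a b, (q.pull c).ab y z a b = 0) ∧
    (∀ a i, grad (fun z => (q.pull c).sa y z a) z i = 0) ∧
    (q.pull c).sL y z = 0 ∧
    (∀ i j, Lop c.metric ((q.pull c).sT y) z i j = 0) ∧
    (∀ a i, (q.pull c).va y z a i = curl c.metric (fun z => (p.pull c).va y z a) z i) ∧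
    (∀ i j, symGrad c.metric ((q.pull c).vi y) z i j =
      symGrad c.metric (curl c.metric ((p.pull c).vi y)) z i j) ∧
    (∀ i j, (q.pull c).tij y z i j = symCurl c.metric ((p.pull c).tij y) z i j) := by
  have hx : ∀ (c : S3Chart) {z}, z ∈ c.dom → Sum.elim y z ∈ region M c := fun c z hz => ⟨hy, hz⟩
  have key : ∀ (c : S3Chart) {z}, z ∈ c.dom → ∀ μ ν, (q.pull c).toTensor c (Sum.elim y z) μ ν
      = ((p.pull c).image c).toTensor c (Sum.elim y z) μ ν := fun c z hz μ ν => by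
    rw [h c _ (hx c hz), Zop_toTensor (hp.2 c) (hx c hz)]
  obtain ⟨s, l, f, v, w, t, hr, hs, hl, hf, hv, hw, ht, dv, dw, ts, dt, tt⟩ := hp.exists_rep hy
  obtain ⟨s', l', f', v', w', t', hr', hs', hl', hf', hv', hw', ht', dv', dw', ts', dt', tt'⟩ :=
    hq.exists_rep hy
  have fc := quatD_frameComm
  have hD := fun (c : S3Chart) a b => restr_quatD (c := c) a b
  -- The mixed components: comparison in each chart gives a global equation between the new `h_{ai}`
  -- and the curl.
  have hai : ∀ a b, gradF quatD (s' a) b + v' a b = curlF quatD (v a) b := fun a b => by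
    refine eq_of_restr ?_ ?_ fun c => ?_
    · rw [map_add, map_gradF homog_quatD, hs', hv']
    · rw [map_curlF homog_quatD]; simp only [hv]
    · rw [map_add, map_gradF (hD c), map_curlF (hD c)]
      refine congrFun (rep1_inj (w := fun z i => grad (fun z => (q.pull c).sa y z a) z i
        + (q.pull c).va y z a i) (((hr' c).1 a).grad.add ((hr' c).2.2.2.1 a))
        (((hr c).2.2.2.1 a).curl.congr (fun z hz i => ?_) fun _ => rfl)) b
      refine (key c hz (Sum.inl a) (Sum.inr i)).trans ?_
      simp [toTensor, blocks, Pieces.image, ofVT, grad, pd]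
      rfl
  have hij : ∀ a b, t' a b + (2 : ℂ) • symGradF quatD w' a b + deltaF l' a b
      + LopF quatD f' a b = symCurlF quatD t a b + (2 : ℂ) • symGradF quatD (curlF quatD w) a b :=
    fun a b => by
    have hcw : (fun a => homog (curlF quatD w a)) = curlF quatD w := funext fun a => by
      rw [map_curlF homog_quatD]; simp only [hw]
    refine eq_of_restr ?_ ?_ fun c => ?_
    · simp only [map_add, map_smul, map_symGradF homog_quatD, map_LopF homog_quatD, map_deltaF,
        ht', hw', hl', hf']
    · simp only [map_add, map_smul, map_symGradF homog_quatD, map_symCurlF homog_quatD, ht, hcw]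
    · have hcw' : (fun a => c.restr (curlF quatD w a)) = curlF c.e (fun a => c.restr (w a)) :=
        funext fun a => map_curlF (hD c) w a
      simp only [map_add, map_smul, map_symGradF (hD c), map_LopF (hD c), map_deltaF,
        map_symCurlF (hD c), hcw']
      obtain ⟨-, hl1, hf1, -, hw1, ht1⟩ := hr' c
      obtain ⟨-, -, -, -, hw2, ht2⟩ := hr c
      refine congrFun₂ (rep2_inj (rep_toTensor hl1 hf1 hw1 ht1)
        ((ht2.symCurl.add (hw2.curl.symGrad.const_mul 2)).congr (fun z hz i j => ?_)
          fun _ _ => rfl)) a b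
      refine (key c hz (Sum.inr i) (Sum.inr j)).trans ?_
      simp [toTensor, blocks, Pieces.image, ofVT, grad, pd, Lop, hess, lap, cov1]
      rfl
  -- Taking the divergence of `hai` leaves the Laplacian of the scalar piece, so that piece is
  -- harmonic and its gradient vanishes.
  have hs0 : ∀ a b, quatD b (s' a) = 0 := fun a => quatD_eq_zero (hs' a) (by
    have h0 := div1F_curlF fc (v a)
    rw [← funext (hai a), div1F_add, dv', add_zero, div1F_eq] at h0
    rw [Fin.sum_univ_three]; exact h0)
  have hv0 : ∀ a b, v' a b = curlF quatD (v a) b := fun a b => by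
    rw [← hai a b, gradF, hs0, zero_add]
  obtain ⟨l0, f0, w0, t0⟩ := sphere_pieces_unique ht ht' hf' ts dt ts' dt' tt' dw' hij
  have hzero : ∀ {c : S3Chart} {b : Sm punctured}, b = 0 → c.restr b = 0 := fun h => by
    rw [h, map_zero]
  obtain ⟨hs1, hl1, hf1, hv1, hw1, ht1⟩ := hr' c
  obtain ⟨-, -, -, hv2, hw2, ht2⟩ := hr c
  refine ⟨fun a b => key c hz (Sum.inl a) (Sum.inl b), fun a i => ?_, ?_, fun i j => ?_,
    fun a i => ?_, fun i j => ?_, fun i j => ?_⟩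
  · rw [(hs1 a).grad.ev_eq ⟨z, hz⟩]
    have : ∀ b, gradF c.e (c.restr (s' a)) b = 0 := fun b => by
      rw [← map_gradF (hD c)]; exact hzero (hs0 a b)
    simp [this]
  · rw [hl1 ⟨z, hz⟩, hzero l0, map_zero]
  · rw [hf1.Lop.ev_eq ⟨z, hz⟩]
    have : ∀ a b, LopF c.e (c.restr f') a b = 0 := fun a b => by
      rw [← map_LopF (hD c)]; exact hzero (f0 a b)
    simp [this]
  · rw [(hv1 a).ev_eq ⟨z, hz⟩, (hv2 a).curl.ev_eq ⟨z, hz⟩]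
    simp only [hv0, map_curlF (hD c)]
  · rw [hw1.symGrad.ev_eq ⟨z, hz⟩, hw2.curl.symGrad.ev_eq ⟨z, hz⟩]
    have : ∀ a b, symGradF c.e (fun b => c.restr (w' b)) a b
        = symGradF c.e (curlF c.e fun b => c.restr (w b)) a b := fun a b => by
      have h3 := congrArg c.restr (w0 a b)
      rw [map_symGradF (hD c), map_symGradF (hD c)] at h3
      simpa only [map_curlF (hD c)] using h3
    simp only [this]
  · rw [ht1.ev_eq ⟨z, hz⟩, ht2.symCurl.ev_eq ⟨z, hz⟩]
    simp only [t0, map_symCurlF (hD c)]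

end Pieces

/-! ## Hyperspherical coordinates -/

section Hyper

lemma sin_pos0 {z : Fin 3 → ℝ} (hz : z ∈ hyperDom) : 0 < Real.sin (z 0) :=
  Real.sin_pos_of_mem_Ioo hz.1

lemma sin_pos1 {z : Fin 3 → ℝ} (hz : z ∈ hyperDom) : 0 < Real.sin (z 1) :=
  Real.sin_pos_of_mem_Ioo hz.2

/-- The lengths of the coordinate vectors. -/
def hlen (z : Fin 3 → ℝ) : Fin 3 → ℝ := ![1, Real.sin (z 0), Real.sin (z 0) * Real.sin (z 1)]

lemma hlen_pos {z : Fin 3 → ℝ} (hz : z ∈ hyperDom) (i : Fin 3) : 0 < hlen z i := by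
  have := sin_pos0 hz; have := sin_pos1 hz
  fin_cases i <;> simp [hlen] <;> positivity

lemma metric_hyper (z : Fin 3 → ℝ) : γ z = Matrix.diagonal fun i => hlen z i ^ 2 := by
  have c0 : Real.cos (z 0) ^ 2 = 1 - Real.sin (z 0) ^ 2 := Real.cos_sq' _
  have c1 : Real.cos (z 1) ^ 2 = 1 - Real.sin (z 1) ^ 2 := Real.cos_sq' _
  have c2 : Real.cos (z 2) ^ 2 = 1 - Real.sin (z 2) ^ 2 := Real.cos_sq' _
  ext i j
  change ∑ A, pd i hyperEmb z A * pd j hyperEmb z A = _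
  rw [pd_hyperEmb, pd_hyperEmb]
  fin_cases i <;> fin_cases j <;> simp [Fin.sum_univ_four, hlen] <;> ring_nf <;>
    simp only [c0, c1, c2] <;> ring

lemma metric_inv_hyper {z : Fin 3 → ℝ} (hz : z ∈ hyperDom) :
    (γ z)⁻¹ = Matrix.diagonal fun i => (hlen z i ^ 2)⁻¹ := by
  refine Matrix.inv_eq_right_inv ?_
  rw [metric_hyper, Matrix.diagonal_mul_diagonal, ← Matrix.diagonal_one]
  congr 1
  funext i
  exact mul_inv_cancel₀ (pow_ne_zero 2 (hlen_pos hz i).ne')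

lemma volUp_hyper {z : Fin 3 → ℝ} (hz : z ∈ hyperDom) (i k l : Fin 3) :
    volUp γ z i k l = leviCivita i k l * (hlen z i / (hlen z k * hlen z l)) := by
  have h0 := sin_pos0 hz; have h1 := sin_pos1 hz
  have hdet : Real.sqrt (γ z).det = Real.sin (z 0) ^ 2 * Real.sin (z 1) := by
    rw [metric_hyper, Matrix.det_diagonal, Fin.prod_univ_three]
    simp only [hlen, Matrix.cons_val]
    rw [show (1 : ℝ) ^ 2 * Real.sin (z 0) ^ 2 * (Real.sin (z 0) * Real.sin (z 1)) ^ 2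
      = (Real.sin (z 0) ^ 2 * Real.sin (z 1)) ^ 2 by ring, Real.sqrt_sq (by positivity)]
  simp only [volUp, vol, hdet, metric_inv_hyper hz, Matrix.diagonal_apply, mul_ite, mul_zero,
    Finset.sum_ite_eq', Finset.mem_univ, if_true, ite_mul, zero_mul]
  fin_cases i <;> fin_cases k <;> fin_cases l <;> norm_num [leviCivita, hlen] <;> field_simp

lemma hasFDerivAt_comp_apply {E : Type} [NormedAddCommGroup E] [NormedSpace ℝ E] {f : ℝ → E}
    {f' : E} {z : Fin 3 → ℝ} (j : Fin 3) (h : HasDerivAt f f' (z j)) :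
    HasFDerivAt (fun z : Fin 3 → ℝ => f (z j))
      ((ContinuousLinearMap.toSpanSingleton ℝ f').comp (ContinuousLinearMap.proj j)) z :=
  HasFDerivAt.comp z h.hasFDerivAt (hasFDerivAt_apply' j z)

lemma pd_comp_apply {E : Type} [NormedAddCommGroup E] [NormedSpace ℝ E] {f : ℝ → E} {f' : E}
    {z : Fin 3 → ℝ} (j : Fin 3) (h : HasDerivAt f f' (z j)) (i : Fin 3) :
    pd i (fun z => f (z j)) z = if i = j then f' else 0 := by
  rw [pd, (hasFDerivAt_comp_apply j h).fderiv]
  by_cases hij : i = j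
  · subst hij; simp
  · simp [hij, Ne.symm hij]

/-- The Christoffel symbols in hyperspherical coordinates. -/
def hyperChr (z : Fin 3 → ℝ) : Fin 3 → Fin 3 → Fin 3 → ℝ :=
  let s := Real.sin (z 0); let c := Real.cos (z 0)
  let σ := Real.sin (z 1); let κ := Real.cos (z 1)
  ![![![0, 0, 0], ![0, -s * c, 0], ![0, 0, -s * c * σ ^ 2]],
    ![![0, c / s, 0], ![c / s, 0, 0], ![0, 0, -σ * κ]],
    ![![0, 0, c / s], ![0, 0, κ / σ], ![c / s, κ / σ, 0]]]

lemma pd_hlen_sq (z : Fin 3 → ℝ) (k i : Fin 3) : pd k (fun z => hlen z i ^ 2) z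
    = ![![0, 0, 0], ![2 * Real.sin (z 0) * Real.cos (z 0), 0, 0],
        ![2 * Real.sin (z 0) * Real.cos (z 0) * Real.sin (z 1) ^ 2,
          2 * Real.sin (z 0) ^ 2 * Real.sin (z 1) * Real.cos (z 1), 0]] i k := by
  have h0 : HasDerivAt (fun x => Real.sin x ^ 2) (2 * Real.sin (z 0) * Real.cos (z 0)) (z 0) := by
    simpa using (Real.hasDerivAt_sin (z 0)).fun_pow 2
  have h1 : HasDerivAt (fun x => Real.sin x ^ 2) (2 * Real.sin (z 1) * Real.cos (z 1)) (z 1) := by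
    simpa using (Real.hasDerivAt_sin (z 1)).fun_pow 2
  fin_cases i
  · fin_cases k <;> simp [hlen, pd]
  · simp only [hlen, Fin.mk_one, Matrix.cons_val]
    rw [pd_comp_apply 0 h0]
    fin_cases k <;> simp
  · have h2 := (hasFDerivAt_comp_apply 0 h0).mul (hasFDerivAt_comp_apply 1 h1)
    simp only [hlen, Fin.reduceFinMk, Matrix.cons_val, mul_pow]
    have h3 : HasFDerivAt (fun z : Fin 3 → ℝ => Real.sin (z 0) ^ 2 * Real.sin (z 1) ^ 2) _ z := h2
    rw [pd, h3.fderiv]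
    fin_cases k <;> simp <;> ring

lemma christoffel_hyper {z : Fin 3 → ℝ} (hz : z ∈ hyperDom) (m k i : Fin 3) :
    christoffel γ z m k i = hyperChr z m k i := by
  have h0 := (sin_pos0 hz).ne'; have h1 := (sin_pos1 hz).ne'
  have hp : ∀ k i j, pd k (fun z => γ z i j) z = if i = j then pd k (fun z => hlen z i ^ 2) z else 0 := by
    intro k i j
    simp only [metric_hyper, Matrix.diagonal_apply]
    split_ifs
    · rfl
    · simp [pd]
  simp only [christoffel, metric_inv_hyper hz, hp, pd_hlen_sq, Matrix.diagonal_apply, ite_mul,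
    zero_mul, Finset.sum_ite_eq, Finset.mem_univ, if_true]
  fin_cases m <;> fin_cases k <;> fin_cases i <;> simp [hyperChr, hlen] <;> field_simp

end Hyper

/-! ### The orthonormal frame -/

/-- Smooth functions on the domain of the hyperspherical coordinates. -/
abbrev HypS : Type := Sm hyperChart.U

lemma pdS_of_hasDerivAt {f f' : ℝ → ℂ} {s s' : HypS} (j : Fin 3)
    (hs : Lift (fun z => f (z j)) s) (hs' : Lift (fun z => f' (z j)) s')
    (h : ∀ z ∈ hyperDom, HasDerivAt f (f' (z j)) (z j)) (i : Fin 3) :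
    pdS i s = if i = j then s' else 0 := Sm.ext' fun u => by
  rw [hs.ev_pdS, pd_comp_apply j (h u u.2)]
  split_ifs
  · exact hs' u
  · simp

/-- The sine of a coordinate. -/
def sinS (j : Fin 3) : HypS :=
  mkS (fun z => (Real.sin (z j) : ℂ)) (contDiffOn_ofReal (by fun_prop))

/-- The cosine of a coordinate. -/
def cosS (j : Fin 3) : HypS :=
  mkS (fun z => (Real.cos (z j) : ℂ)) (contDiffOn_ofReal (by fun_prop))

lemma sin_ne {z : Fin 3 → ℝ} (hz : z ∈ hyperDom) (j : Fin 2) : Real.sin (z j.castSucc) ≠ 0 := by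
  fin_cases j
  · exact (sin_pos0 hz).ne'
  · exact (sin_pos1 hz).ne'

/-- The cosecant of one of the first two coordinates. -/
def cscS (j : Fin 2) : HypS :=
  mkS (fun z => ((Real.sin (z j.castSucc))⁻¹ : ℝ)) (contDiffOn_ofReal
    (ContDiffOn.inv (by fun_prop) fun _ hz => sin_ne hz j))

/-- The cotangent of one of the first two coordinates. -/
def cotS (j : Fin 2) : HypS := cosS j.castSucc * cscS j

@[simp] lemma ev_sinS (u : hyperChart.U) (j : Fin 3) : ev u (sinS j) = (Real.sin (u.1 j) : ℂ) := rfl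

@[simp] lemma ev_cosS (u : hyperChart.U) (j : Fin 3) : ev u (cosS j) = (Real.cos (u.1 j) : ℂ) := rfl

@[simp] lemma ev_cscS (u : hyperChart.U) (j : Fin 2) :
    ev u (cscS j) = (((Real.sin (u.1 j.castSucc))⁻¹ : ℝ) : ℂ) := rfl

lemma pdS_sinS (i j : Fin 3) : pdS i (sinS j) = if i = j then cosS j else 0 :=
  pdS_of_hasDerivAt (f := fun x => (Real.sin x : ℂ)) (f' := fun x => (Real.cos x : ℂ)) j
    (lift_mkS _ _) (lift_mkS _ _) (fun z _ => (Real.hasDerivAt_sin (z j)).ofReal_comp) i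

lemma pdS_cosS (i j : Fin 3) : pdS i (cosS j) = if i = j then -sinS j else 0 :=
  pdS_of_hasDerivAt (f := fun x => (Real.cos x : ℂ)) (f' := fun x => ((-Real.sin x : ℝ) : ℂ)) j
    (lift_mkS _ _) (fun u => by simp)
    (fun z _ => (Real.hasDerivAt_cos (z j)).ofReal_comp) i

lemma sinS_mul_cscS (j : Fin 2) : sinS j.castSucc * cscS j = 1 := Sm.ext' fun u => by
  have : (Real.sin (u.1 j.castSucc) : ℂ) ≠ 0 := Complex.ofReal_ne_zero.2 (sin_ne u.2 j)
  simp only [map_mul, ev_sinS, ev_cscS, map_one, Complex.ofReal_inv]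
  exact mul_inv_cancel₀ this

lemma sinS_sq_add_cosS_sq (j : Fin 3) : sinS j ^ 2 + cosS j ^ 2 = 1 := Sm.ext' fun u => by
  have := Real.sin_sq_add_cos_sq (u.1 j)
  simp only [map_add, map_pow, ev_sinS, ev_cosS, map_one]
  exact_mod_cast this

/-- Cosecants and cotangents serve as independent generators below. This relation is what the ring
normal form must be told when it does not close a component by itself. -/
lemma cscS_sq (j : Fin 2) : cscS j ^ 2 = 1 + cotS j ^ 2 := by
  have h1 := sinS_mul_cscS j; have h2 := sinS_sq_add_cosS_sq j.castSucc
  rw [cotS]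
  linear_combination (cscS j) ^ 2 * (-h2) + (sinS j.castSucc * cscS j + 1) * h1

lemma pdS_cscS (i : Fin 3) (j : Fin 2) :
    pdS i (cscS j) = if i = j.castSucc then -(cotS j * cscS j) else 0 := by
  have h1 := sinS_mul_cscS j
  -- The derivative of the cosecant is obtained by differentiating `sin · csc = 1` in the algebra.
  have h2 := congrArg (pdS i) h1
  rw [Derivation.leibniz, Derivation.map_one_eq_zero, pdS_sinS, smul_eq_mul, smul_eq_mul] at h2
  split_ifs at h2 ⊢ with h
  · rw [cotS]
    linear_combination cscS j * h2 - pdS i (cscS j) * h1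
  · linear_combination cscS j * h2 - pdS i (cscS j) * h1

lemma pdS_cotS (i : Fin 3) (j : Fin 2) :
    pdS i (cotS j) = if i = j.castSucc then -(1 + cotS j ^ 2) else 0 := by
  have h1 := sinS_mul_cscS j
  rw [cotS, Derivation.leibniz, pdS_cscS, pdS_cosS]
  split_ifs
  · simp only [smul_eq_mul, cotS]
    linear_combination -h1
  · simp

/-- The lengths of the coordinate vectors as smooth functions. -/
def hS : Fin 3 → HypS := ![1, sinS 0, sinS 0 * sinS 1]

/-- The orthonormal frame of the hyperspherical coordinates, as derivations. -/
def onE : Fin 3 → Derivation ℂ HypS HypS := ![pdS 0, cscS 0 • pdS 1, (cscS 0 * cscS 1) • pdS 2]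

lemma onE_zero (f : HypS) : onE 0 f = pdS 0 f := rfl
lemma onE_one (f : HypS) : onE 1 f = cscS 0 * pdS 1 f := rfl
lemma onE_two (f : HypS) : onE 2 f = cscS 0 * cscS 1 * pdS 2 f := rfl

/-- The connection coefficients of the orthonormal frame. -/
def onOm : Fin 3 → Fin 3 → Fin 3 → HypS :=
  ![![![0, 0, 0], ![0, 0, 0], ![0, 0, 0]],
    ![![0, cotS 0, 0], ![-cotS 0, 0, 0], ![0, 0, 0]],
    ![![0, 0, cotS 0], ![0, 0, cscS 0 * cotS 1], ![-cotS 0, -(cscS 0 * cotS 1), 0]]]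

/-- Covariant derivative of a covector in the orthonormal frame. -/
def cov1O (v : Fin 3 → HypS) (a b : Fin 3) : HypS := onE a (v b) - ∑ d, onOm a b d * v d

/-- Covariant derivative of a 2-tensor in the orthonormal frame. -/
def cov2O (t : Fin 3 → Fin 3 → HypS) (a b d : Fin 3) : HypS :=
  onE a (t b d) - ∑ m, onOm a b m * t m d - ∑ m, onOm a d m * t b m

/-- Curl in the orthonormal frame. -/
def curlO (v : Fin 3 → HypS) (a : Fin 3) : HypS := ∑ b, ∑ d, eps a b d • cov1O v b d

/-- Symmetrized curl in the orthonormal frame. -/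
def symCurlO (t : Fin 3 → Fin 3 → HypS) (a b : Fin 3) : HypS :=
  ∑ k, ∑ l, (eps a k l • cov2O t k b l + eps b k l • cov2O t k a l)

/-- `D_{(a} v_{b)}` in the orthonormal frame. -/
def symGradO (v : Fin 3 → HypS) (a b : Fin 3) : HypS :=
  (1 / 2 : ℂ) • (cov1O v a b + cov1O v b a)

/-- The covector field `w` has the orthonormal components `v`. -/
def RepO1 (w : (Fin 3 → ℝ) → Fin 3 → ℂ) (v : Fin 3 → HypS) : Prop :=
  ∀ i, Lift (fun z => w z i) (hS i * v i)

/-- The tensor field `T` has the orthonormal components `t`. -/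
def RepO2 (T : (Fin 3 → ℝ) → Fin 3 → Fin 3 → ℂ) (t : Fin 3 → Fin 3 → HypS) : Prop :=
  ∀ i j, Lift (fun z => T z i j) (hS i * hS j * t i j)

lemma ev_hS (u : hyperChart.U) (i : Fin 3) : ev u (hS i) = (hlen u i : ℂ) := by
  fin_cases i <;> simp [hS, hlen]

lemma RepO1.ev_eq {w : (Fin 3 → ℝ) → Fin 3 → ℂ} {v : Fin 3 → HypS} (h : RepO1 w v)
    (u : hyperChart.U) (i : Fin 3) : w u i = hlen u i * ev u (v i) := by
  rw [← ev_hS, ← map_mul]; exact h i u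

lemma RepO2.ev_eq {T : (Fin 3 → ℝ) → Fin 3 → Fin 3 → ℂ} {t : Fin 3 → Fin 3 → HypS}
    (h : RepO2 T t) (u : hyperChart.U) (i j : Fin 3) :
    T u i j = hlen u i * hlen u j * ev u (t i j) := by
  rw [← ev_hS, ← ev_hS, ← map_mul, ← map_mul]; exact h i j u

lemma pdS_hS (k i : Fin 3) : pdS k (hS i)
    = ![![0, 0, 0], ![cosS 0, 0, 0], ![cosS 0 * sinS 1, sinS 0 * cosS 1, 0]] i k := by
  fin_cases i <;> fin_cases k <;> simp [hS, pdS_sinS, mul_comm]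

lemma RepO1.cov1 {w : (Fin 3 → ℝ) → Fin 3 → ℂ} {v : Fin 3 → HypS} (h : RepO1 w v) :
    RepO2 (cov1 γ w) (cov1O v) := fun k i u => by
  have h0 : (Real.sin (u.1 0) : ℂ) ≠ 0 := Complex.ofReal_ne_zero.2 (sin_pos0 u.2).ne'
  have h1 : (Real.sin (u.1 1) : ℂ) ≠ 0 := Complex.ofReal_ne_zero.2 (sin_pos1 u.2).ne'
  simp only [SchwKY.cov1, ← (h i).ev_pdS k u, h.ev_eq, christoffel_hyper u.2,
    Derivation.leibniz, pdS_hS, cov1O, Fin.sum_univ_three, map_add, map_mul, map_sub, ev_hS,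
    smul_eq_mul, Complex.real_smul]
  fin_cases k <;> fin_cases i <;>
    simp [hyperChr, hlen, onE_zero, onE_one, onE_two, onOm, cotS, -Complex.ofReal_sin,
      -Complex.ofReal_cos] <;> field_simp <;> ring

lemma RepO2.cov2 {T : (Fin 3 → ℝ) → Fin 3 → Fin 3 → ℂ} {t : Fin 3 → Fin 3 → HypS}
    (h : RepO2 T t) (k i j : Fin 3) :
    Lift (fun z => cov2 γ T z k i j) (hS k * hS i * hS j * cov2O t k i j) := fun u => by
  have h0 : (Real.sin (u.1 0) : ℂ) ≠ 0 := Complex.ofReal_ne_zero.2 (sin_pos0 u.2).ne'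
  have h1 : (Real.sin (u.1 1) : ℂ) ≠ 0 := Complex.ofReal_ne_zero.2 (sin_pos1 u.2).ne'
  simp only [SchwKY.cov2, ← (h i j).ev_pdS k u, h.ev_eq, christoffel_hyper u.2,
    Derivation.leibniz, pdS_hS, cov2O, Fin.sum_univ_three, map_add, map_mul, map_sub, ev_hS,
    smul_eq_mul, Complex.real_smul]
  fin_cases k <;> fin_cases i <;> fin_cases j <;>
    simp [hyperChr, hlen, onE_zero, onE_one, onE_two, onOm, cotS, -Complex.ofReal_sin,
      -Complex.ofReal_cos] <;> field_simp <;> ring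

/-- In orthogonal coordinates `ε_i^{kl}` carries the factor `h_i / (h_k h_l)`, which is absorbed by
passing to orthonormal components; the constant symbol remains. -/
lemma RepO2.symm_volUp {K : (Fin 3 → ℝ) → Fin 3 → Fin 3 → ℂ} {x : Fin 3 → Fin 3 → HypS}
    (h : RepO2 K x) : RepO1 (fun z i => ∑ k, ∑ l, volUp γ z i k l • K z k l)
      (fun i => ∑ k, ∑ l, eps i k l • x k l) := fun i u => by
  simp only [h.ev_eq, volUp_hyper u.2, map_mul, ev_hS, map_sum, map_smul, smul_eq_mul,
    Finset.mul_sum, eps, Complex.real_smul]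
  refine Finset.sum_congr rfl fun k _ => Finset.sum_congr rfl fun l _ => ?_
  have hk : (hlen u k : ℂ) ≠ 0 := Complex.ofReal_ne_zero.2 (hlen_pos u.2 k).ne'
  have hl : (hlen u l : ℂ) ≠ 0 := Complex.ofReal_ne_zero.2 (hlen_pos u.2 l).ne'
  push_cast
  field_simp

lemma RepO1.curl {w : (Fin 3 → ℝ) → Fin 3 → ℂ} {v : Fin 3 → HypS} (h : RepO1 w v) :
    RepO1 (curl γ w) (curlO v) := h.cov1.symm_volUp

lemma RepO2.symCurl {T : (Fin 3 → ℝ) → Fin 3 → Fin 3 → ℂ} {t : Fin 3 → Fin 3 → HypS}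
    (h : RepO2 T t) : RepO2 (symCurl γ T) (symCurlO t) := fun i j u => by
  have h2 := fun k i j => h.cov2 k i j u
  simp only [map_mul, ev_hS] at h2
  simp only [SchwKY.symCurl, h2, volUp_hyper u.2, symCurlO, map_mul, ev_hS, map_sum, map_smul,
    map_add, smul_eq_mul, Finset.mul_sum, eps, Complex.real_smul]
  refine Finset.sum_congr rfl fun k _ => Finset.sum_congr rfl fun l _ => ?_
  have hk : (hlen u k : ℂ) ≠ 0 := Complex.ofReal_ne_zero.2 (hlen_pos u.2 k).ne'
  have hl : (hlen u l : ℂ) ≠ 0 := Complex.ofReal_ne_zero.2 (hlen_pos u.2 l).ne'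
  push_cast
  field_simp

lemma RepO1.symGrad {w : (Fin 3 → ℝ) → Fin 3 → ℂ} {v : Fin 3 → HypS} (h : RepO1 w v) :
    RepO2 (symGrad γ w) (symGradO v) := fun i j u => by
  have h1 := h.cov1 i j u; have h2 := h.cov1 j i u
  simp only at h1 h2
  simp only [SchwKY.symGrad, h1, h2, symGradO, map_mul, map_smul, map_add, smul_eq_mul,
    Complex.real_smul]
  push_cast
  ring

lemma _root_.SchwKY.Lift.gradO {f : (Fin 3 → ℝ) → ℂ} {s : HypS} (h : Lift f s) :
    RepO1 (grad f) (fun i => onE i s) := fun i u => by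
  have h0 : (Real.sin (u.1 0) : ℂ) ≠ 0 := Complex.ofReal_ne_zero.2 (sin_pos0 u.2).ne'
  have h1 : (Real.sin (u.1 1) : ℂ) ≠ 0 := Complex.ofReal_ne_zero.2 (sin_pos1 u.2).ne'
  simp only [grad]
  rw [h.pd i u, map_mul, ev_hS]
  fin_cases i <;> simp [hlen, onE_zero, onE_one, onE_two, -Complex.ofReal_sin] <;> field_simp

lemma RepO1.congr {w w' : (Fin 3 → ℝ) → Fin 3 → ℂ} {v v' : Fin 3 → HypS} (h : RepO1 w v)
    (hw : ∀ z ∈ hyperDom, ∀ i, w' z i = w z i) (hv : ∀ a, v' a = v a) : RepO1 w' v' :=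
  fun i u => by simpa only [hv, hw u u.2 i] using h i u

lemma RepO2.congr {T T' : (Fin 3 → ℝ) → Fin 3 → Fin 3 → ℂ} {t t' : Fin 3 → Fin 3 → HypS}
    (h : RepO2 T t) (hw : ∀ z ∈ hyperDom, ∀ i j, T' z i j = T z i j)
    (hv : ∀ a b, t' a b = t a b) : RepO2 T' t' :=
  fun i j u => by simpa only [hv, hw u u.2 i j] using h i j u

lemma RepO1.mul {w : (Fin 3 → ℝ) → Fin 3 → ℂ} {v : Fin 3 → HypS} {f : (Fin 3 → ℝ) → ℂ}
    {s : HypS} (hf : Lift f s) (h : RepO1 w v) :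
    RepO1 (fun z i => f z * w z i) (fun a => s * v a) := fun i u => by
  simp only [h.ev_eq, hf u, map_mul, ev_hS]; ring

lemma RepO2.mul {T : (Fin 3 → ℝ) → Fin 3 → Fin 3 → ℂ} {t : Fin 3 → Fin 3 → HypS}
    {f : (Fin 3 → ℝ) → ℂ} {s : HypS} (hf : Lift f s) (h : RepO2 T t) :
    RepO2 (fun z i j => f z * T z i j) (fun a b => s * t a b) := fun i j u => by
  simp only [h.ev_eq, hf u, map_mul, ev_hS]; ring

lemma RepO2.add {T T' : (Fin 3 → ℝ) → Fin 3 → Fin 3 → ℂ} {t t' : Fin 3 → Fin 3 → HypS}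
    (h : RepO2 T t) (h' : RepO2 T' t') :
    RepO2 (fun z i j => T z i j + T' z i j) (fun a b => t a b + t' a b) := fun i j u => by
  simp only [h.ev_eq, h'.ev_eq, map_mul, map_add, ev_hS]; ring

lemma RepO1.tensor {w w' : (Fin 3 → ℝ) → Fin 3 → ℂ} {v v' : Fin 3 → HypS} (h : RepO1 w v)
    (h' : RepO1 w' v') : RepO2 (fun z i j => w z i * w' z j) (fun a b => v a * v' b) :=
  fun i j u => by
    simp only [h.ev_eq, h'.ev_eq, map_mul, ev_hS]; ring

lemma lift_const (r : ℂ) : Lift (fun _ => r) (algebraMap ℂ HypS r) := fun u => by simp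

lemma RepO1.contDiffOn {w : (Fin 3 → ℝ) → Fin 3 → ℂ} {v : Fin 3 → HypS} (h : RepO1 w v) :
    ContDiffOn ℝ ∞ w hyperDom := contDiffOn_pi.2 fun i => (h i).contDiffOn

lemma RepO2.contDiffOn {T : (Fin 3 → ℝ) → Fin 3 → Fin 3 → ℂ} {t : Fin 3 → Fin 3 → HypS}
    (h : RepO2 T t) : ContDiffOn ℝ ∞ T hyperDom :=
  contDiffOn_pi.2 fun i => contDiffOn_pi.2 fun j => (h i j).contDiffOn

section

variable {v : Fin 3 → HypS} {t : Fin 3 → Fin 3 → HypS}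

lemma curlO_eq (v : Fin 3 → HypS) (a : Fin 3) : curlO v a
    = ![onE 1 (v 2) - onE 2 (v 1) + cscS 0 * cotS 1 * v 2,
        onE 2 (v 0) - onE 0 (v 2) - cotS 0 * v 2,
        onE 0 (v 1) - onE 1 (v 0) + cotS 0 * v 1] a := by
  rw [curlO, sum_sum_eps_smul]
  rcases fin3_cases a with rfl | rfl | rfl <;>
    simp [cov1O, onOm, Fin.sum_univ_three] <;> ring

/-- The symmetrized curl of a symmetric tensor in the orthonormal frame. -/
lemma symCurlO_eq (ht : ∀ a b, t a b = t b a) (htr : t 0 0 + t 1 1 + t 2 2 = 0) :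
    symCurlO t 0 0 = 2 * (onE 1 (t 0 2) - onE 2 (t 0 1) + cscS 0 * cotS 1 * t 0 2) ∧
    symCurlO t 1 1 = 2 * (onE 2 (t 0 1) - cscS 0 * cotS 1 * t 0 2 - cotS 0 * t 1 2
      - onE 0 (t 1 2)) ∧
    symCurlO t 2 2 = 2 * (onE 0 (t 1 2) + cotS 0 * t 1 2 - onE 1 (t 0 2)) ∧
    symCurlO t 0 1 = onE 1 (t 1 2) - onE 2 (t 1 1) + 2 * cscS 0 * cotS 1 * t 1 2
      + onE 2 (t 0 0) - onE 0 (t 0 2) - cotS 0 * t 0 2 ∧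
    symCurlO t 0 2 = onE 1 (t 2 2) - onE 2 (t 1 2) + cscS 0 * cotS 1 * (t 2 2 - t 1 1)
      + onE 0 (t 0 1) - onE 1 (t 0 0) + cotS 0 * t 0 1 ∧
    symCurlO t 1 2 = onE 2 (t 0 2) - onE 0 (t 2 2) + onE 0 (t 1 1) - onE 1 (t 0 1)
      + cscS 0 * cotS 1 * t 0 1 + cotS 0 * (t 1 1 - t 2 2) := by
  have h10 := ht 1 0; have h20 := ht 2 0; have h21 := ht 2 1
  have key : ∀ a b, symCurlO t a b
    = ![cov2O t 1 b 2 - cov2O t 2 b 1, cov2O t 2 b 0 - cov2O t 0 b 2,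
        cov2O t 0 b 1 - cov2O t 1 b 0] a
      + ![cov2O t 1 a 2 - cov2O t 2 a 1, cov2O t 2 a 0 - cov2O t 0 a 2,
        cov2O t 0 a 1 - cov2O t 1 a 0] b := fun a b => by
    simp only [symCurlO, Finset.sum_add_distrib]
    rw [sum_sum_eps_smul a fun k l => cov2O t k b l, sum_sum_eps_smul b fun k l => cov2O t k a l]
  have h00 : t 0 0 = - t 1 1 - t 2 2 := by linear_combination htr
  refine ⟨?_, ?_, ?_, ?_, ?_, ?_⟩ <;> rw [key] <;>
    simp only [cov2O, onOm, Fin.sum_univ_three, Matrix.cons_val, h10, h20, h21] <;>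
    simp <;> ring

end

/-! ### Scalar harmonics in hyperspherical coordinates -/

lemma RepO1.const_mul {w : (Fin 3 → ℝ) → Fin 3 → ℂ} {v : Fin 3 → HypS} (h : RepO1 w v) (r : ℂ) :
    RepO1 (fun z i => r * w z i) (fun a => r • v a) :=
  (RepO1.mul (lift_const r) h).congr (fun _ _ _ => rfl) fun a => by rw [Algebra.smul_def]

lemma RepO2.const_mul {T : (Fin 3 → ℝ) → Fin 3 → Fin 3 → ℂ} {t : Fin 3 → Fin 3 → HypS}
    (h : RepO2 T t) (r : ℂ) : RepO2 (fun z i j => r * T z i j) (fun a b => r • t a b) :=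
  (RepO2.mul (lift_const r) h).congr (fun _ _ _ _ => rfl) fun a b => by rw [Algebra.smul_def]

lemma cov1O_smul (r : ℂ) (v : Fin 3 → HypS) (a b : Fin 3) :
    cov1O (fun a => r • v a) a b = r • cov1O v a b := by
  simp only [cov1O, Derivation.map_smul, smul_sub, Finset.smul_sum, mul_smul_comm]

lemma cov2O_smul (r : ℂ) (t : Fin 3 → Fin 3 → HypS) (a b d : Fin 3) :
    cov2O (fun a b => r • t a b) a b d = r • cov2O t a b d := by
  simp only [cov2O, Derivation.map_smul, smul_sub, Finset.smul_sum, mul_smul_comm]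

lemma curlO_smul (r : ℂ) (v : Fin 3 → HypS) (a : Fin 3) :
    curlO (fun a => r • v a) a = r • curlO v a := by
  simp only [curlO, cov1O_smul, Finset.smul_sum, smul_comm r]

lemma symGradO_smul (r : ℂ) (v : Fin 3 → HypS) (a b : Fin 3) :
    symGradO (fun a => r • v a) a b = r • symGradO v a b := by
  simp only [symGradO, cov1O_smul, smul_add, smul_comm r]

lemma symCurlO_smul (r : ℂ) (t : Fin 3 → Fin 3 → HypS) (a b : Fin 3) :
    symCurlO (fun a b => r • t a b) a b = r • symCurlO t a b := by
  simp only [symCurlO, cov2O_smul, Finset.smul_sum, smul_add, smul_comm r]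

namespace HarmonicData

variable (d : HarmonicData)

lemma cos_mem {z : Fin 3 → ℝ} (hz : z ∈ hyperDom) : Real.cos (z 0) ∈ Set.Ioo (-1 : ℝ) 1 := by
  have hs := sin_pos0 hz
  have := Real.sin_sq_add_cos_sq (z 0)
  constructor <;> nlinarith

lemma contDiffOn_deriv_C : ContDiffOn ℝ ∞ (deriv d.C) (Set.Ioo (-1) 1) :=
  d.contDiff_C.deriv_of_isOpen isOpen_Ioo (by simp)

lemma contDiffOn_deriv_Θ : ContDiffOn ℝ ∞ (deriv d.Θ) (Set.Ioo 0 Real.pi) :=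
  d.contDiff_Θ.deriv_of_isOpen isOpen_Ioo (by simp)

lemma contDiffOn_comp_cos {f : ℝ → ℂ} (hf : ContDiffOn ℝ ∞ f (Set.Ioo (-1) 1)) :
    ContDiffOn ℝ ∞ (fun z : Fin 3 → ℝ => f (Real.cos (z 0))) hyperDom :=
  hf.comp (f := fun z : Fin 3 → ℝ => Real.cos (z 0)) (by fun_prop) fun _ hz => cos_mem hz

lemma contDiffOn_comp_one {f : ℝ → ℂ} (hf : ContDiffOn ℝ ∞ f (Set.Ioo 0 Real.pi)) :
    ContDiffOn ℝ ∞ (fun z : Fin 3 → ℝ => f (z 1)) hyperDom :=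
  hf.comp (f := fun z : Fin 3 → ℝ => z 1) (by fun_prop) fun _ hz => hz.2

/-- `C(cos χ)`. -/
def C0 : HypS := mkS (fun z => d.C (Real.cos (z 0))) (contDiffOn_comp_cos d.contDiff_C)

/-- `C'(cos χ)`. -/
def C1 : HypS := mkS (fun z => deriv d.C (Real.cos (z 0))) (contDiffOn_comp_cos d.contDiffOn_deriv_C)

/-- `Θ(ϑ)`. -/
def Θ0 : HypS := mkS (fun z => d.Θ (z 1)) (contDiffOn_comp_one d.contDiff_Θ)

/-- `Θ'(ϑ)`. -/
def Θ1 : HypS := mkS (fun z => deriv d.Θ (z 1)) (contDiffOn_comp_one d.contDiffOn_deriv_Θ)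

@[simp] lemma ev_C0 (u : hyperChart.U) : ev u d.C0 = d.C (Real.cos (u.1 0)) := rfl

@[simp] lemma ev_C1 (u : hyperChart.U) : ev u d.C1 = deriv d.C (Real.cos (u.1 0)) := rfl

@[simp] lemma ev_Θ0 (u : hyperChart.U) : ev u d.Θ0 = d.Θ (u.1 1) := rfl

@[simp] lemma ev_Θ1 (u : hyperChart.U) : ev u d.Θ1 = deriv d.Θ (u.1 1) := rfl

/-- The eigenvalue of `∂/∂φ`. -/
def nu : ℂ := -(Complex.I * d.m)

lemma nu_sq : d.nu ^ 2 = -(d.m : ℂ) ^ 2 := by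
  rw [nu, neg_sq, mul_pow, Complex.I_sq]; ring

/-- `e^{-imφ}`. -/
def expS : HypS := mkS (fun z => Complex.exp (-(Complex.I * d.m * (z 2 : ℝ)))) (by
  have h : ContDiff ℝ ∞ fun z : Fin 3 → ℝ => ((z 2 : ℝ) : ℂ) :=
    Complex.ofRealCLM.contDiff.comp (contDiff_apply ℝ ℝ 2)
  exact (contDiff_const.mul h).neg.cexp.contDiffOn)

lemma hasDerivAt_C {x : ℝ} (hx : x ∈ Set.Ioo (-1 : ℝ) 1) : HasDerivAt d.C (deriv d.C x) x :=
  ((d.contDiff_C.contDiffAt (isOpen_Ioo.mem_nhds hx)).differentiableAt (by simp)).hasDerivAt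

lemma hasDerivAt_deriv_C {x : ℝ} (hx : x ∈ Set.Ioo (-1 : ℝ) 1) :
    HasDerivAt (deriv d.C) (deriv (deriv d.C) x) x :=
  ((d.contDiffOn_deriv_C.contDiffAt (isOpen_Ioo.mem_nhds hx)).differentiableAt
    (by simp)).hasDerivAt

lemma hasDerivAt_Θ {x : ℝ} (hx : x ∈ Set.Ioo (0 : ℝ) Real.pi) : HasDerivAt d.Θ (deriv d.Θ x) x :=
  ((d.contDiff_Θ.contDiffAt (isOpen_Ioo.mem_nhds hx)).differentiableAt (by simp)).hasDerivAt

lemma hasDerivAt_deriv_Θ {x : ℝ} (hx : x ∈ Set.Ioo (0 : ℝ) Real.pi) :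
    HasDerivAt (deriv d.Θ) (deriv (deriv d.Θ) x) x :=
  ((d.contDiffOn_deriv_Θ.contDiffAt (isOpen_Ioo.mem_nhds hx)).differentiableAt
    (by simp)).hasDerivAt

lemma pdS_C0 (i : Fin 3) : pdS i d.C0 = if i = 0 then -(sinS 0 * d.C1) else 0 :=
  pdS_of_hasDerivAt (f := fun x => d.C (Real.cos x))
    (f' := fun x => -Real.sin x • deriv d.C (Real.cos x)) 0
    (lift_mkS _ _) (fun u => by simp)
    (fun z hz => (d.hasDerivAt_C (cos_mem hz)).scomp (z 0) (Real.hasDerivAt_cos (z 0))) i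

/-- The second derivative of `C` enters as a new element subject to its differential equation, with
`1 - x²` written as `sin² χ`. It is eliminated in `pdS_H1S`. -/
lemma exists_pdS_C1 : ∃ c2 : HypS, (∀ i, pdS i d.C1 = if i = 0 then -(sinS 0 * c2) else 0) ∧
    sinS 0 ^ 2 * c2 - (2 * d.l + 3) * (cosS 0 * d.C1) + (d.k * (d.k + 2) - d.l * (d.l + 2)) * d.C0
      = 0 := by
  have hs : ContDiffOn ℝ ∞ (deriv (deriv d.C)) (Set.Ioo (-1) 1) :=
    d.contDiffOn_deriv_C.deriv_of_isOpen isOpen_Ioo (by simp)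
  obtain ⟨c2, hc2⟩ := exists_lift (U := hyperChart.U) (contDiffOn_comp_cos hs)
  refine ⟨c2, fun i => ?_, Sm.ext' fun u => ?_⟩
  · exact pdS_of_hasDerivAt (f := fun x => deriv d.C (Real.cos x))
      (f' := fun x => -Real.sin x • deriv (deriv d.C) (Real.cos x)) 0
      (lift_mkS _ _) (fun u => by simp [← hc2 u])
      (fun z hz => (d.hasDerivAt_deriv_C (cos_mem hz)).scomp (z 0) (Real.hasDerivAt_cos (z 0))) i
  · have h := d.ode_C _ (cos_mem u.2)
    have hs2 : (Real.sin (u.1 0) : ℂ) ^ 2 = 1 - (Real.cos (u.1 0) : ℂ) ^ 2 := by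
      rw [← Complex.ofReal_pow, Real.sin_sq]; push_cast; ring
    simp only [Complex.real_smul] at h
    push_cast at h
    simp only [map_add, map_sub, map_mul, map_pow, ev_sinS, ev_cosS, ev_C1, ev_C0, ← hc2 u, map_natCast,
      map_ofNat, map_zero, hs2]
    push_cast
    linear_combination h

lemma pdS_Θ0 (i : Fin 3) : pdS i d.Θ0 = if i = 1 then d.Θ1 else 0 :=
  pdS_of_hasDerivAt (f := d.Θ) (f' := deriv d.Θ) 1 (lift_mkS _ _) (lift_mkS _ _)
    (fun _ hz => d.hasDerivAt_Θ hz.2) i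

/-- The polar equation solved for `Θ''`, with `-m²` written as the square of the eigenvalue of
`∂/∂φ`, so that polar and azimuthal derivatives use the same constant. -/
lemma pdS_Θ1 (i : Fin 3) : pdS i d.Θ1 = if i = 1 then
    -(cotS 1 * d.Θ1) - (d.l * (d.l + 1) + algebraMap ℂ HypS d.nu ^ 2 * cscS 1 ^ 2) * d.Θ0
      else 0 := by
  have hs : ContDiffOn ℝ ∞ (deriv (deriv d.Θ)) (Set.Ioo 0 Real.pi) :=
    d.contDiffOn_deriv_Θ.deriv_of_isOpen isOpen_Ioo (by simp)
  obtain ⟨t2, ht2⟩ := exists_lift (U := hyperChart.U) (contDiffOn_comp_one hs)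
  have h1 := pdS_of_hasDerivAt (f := deriv d.Θ) (f' := deriv (deriv d.Θ)) 1
    (s := d.Θ1) (s' := t2) (lift_mkS _ _) ht2 (fun z hz => d.hasDerivAt_deriv_Θ hz.2) i
  rw [h1]
  split_ifs
  · refine Sm.ext' fun u => ?_
    have h := d.ode_Θ _ u.2.2
    have hd : deriv (fun s => Real.sin s • deriv d.Θ s) (u.1 1) = _ :=
      ((Real.hasDerivAt_sin (u.1 1)).smul (d.hasDerivAt_deriv_Θ u.2.2)).deriv
    rw [hd] at h
    simp only [Complex.real_smul] at h
    push_cast at h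
    have hs : (Real.sin (u.1 1) : ℂ) ≠ 0 := Complex.ofReal_ne_zero.2 (sin_pos1 u.2).ne'
    simp only [map_add, map_sub, map_neg, map_mul, map_pow, ev_cosS, ev_Θ1, ev_Θ0, ← ht2 u, map_natCast,
      map_one, cotS, ev_cscS, AlgHom.commutes, Algebra.algebraMap_self, RingHom.id_apply, nu_sq]
    simp only [Fin.castSucc_one, Complex.ofReal_inv, Complex.ofReal_sin, Complex.ofReal_cos] at hs ⊢
    field_simp
    linear_combination h
  · rfl

lemma pdS_expS (i : Fin 3) : pdS i d.expS = if i = 2 then d.nu • d.expS else 0 :=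
  pdS_of_hasDerivAt (f := fun x => Complex.exp (-(Complex.I * d.m * (x : ℝ))))
    (f' := fun x => d.nu * Complex.exp (-(Complex.I * d.m * (x : ℝ)))) 2
    (lift_mkS _ _) (fun u => by simp [expS])
    (fun z _ => by
      have h1 : HasDerivAt (fun x : ℝ => (x : ℂ)) 1 (z 2) := (hasDerivAt_id (z 2)).ofReal_comp
      have h2 := ((h1.const_mul (Complex.I * d.m)).neg).cexp
      refine h2.congr_deriv ?_
      rw [nu, mul_one, mul_comm]; rfl) i

/-- The radial function of the harmonic. -/
def HS : HypS := sinS 0 ^ d.l * d.C0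

/-- The derivative of the radial function. -/
def H1S : HypS := pdS 0 d.HS

/-- The spherical harmonic. -/
def YS : HypS := d.expS * d.Θ0

/-- The polar derivative of the spherical harmonic. -/
def Y1S : HypS := d.expS * d.Θ1

/-- The eigenvalue of `∂/∂φ` as a constant function. -/
def nuS : HypS := algebraMap ℂ HypS d.nu

@[simp] lemma pdS_nuS (i : Fin 3) : pdS i d.nuS = 0 := Derivation.map_algebraMap _ _

lemma lift_HS : Lift (fun z => d.H (z 0)) d.HS := fun u => by
  simp [HS, H]

lemma lift_YS : Lift (fun z => d.Y (z 1) (z 2)) d.YS := fun u => by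
  simp [YS, Y, expS]

lemma lift_S : Lift d.S (d.HS * d.YS) := d.lift_HS.mul d.lift_YS

lemma pdS_sin_pow (n : ℕ) (i : Fin 3) :
    pdS i (sinS 0 ^ n) = if i = 0 then (n : HypS) * (cotS 0 * sinS 0 ^ n) else 0 := by
  have h := sinS_mul_cscS 0
  rw [Derivation.leibniz_pow, pdS_sinS]
  split_ifs
  · cases n with
    | zero => simp
    | succ n =>
      simp only [nsmul_eq_mul, smul_eq_mul, add_tsub_cancel_right, cotS]
      rw [pow_succ]
      simp only [Fin.castSucc_zero] at h ⊢
      linear_combination -((n + 1 : ℕ) : HypS) * sinS 0 ^ n * cosS 0 * h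
  · simp

lemma H1S_eq : d.H1S = d.l * (cotS 0 * d.HS) - sinS 0 ^ d.l * (sinS 0 * d.C1) := by
  rw [H1S, HS, Derivation.leibniz, pdS_sin_pow, pdS_C0]
  simp only [if_true, smul_eq_mul]
  ring

lemma pdS_HS (i : Fin 3) : pdS i d.HS = if i = 0 then d.H1S else 0 := by
  split_ifs with h
  · rw [h]; rfl
  · rw [HS, Derivation.leibniz, pdS_sin_pow, pdS_C0]
    simp [h]

/-- The radial equation `H'' + 2 cot χ H' + (k(k+2) - ℓ(ℓ+1) csc² χ) H = 0`. With the equations of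
`Y`, it is all the harmonic computations use of the equation of `C`. -/
lemma pdS_H1S (i : Fin 3) : pdS i d.H1S = if i = 0 then
    -(2 * cotS 0 * d.H1S) - (d.k * (d.k + 2) - d.l * (d.l + 1) * cscS 0 ^ 2) * d.HS else 0 := by
  split_ifs with h
  · obtain ⟨c2, hc2, hode⟩ := d.exists_pdS_C1
    have h1 := sinS_mul_cscS 0
    have h2 := cscS_sq 0
    subst h
    rw [H1S_eq]
    simp only [map_sub, Derivation.leibniz, pdS_HS, pdS_cotS, pdS_sin_pow, pdS_sinS, hc2,
      Derivation.map_natCast, smul_eq_mul, Fin.castSucc_zero, if_true, H1S_eq] at h1 ⊢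
    rw [show cotS 0 = cosS 0 * cscS 0 from rfl, HS] at *
    linear_combination sinS 0 ^ d.l * hode
      - (2 * d.l + 2) * sinS 0 ^ d.l * d.C1 * cosS 0 * h1
      - (d.l ^ 2 + d.l) * d.C0 * sinS 0 ^ d.l * h2
  · rw [H1S, pdS_comm, pdS_HS, if_neg h, map_zero]

lemma pdS_YS (i : Fin 3) : pdS i d.YS = ![0, d.Y1S, d.nuS * d.YS] i := by
  rw [YS, Derivation.leibniz, pdS_expS, pdS_Θ0]
  fin_cases i <;> simp [Y1S, nuS, Algebra.smul_def]
  ring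

lemma pdS_Y1S (i : Fin 3) : pdS i d.Y1S = ![0,
    -(cotS 1 * d.Y1S) - (d.l * (d.l + 1) + d.nuS ^ 2 * cscS 1 ^ 2) * d.YS, d.nuS * d.Y1S] i := by
  rw [Y1S, Derivation.leibniz, pdS_expS, pdS_Θ1]
  fin_cases i <;> simp [YS, nuS, Algebra.smul_def] <;> ring

end HarmonicData

namespace HarmonicData

variable (d : HarmonicData)

/-! ### Vector harmonics -/

/-- Orthonormal components of `ε_i^{jk} D_j (q Y) D_k cos χ` for a radial function `q`. -/
def vecO (q : HypS) : Fin 3 → HypS := ![0, -(d.nuS * cscS 1 * q * d.YS), q * d.Y1S]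

lemma lift_cosχ : Lift cosχ (cosS 0) := lift_mkS _ _

/-- `D cos χ` is radial, so the derivative of `q` drops out of the cross product and only angular
derivatives of `Y` occur. It is used with `q = H` for `V1` and with `q = sin^ℓ χ` for `F`. -/
lemma rep_cross {f q : HypS} {F : (Fin 3 → ℝ) → ℂ} (hF : Lift F f) (hf : f = q * d.YS)
    (hq : ∀ i, i ≠ 0 → pdS i q = 0) :
    RepO1 (fun z i => ∑ j, ∑ k, volUp γ z i j k • (grad F z j * grad cosχ z k)) (d.vecO q) := by
  have h := (hF.gradO.tensor lift_cosχ.gradO).symm_volUp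
  refine h.congr (fun _ _ _ => rfl) fun i => ?_
  have hs := sinS_mul_cscS 0
  have h1 := hq 1 (by decide); have h2 := hq 2 (by decide)
  simp only [Fin.castSucc_zero] at hs
  rw [sum_sum_eps_smul i fun k l => onE k f * onE l (cosS 0), hf]
  rcases fin3_cases i with rfl | rfl | rfl <;>
    simp [vecO, onE_zero, onE_one, onE_two, pdS_cosS, Derivation.leibniz, h1, h2, pdS_YS]
  · linear_combination cscS 1 * q * d.nuS * d.YS * hs
  · linear_combination -q * d.Y1S * hs

/-- The norming factor of `V1` as a complex number. -/
def nV : ℂ := ((1 / Real.sqrt ((d.l : ℝ) * (d.l + 1)) : ℝ) : ℂ)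

lemma rep_V1 : RepO1 d.V1 (fun i => d.nV • d.vecO d.HS i) :=
  ((d.rep_cross d.lift_S rfl fun i hi => by rw [pdS_HS, if_neg hi]).const_mul d.nV).congr
    (fun z _ i => by rw [V1, Complex.real_smul]; rfl) fun _ => rfl

lemma curlO_vecO (i : Fin 3) : curlO (d.vecO d.HS) i
    = ![-(d.l * (d.l + 1) * cscS 0 * d.HS * d.YS), -((cotS 0 * d.HS + d.H1S) * d.Y1S),
      -((cotS 0 * d.HS + d.H1S) * d.nuS * cscS 1 * d.YS)] i := by
  rw [curlO_eq]
  rcases fin3_cases i with rfl | rfl | rfl <;>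
    simp [vecO, onE_zero, onE_one, onE_two, Derivation.leibniz, pdS_YS, pdS_Y1S, pdS_HS, pdS_cscS] <;> ring

/-- The `χ` component cancels by the product rules alone. In the others the radial equation cancels
`ℓ(ℓ+1) csc² χ` and leaves `k(k+2) + 1 = (k+1)²`. -/
lemma curlO_curlO_vecO (i : Fin 3) :
    curlO (curlO (d.vecO d.HS)) i = (d.k + 1) ^ 2 * d.vecO d.HS i := by
  have ha := cscS_sq 0
  rw [funext d.curlO_vecO, curlO_eq]
  rcases fin3_cases i with rfl | rfl | rfl <;>
    simp [vecO, onE_zero, onE_one, onE_two, Derivation.leibniz, pdS_YS, pdS_Y1S, pdS_HS, pdS_H1S,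
      pdS_cscS, pdS_cotS]
  · ring
  · ring_nf
  · ring_nf

/-- The factor `1 / (k + 1)`. -/
def rk : ℂ := ((1 / ((d.k : ℝ) + 1) : ℝ) : ℂ)

lemma k_ne : (d.k : ℂ) + 1 ≠ 0 := Nat.cast_add_one_ne_zero d.k

lemma rk_mul : ((d.k : ℂ) + 1) * d.rk = 1 := by
  have := d.k_ne
  rw [rk]; push_cast; field_simp

lemma V2_eq (z : Fin 3 → ℝ) (i : Fin 3) : d.V2 z i = d.rk * curl γ d.V1 z i := by
  rw [V2, Complex.real_smul]; rfl

lemma curl_V1 (z : Fin 3 → ℝ) (i : Fin 3) : curl γ d.V1 z i = (d.k + 1) * d.V2 z i := by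
  rw [V2_eq, ← mul_assoc, rk_mul, one_mul]

lemma rep_V2 : RepO1 d.V2 (fun i => (d.rk * d.nV) • curlO (d.vecO d.HS) i) :=
  (d.rep_V1.curl.const_mul d.rk).congr (fun z _ i => d.V2_eq z i) fun i => by
    rw [curlO_smul, smul_smul]

lemma curl_V2 {z : Fin 3 → ℝ} (hz : z ∈ hyperDom) (i : Fin 3) :
    curl γ d.V2 z i = (d.k + 1) * d.V1 z i := by
  have h1 := d.rep_V2.curl.ev_eq ⟨z, hz⟩ i
  have h2 := d.rep_V1.ev_eq ⟨z, hz⟩ i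
  have h3 := d.rk_mul
  simp only [curlO_smul, curlO_curlO_vecO, map_smul, map_mul, map_pow, map_add, map_natCast,
    map_one, smul_eq_mul] at h1 h2
  rw [h1, h2]
  linear_combination (d.k + 1 : ℂ) * hlen z i * d.nV * ev ⟨z, hz⟩ (d.vecO d.HS i) * h3

/-! ### Tensor harmonics -/

/-- Orthonormal components of a multiple of `T4`. -/
def tenO : Fin 3 → Fin 3 → HypS :=
  let a := cscS 0; let t := cotS 0; let b := cscS 1; let τ := cotS 1
  let Λ : HypS := d.l * (d.l + 1)
  let q := 2 * t * d.HS + d.H1S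
  let x01 := (Λ - 2) * a * d.nuS * b * d.HS * d.YS
  let x02 := -((Λ - 2) * a * d.HS * d.Y1S)
  let x11 := 2 * q * d.nuS * b * (d.Y1S - τ * d.YS)
  let x12 := q * (Λ * d.YS + 2 * (d.nuS ^ 2 * b ^ 2 * d.YS + τ * d.Y1S))
  ![![0, x01, x02], ![x01, x11, x12], ![x02, x12, -x11]]

/-- Orthonormal components of a multiple of `T5`. -/
def tenO' : Fin 3 → Fin 3 → HypS :=
  let a := cscS 0; let t := cotS 0; let b := cscS 1; let τ := cotS 1
  let Λ : HypS := d.l * (d.l + 1)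
  let X : HypS := d.k * (d.k + 2)
  let g := 2 * (2 * t ^ 2 * d.HS + t * d.H1S + (Λ - 2) * a ^ 2 * d.HS - X * d.HS)
  let f := g - (Λ - 2) * a ^ 2 * d.HS
  let Φ := d.nuS ^ 2 * b ^ 2 * d.YS + τ * d.Y1S
  let x00 := 2 * (Λ - 2) * Λ * a ^ 2 * d.HS * d.YS
  let x01 := 2 * (Λ - 2) * a * (t * d.HS + d.H1S) * d.Y1S
  let x02 := 2 * (Λ - 2) * a * (t * d.HS + d.H1S) * d.nuS * b * d.YS
  let x11 := -(g * Λ * d.YS) - 2 * f * Φ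
  let x12 := 2 * f * d.nuS * b * (d.Y1S - τ * d.YS)
  ![![x00, x01, x02], ![x01, x11, x12], ![x02, x12, -x00 - x11]]

lemma tenO_symm (a b : Fin 3) : d.tenO a b = d.tenO b a := by
  rcases fin3_cases a with rfl | rfl | rfl <;> rcases fin3_cases b with rfl | rfl | rfl <;> rfl

lemma tenO'_symm (a b : Fin 3) : d.tenO' a b = d.tenO' b a := by
  rcases fin3_cases a with rfl | rfl | rfl <;> rcases fin3_cases b with rfl | rfl | rfl <;> rfl

lemma symCurlO_symm (t : Fin 3 → Fin 3 → HypS) (a b : Fin 3) :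
    symCurlO t a b = symCurlO t b a := by
  simp only [symCurlO]
  exact Finset.sum_congr rfl fun _ _ => Finset.sum_congr rfl fun _ _ => add_comm _ _

lemma pdS_two (i : Fin 3) : pdS i (2 : HypS) = 0 := by
  simpa using (pdS i : Derivation ℂ HypS HypS).map_natCast 2

/-- Second derivatives are eliminated by the radial and angular equations. The components with a `χ`
index are then polynomial identities; the purely angular ones also need `csc² χ = 1 + cot² χ`. -/
lemma symCurlO_tenO (a b : Fin 3) : symCurlO d.tenO a b = d.tenO' a b := by
  have ha := cscS_sq 0
  obtain ⟨h00, h11, h22, h01, h02, h12⟩ := symCurlO_eq d.tenO_symm (by simp [tenO])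
  refine symm_ext (symCurlO_symm _) d.tenO'_symm ?_ ?_ ?_ ?_ ?_ ?_ a b <;>
    simp only [h00, h11, h22, h01, h02, h12] <;> clear h00 h11 h22 h01 h02 h12 <;>
    simp [tenO, tenO', onE_zero, onE_one, onE_two, Derivation.leibniz, pdS_YS, pdS_Y1S, pdS_HS,
      pdS_H1S, pdS_cscS, pdS_cotS, pdS_two]
  · ring
  · ring
  · ring
  · linear_combination (-4 * d.HS * (d.l * (d.l + 1) * d.YS
      + 2 * (d.nuS ^ 2 * cscS 1 ^ 2 * d.YS + cotS 1 * d.Y1S))) * ha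
  · linear_combination (8 * cscS 1 * d.nuS * d.HS * (d.Y1S - cotS 1 * d.YS)) * ha
  · linear_combination (4 * d.HS * (d.l * (d.l + 1) * d.YS
      + 2 * (d.nuS ^ 2 * cscS 1 ^ 2 * d.YS + cotS 1 * d.Y1S))) * ha

end HarmonicData

namespace HarmonicData

variable (d : HarmonicData)

-- Together with `symCurlO_tenO` this is `symCurl² = 4(k+1)²` on the `T4` class. The method is the
-- same, and the radial equation is now also used for `H'` inside the components of `tenO'`.
set_option maxHeartbeats 1000000 in
lemma symCurlO_tenO' (a b : Fin 3) :
    symCurlO d.tenO' a b = 4 * (d.k + 1) ^ 2 * d.tenO a b := by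
  have ha := cscS_sq 0
  obtain ⟨h00, h11, h22, h01, h02, h12⟩ := symCurlO_eq d.tenO'_symm (by simp [tenO'])
  refine symm_ext (s := symCurlO d.tenO')
    (t := fun a b => 4 * (d.k + 1) ^ 2 * d.tenO a b) (symCurlO_symm _)
    (fun a b => by rw [d.tenO_symm a b]) ?_ ?_ ?_ ?_ ?_ ?_ a b <;>
    simp only [h00, h11, h22, h01, h02, h12] <;> clear h00 h11 h22 h01 h02 h12 <;>
    simp [tenO, tenO', onE_zero, onE_one, onE_two, Derivation.leibniz, pdS_YS, pdS_Y1S, pdS_HS,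
      pdS_H1S, pdS_cscS, pdS_cotS, pdS_two]
  · ring
  · linear_combination (2 * ((d.l : HypS) * (d.l + 1) - 2) * cscS 0 * d.nuS * cscS 1 * d.HS
      * d.YS) * ha
  · linear_combination (-2 * ((d.l : HypS) * (d.l + 1) - 2) * cscS 0 * d.HS * d.Y1S) * ha
  · linear_combination (-16 * cotS 0 * d.HS * cscS 1 * d.nuS * (d.Y1S - cotS 1 * d.YS)) * ha
  · linear_combination (-8 * cotS 0 * d.HS * (d.l * (d.l + 1) * d.YS
      + 2 * (d.nuS ^ 2 * cscS 1 ^ 2 * d.YS + cotS 1 * d.Y1S))) * ha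
  · linear_combination (16 * cotS 0 * d.HS * cscS 1 * d.nuS * (d.Y1S - cotS 1 * d.YS)) * ha

end HarmonicData

namespace HarmonicData

variable (d : HarmonicData)

lemma rep_F : RepO1 d.F (fun i => d.nV • d.vecO (sinS 0 ^ d.l) i) := by
  have hF : Lift (fun z => Real.sin (z 0) ^ d.l • d.Y (z 1) (z 2)) (sinS 0 ^ d.l * d.YS) :=
    fun u => by
      rw [map_mul, map_pow, ← d.lift_YS u, ev_sinS]
      simp only [Complex.real_smul, Complex.ofReal_pow]
  exact ((d.rep_cross hF rfl fun i hi => by rw [pdS_sin_pow, if_neg hi]).const_mul d.nV).congr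
    (fun z _ i => by rw [F, Complex.real_smul]; rfl) fun _ => rfl

lemma deriv_sq_mul_H {z : Fin 3 → ℝ} (hz : z ∈ hyperDom) :
    deriv (fun s => Real.sin s ^ 2 • d.H s) (z 0)
      = ev (⟨z, hz⟩ : hyperChart.U) (2 * sinS 0 * cosS 0 * d.HS + sinS 0 ^ 2 * d.H1S) := by
  have hl : Lift (fun z : Fin 3 → ℝ => Real.sin (z 0) ^ 2 • d.H (z 0)) (sinS 0 ^ 2 * d.HS) :=
    fun u => by
      rw [map_mul, map_pow, ← d.lift_HS u, ev_sinS]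
      simp only [Complex.real_smul, Complex.ofReal_pow]
  have hC : DifferentiableAt ℝ d.C (Real.cos (z 0)) := (d.hasDerivAt_C (cos_mem hz)).differentiableAt
  have hd : DifferentiableAt ℝ (fun s => Real.sin s ^ 2 • d.H s) (z 0) := by
    unfold H
    have := hC.comp (z 0) Real.differentiable_cos.differentiableAt
    fun_prop
  have h := pd_comp_apply (z := z) 0 hd.hasDerivAt 0
  rw [if_pos rfl] at h
  have h2 := hl.ev_pdS 0 ⟨z, hz⟩
  rw [← h, ← h2, Derivation.leibniz, Derivation.leibniz_pow, pdS_HS, pdS_sinS]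
  simp
  ring

/-- The function `E` times `-(ℓ-1)(ℓ+2)/2`. -/
def eS : HypS := cscS 0 ^ d.l * sinS 0 * (2 * cotS 0 * d.HS + d.H1S)

lemma lift_E : Lift (fun z => d.E (z 0))
    ((-2 / (((d.l : ℂ) - 1) * (d.l + 2))) • d.eS) := fun u => by
  have h0 : (Real.sin (u.1 0) : ℂ) ≠ 0 := Complex.ofReal_ne_zero.2 (sin_pos0 u.2).ne'
  simp only [E]
  rw [d.deriv_sq_mul_H u.2, Complex.real_smul]
  simp only [eS, cotS, map_smul, map_mul, map_add, map_pow, smul_eq_mul, ev_sinS, ev_cosS, ev_cscS,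
    Fin.castSucc_zero, map_ofNat]
  push_cast [-Complex.ofReal_sin, -Complex.ofReal_cos]
  rw [pow_succ]
  field_simp

/-- The factor of `T4` relative to `tenO`. -/
def nT : ℂ := (Real.sqrt (((d.l : ℝ) - 1) * (d.l + 2) / (2 * (d.k : ℝ) * (d.k + 2))) : ℝ)
  * d.nV / (((d.l : ℂ) - 1) * (d.l + 2))

/-- The defining formula of `T4` multiplied by `(ℓ-1)(ℓ+2)`, which removes the denominator of `E`
and makes the comparison with `tenO` polynomial, valid for every `ℓ`. -/
lemma tenO_eq (a b : Fin 3) :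
    d.tenO a b = -(d.eS * (cov1O (d.vecO (sinS 0 ^ d.l)) a b + cov1O (d.vecO (sinS 0 ^ d.l)) b a))
      + cscS 0 ^ 2 * ((d.l - 1) * (d.l + 2) * d.C0 - (d.l - 1) * (cosS 0 * d.eS))
        * (d.vecO (sinS 0 ^ d.l) a * onE b (cosS 0) + d.vecO (sinS 0 ^ d.l) b * onE a (cosS 0)) := by
  have hs : sinS 0 * cscS 0 = 1 := sinS_mul_cscS 0
  have ht : cotS 0 = cosS 0 * cscS 0 := rfl
  have hp := pdS_sin_pow d.l
  have hH : d.HS = sinS 0 ^ d.l * d.C0 := rfl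
  have he : d.eS * (sinS 0 ^ d.l * cscS 0) = 2 * cotS 0 * d.HS + d.H1S := by
    have hp : cscS 0 ^ d.l * sinS 0 ^ d.l = 1 := by rw [← mul_pow, mul_comm, hs, one_pow]
    rw [eS]
    linear_combination (2 * cotS 0 * d.HS + d.H1S) * ((sinS 0 * cscS 0) * hp + hs)
  -- From here the power enters only through its derivative `ℓ cot χ · p` and the relations `hH` and
  -- `he`, so symbolic exponents do not reach the ring normalizer.
  generalize sinS 0 ^ d.l = p at *
  refine symm_ext (s := d.tenO) (t := fun a b => -(d.eS * (cov1O (d.vecO p) a b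
    + cov1O (d.vecO p) b a))
      + cscS 0 ^ 2 * ((d.l - 1) * (d.l + 2) * d.C0 - (d.l - 1) * (cosS 0 * d.eS))
        * (d.vecO p a * onE b (cosS 0) + d.vecO p b * onE a (cosS 0)))
    d.tenO_symm (fun a b => by ring) ?_ ?_ ?_ ?_ ?_ ?_ a b <;>
    simp [cov1O, onOm, Fin.sum_univ_three, tenO, vecO, onE_zero, onE_one, onE_two,
      Derivation.leibniz, pdS_YS, pdS_Y1S, pdS_cscS, pdS_cosS, hp]
  · linear_combination (-d.eS * (d.l - 1) * (d.nuS * cscS 1 * p * d.YS)) * ht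
      - (((d.l : HypS) - 1) * (d.l + 2) * cscS 0 * d.C0 - (d.l - 1) * cscS 0 * cosS 0 * d.eS)
        * (d.nuS * cscS 1 * p * d.YS) * hs
      + ((d.l : HypS) * (d.l + 1) - 2) * cscS 0 * d.nuS * cscS 1 * d.YS * hH
  · linear_combination (d.eS * (d.l - 1) * (p * d.Y1S)) * ht
      + (((d.l : HypS) - 1) * (d.l + 2) * cscS 0 * d.C0 - (d.l - 1) * cscS 0 * cosS 0 * d.eS)
        * (p * d.Y1S) * hs
      - ((d.l : HypS) * (d.l + 1) - 2) * cscS 0 * d.Y1S * hH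
  · linear_combination (-2 * d.nuS * cscS 1 * (d.Y1S - cotS 1 * d.YS)) * he
  · linear_combination (-(d.l * (d.l + 1) * d.YS
      + 2 * (d.nuS ^ 2 * cscS 1 ^ 2 * d.YS + cotS 1 * d.Y1S))) * he
  · linear_combination (-2 * d.nuS * cscS 1 * (d.Y1S - cotS 1 * d.YS)) * he

lemma A_ne (hl : 2 ≤ d.l) : ((d.l : ℂ) - 1) * (d.l + 2) ≠ 0 := by
  refine mul_ne_zero (sub_ne_zero.2 ?_) (by exact_mod_cast (by omega : d.l + 2 ≠ 0))
  exact_mod_cast (by omega : d.l ≠ 1)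

lemma rep_T4_of_two_le (hl : 2 ≤ d.l) : RepO2 d.T4 (fun a b => d.nT • d.tenO a b) := by
  have hA := d.A_ne hl
  have hg := lift_cosχ.gradO
  have hc : Lift (fun z : Fin 3 → ℝ => ((2 * (1 / Real.sin (z 0)) ^ 2 : ℝ) : ℂ))
      ((2 : ℂ) • cscS 0 ^ 2) := fun u => by
    simp
  have hcos : Lift (fun z : Fin 3 → ℝ => (((d.l : ℂ) - 1) / 2 * (Real.cos (z 0) : ℂ)))
      ((((d.l : ℂ) - 1) / 2) • cosS 0) := fun u => by simp
  have hC : Lift (fun z : Fin 3 → ℝ => d.C (Real.cos (z 0))) d.C0 := fun u => rfl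
  have h := (((RepO2.mul d.lift_E d.rep_F.symGrad).add (RepO2.mul hc (RepO2.mul
    ((hcos.mul d.lift_E).add hC) (((d.rep_F.tensor hg).add
      (RepO2.congr (hg.tensor d.rep_F) (fun _ _ _ _ => mul_comm _ _) fun a b => mul_comm _ _)).const_mul (1 / 2))))).const_mul
        (Real.sqrt (((d.l : ℝ) - 1) * (d.l + 2) / (2 * (d.k : ℝ) * (d.k + 2))) : ℝ))
  refine h.congr (fun z hz i j => ?_) fun a b => ?_
  · simp only [T4, Complex.real_smul]
    push_cast
    ring
  · rw [tenO_eq, nT]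
    simp only [symGradO, cov1O_smul]
    refine Sm.ext' fun u => ?_
    simp only [map_add, map_mul, map_smul, map_neg, map_sub, map_pow, map_natCast, map_one,
      map_ofNat, smul_eq_mul]
    generalize ((Real.sqrt _ : ℝ) : ℂ) = β
    have hr := inv_mul_cancel₀ hA
    rw [div_eq_mul_inv, div_eq_mul_inv]
    linear_combination (β * d.nV * ev u (cscS 0) ^ 2 * ev u d.C0
      * (ev u (d.vecO (sinS 0 ^ d.l) a) * ev u (onE b (cosS 0))
        + ev u (d.vecO (sinS 0 ^ d.l) b) * ev u (onE a (cosS 0)))) * hr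

end HarmonicData

/-! ### Sums of fields -/

namespace S3Chart

variable {c : S3Chart} {z : Fin 3 → ℝ}

lemma curl_add_const_mul {w w' : (Fin 3 → ℝ) → Fin 3 → ℂ} (hw : ContDiffOn ℝ ∞ w c.dom)
    (hw' : ContDiffOn ℝ ∞ w' c.dom) (hz : z ∈ c.dom) (r : ℂ) (i : Fin 3) :
    curl c.metric (fun z i => w z i + r * w' z i) z i
      = curl c.metric w z i + r * curl c.metric w' z i := by
  obtain ⟨v, hv⟩ := exists_rep1 (c := c) fun i => contDiffOn_pi.1 hw i
  obtain ⟨v', hv'⟩ := exists_rep1 (c := c) fun i => contDiffOn_pi.1 hw' i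
  have h1 := (hv.add (hv'.const_mul r)).curl.ev_eq ⟨z, hz⟩ i
  have h2 := (hv.curl.add (hv'.curl.const_mul r)).ev_eq ⟨z, hz⟩ i
  exact h1.trans (Eq.trans (by simp only [curlF_add, curlF_smul]) h2.symm)

lemma symCurl_add_const_mul {T T' : (Fin 3 → ℝ) → Fin 3 → Fin 3 → ℂ} (hT : ContDiffOn ℝ ∞ T c.dom)
    (hT' : ContDiffOn ℝ ∞ T' c.dom) (hz : z ∈ c.dom) (r : ℂ) (i j : Fin 3) :
    symCurl c.metric (fun z i j => T z i j + r * T' z i j) z i j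
      = symCurl c.metric T z i j + r * symCurl c.metric T' z i j := by
  obtain ⟨t, ht⟩ := exists_rep2 (c := c) (T := T) fun i j =>
    contDiffOn_pi.1 (contDiffOn_pi.1 hT i) j
  obtain ⟨t', ht'⟩ := exists_rep2 (c := c) (T := T') fun i j =>
    contDiffOn_pi.1 (contDiffOn_pi.1 hT' i) j
  have h1 := (ht.add (ht'.const_mul r)).symCurl.ev_eq ⟨z, hz⟩ i j
  have h2 := (ht.symCurl.add (ht'.symCurl.const_mul r)).ev_eq ⟨z, hz⟩ i j
  exact h1.trans (Eq.trans (by simp only [symCurlF_add, symCurlF_smul]) h2.symm)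

lemma symGrad_congr {w w' : (Fin 3 → ℝ) → Fin 3 → ℂ} (h : ∀ z ∈ c.dom, ∀ i, w z i = w' z i)
    (hz : z ∈ c.dom) (i j : Fin 3) : symGrad c.metric w z i j = symGrad c.metric w' z i j := by
  simp only [symGrad, cov1_congr h hz]

lemma symCurl_symGrad {w : (Fin 3 → ℝ) → Fin 3 → ℂ} (hw : ContDiffOn ℝ ∞ w c.dom)
    (hz : z ∈ c.dom) (i j : Fin 3) :
    symCurl c.metric (symGrad c.metric w) z i j = symGrad c.metric (curl c.metric w) z i j := by
  obtain ⟨v, hv⟩ := exists_rep1 (c := c) fun i => contDiffOn_pi.1 hw i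
  have h1 := hv.symGrad.symCurl.ev_eq ⟨z, hz⟩ i j
  have h2 := hv.curl.symGrad.ev_eq ⟨z, hz⟩ i j
  exact h1.trans (Eq.trans (by simp only [symCurlF_symGradF c.frameComm]) h2.symm)

/-- If `curl` exchanges two fields up to a factor `μ`, their sum and difference are eigenfields. -/
lemma curl_eigen {w w' : (Fin 3 → ℝ) → Fin 3 → ℂ} (hw : ContDiffOn ℝ ∞ w c.dom)
    (hw' : ContDiffOn ℝ ∞ w' c.dom) {μ : ℂ} {σ : ℝ} (hσ : σ = 1 ∨ σ = -1) (hz : z ∈ c.dom)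
    (h : ∀ i, curl c.metric w z i = μ * w' z i) (h' : ∀ i, curl c.metric w' z i = μ * w z i)
    (i : Fin 3) :
    curl c.metric (fun z i => w z i + σ • w' z i) z i = σ * μ * (w z i + σ • w' z i) := by
  simp only [Complex.real_smul]
  rw [curl_add_const_mul hw hw' hz, h, h']
  rcases hσ with rfl | rfl <;> push_cast <;> ring

/-- If `symCurl` exchanges two fields up to a factor `μ`, their sum and difference are
eigenfields. -/
lemma symCurl_eigen {T T' : (Fin 3 → ℝ) → Fin 3 → Fin 3 → ℂ} (hT : ContDiffOn ℝ ∞ T c.dom)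
    (hT' : ContDiffOn ℝ ∞ T' c.dom) {μ : ℂ} {σ : ℝ} (hσ : σ = 1 ∨ σ = -1) (hz : z ∈ c.dom)
    (h : ∀ i j, symCurl c.metric T z i j = μ * T' z i j)
    (h' : ∀ i j, symCurl c.metric T' z i j = μ * T z i j) (i j : Fin 3) :
    symCurl c.metric (fun z i j => T z i j + σ • T' z i j) z i j
      = σ * μ * (T z i j + σ • T' z i j) := by
  simp only [Complex.real_smul]
  rw [symCurl_add_const_mul hT hT' hz, h, h']
  rcases hσ with rfl | rfl <;> push_cast <;> ring

end S3Chart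

/-! ### Action of the operators on the harmonic classes -/

namespace HarmonicData

variable (d : HarmonicData) {z : Fin 3 → ℝ}

lemma sqrt_eq_zero_of_l_le_one (hl : d.l ≤ 1) :
    Real.sqrt (((d.l : ℝ) - 1) * (d.l + 2) / (2 * (d.k : ℝ) * (d.k + 2))) = 0 := by
  have : (d.l : ℝ) ≤ 1 := by exact_mod_cast hl
  refine Real.sqrt_eq_zero_of_nonpos (div_nonpos_of_nonpos_of_nonneg ?_ (by positivity))
  exact mul_nonpos_of_nonpos_of_nonneg (by linarith) (by positivity)

/-- For `ℓ ≤ 1` the radicand is not positive, the real square root is zero by convention, and both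
sides vanish; `E`, whose denominator is zero at `ℓ = 1`, plays no role then. -/
lemma rep_T4 : RepO2 d.T4 (fun a b => d.nT • d.tenO a b) := by
  rcases Nat.lt_or_ge d.l 2 with hl | hl
  · have h := d.sqrt_eq_zero_of_l_le_one (by omega)
    intro i j u
    simp [T4, nT, h]
  · exact d.rep_T4_of_two_le hl

lemma T5_eq (z : Fin 3 → ℝ) (i j : Fin 3) : d.T5 z i j = (d.rk / 2) * symCurl γ d.T4 z i j := by
  rw [T5, symCurl, rk]
  simp only [Complex.real_smul]
  have := d.k_ne
  push_cast
  field_simp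

lemma symCurl_T4 (z : Fin 3 → ℝ) (i j : Fin 3) :
    symCurl γ d.T4 z i j = 2 * (d.k + 1) * d.T5 z i j := by
  rw [T5_eq]
  linear_combination -symCurl γ d.T4 z i j * d.rk_mul

lemma rep_T5 : RepO2 d.T5 (fun a b => (d.rk / 2 * d.nT) • d.tenO' a b) :=
  (d.rep_T4.symCurl.const_mul (d.rk / 2)).congr (fun z _ i j => d.T5_eq z i j) fun a b => by
    rw [symCurlO_smul, symCurlO_tenO, smul_smul]

lemma symCurl_T5 (hz : z ∈ hyperDom) (i j : Fin 3) :
    symCurl γ d.T5 z i j = 2 * (d.k + 1) * d.T4 z i j := by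
  have h1 := d.rep_T5.symCurl.ev_eq ⟨z, hz⟩ i j
  have h2 := d.rep_T4.ev_eq ⟨z, hz⟩ i j
  have h3 := d.rk_mul
  simp only [symCurlO_smul, symCurlO_tenO', map_smul, map_mul, map_pow, map_add, map_natCast,
    map_one, map_ofNat, smul_eq_mul] at h1 h2
  rw [h1, h2]
  linear_combination (2 * (d.k + 1 : ℂ) * hlen z i * hlen z j * d.nT
    * ev ⟨z, hz⟩ (d.tenO i j)) * h3

/-- The norming factor of `V0`. -/
def nG : ℂ := ((1 / Real.sqrt ((d.k : ℝ) * (d.k + 2)) : ℝ) : ℂ)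

lemma rep1_V0 : hyperChart.Rep1 d.V0
    (fun a => d.nG • gradF hyperChart.e (d.HS * d.YS) a) :=
  (d.lift_S.grad.const_mul d.nG).congr (fun z _ i => by rw [V0, Complex.real_smul]; rfl)
    fun _ => rfl

lemma curl_V0 (hz : z ∈ hyperDom) (i : Fin 3) : curl γ d.V0 z i = 0 := by
  refine (d.rep1_V0.curl.ev_eq ⟨z, hz⟩ i).trans ?_
  simp [curlF_smul, curlF_gradF hyperChart.frameComm]

lemma rep2_cov1_V0 : hyperChart.Rep2 (cov1 γ d.V0)
    (fun a b => d.nG • hessF hyperChart.e (d.HS * d.YS) a b) :=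
  d.rep1_V0.cov1.congr (fun _ _ _ _ => rfl) fun a b => by rw [cov1F_smul]; rfl

lemma rep2_T0 : hyperChart.Rep2 d.T0
    (fun a b => ((1 / Real.sqrt 3 : ℝ) : ℂ) • deltaF (d.HS * d.YS) a b) :=
  ((S3Chart.rep2_delta (lift_S d)).const_mul _).congr (fun z _ i j => by
    rw [T0, Complex.real_smul, Complex.real_smul]; push_cast; ring) fun _ _ => rfl

lemma symCurl_T0 (hz : z ∈ hyperDom) (i j : Fin 3) : symCurl γ d.T0 z i j = 0 := by
  refine (d.rep2_T0.symCurl.ev_eq ⟨z, hz⟩ i j).trans ?_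
  simp [symCurlF_smul, symCurlF_deltaF]

/-- A Hessian plus a multiple of the metric is annihilated whatever the constants are, so neither
the norming factors nor degenerate `k` matter. -/
lemma symCurl_T3 (hz : z ∈ hyperDom) (i j : Fin 3) : symCurl γ d.T3 z i j = 0 := by
  have h := (d.rep2_cov1_V0.add
    (d.rep2_T0.const_mul ((Real.sqrt ((d.k : ℝ) * (d.k + 2)) / Real.sqrt 3 : ℝ) : ℂ))).const_mul
      ((Real.sqrt 3 / Real.sqrt (2 * ((d.k : ℝ) - 1) * (d.k + 3)) : ℝ) : ℂ)
  have h' := h.congr (T' := d.T3) (fun z hz i j => by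
    rw [T3, Complex.real_smul, Complex.real_smul]) fun _ _ => rfl
  refine (h'.symCurl.ev_eq ⟨z, hz⟩ i j).trans ?_
  simp [symCurlF_smul, symCurlF_add, symCurlF_deltaF, symCurlF_hessF hyperChart.frameComm]

/-- The norming factor of `T1` and `T2`. -/
def nU : ℂ := ((2 / Real.sqrt (2 * ((d.k : ℝ) - 1) * (d.k + 3)) : ℝ) : ℂ)

lemma T1_eq : d.T1 = fun z i j => d.nU * symGrad γ d.V1 z i j := by
  funext z i j; rw [T1, Complex.real_smul]; rfl

lemma T2_eq : d.T2 = fun z i j => d.nU * symGrad γ d.V2 z i j := by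
  funext z i j; rw [T2, Complex.real_smul]; rfl

/-- Symmetrized gradients inherit the action of the curl, by symCurl symGrad = symGrad curl. -/
lemma symCurl_const_mul_symGrad {w w' : (Fin 3 → ℝ) → Fin 3 → ℂ} {v v' : Fin 3 → HypS}
    (hw : RepO1 w v) (hw' : RepO1 w' v') {r μ : ℂ}
    (h : ∀ z ∈ hyperDom, ∀ i, curl γ w z i = μ * w' z i) (hz : z ∈ hyperDom) (i j : Fin 3) :
    symCurl γ (fun z i j => r * symGrad γ w z i j) z i j = μ * (r * symGrad γ w' z i j) := by
  have h1 := S3Chart.symCurl_const_mul (c := hyperChart) hw.symGrad.contDiffOn hz r i j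
  have h2 := S3Chart.symCurl_symGrad (c := hyperChart) hw.contDiffOn hz i j
  have h3 := S3Chart.symGrad_congr (c := hyperChart) h hz i j
  have h4 := S3Chart.symGrad_const_mul (c := hyperChart) hw'.contDiffOn hz μ i j
  rw [h1, h2, h3, h4]
  ring

lemma symCurl_T1 (hz : z ∈ hyperDom) (i j : Fin 3) :
    symCurl γ d.T1 z i j = (d.k + 1) * d.T2 z i j := by
  rw [T1_eq, T2_eq]
  exact symCurl_const_mul_symGrad d.rep_V1 d.rep_V2 (fun z _ i => d.curl_V1 z i) hz i j

lemma symCurl_T2 (hz : z ∈ hyperDom) (i j : Fin 3) :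
    symCurl γ d.T2 z i j = (d.k + 1) * d.T1 z i j := by
  rw [T1_eq, T2_eq]
  exact symCurl_const_mul_symGrad d.rep_V2 d.rep_V1 (fun z hz i => d.curl_V2 hz i) hz i j

lemma rep_T1 : RepO2 d.T1 (fun a b => d.nU • symGradO (fun i => d.nV • d.vecO d.HS i) a b) := by
  rw [T1_eq]; exact d.rep_V1.symGrad.const_mul _

lemma rep_T2 : RepO2 d.T2
    (fun a b => d.nU • symGradO (fun i => (d.rk * d.nV) • curlO (d.vecO d.HS) i) a b) := by
  rw [T2_eq]; exact d.rep_V2.symGrad.const_mul _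

end HarmonicData

namespace HarmonicData

variable (d : HarmonicData) {z : Fin 3 → ℝ}

/-! ### The eigenfields do not vanish identically -/

/-- One polar angle serves for all `χ` and `φ`, since the exponential never vanishes. This lets `χ`
vary freely in `T12_eigen_ne`. -/
lemma exists_YS_ne : ∃ t ∈ Set.Ioo 0 Real.pi, ∀ u : hyperChart.U, u.1 1 = t → ev u d.YS ≠ 0 := by
  obtain ⟨t, ht, hΘ⟩ := d.Θ_ne
  refine ⟨t, ht, fun u hu => ?_⟩
  rw [← d.lift_YS u]
  simp only [Y, hu]
  exact mul_ne_zero (Complex.exp_ne_zero _) hΘ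

lemma exists_ne : ∃ u : hyperChart.U, ev u d.HS ≠ 0 ∧ ev u d.YS ≠ 0 := by
  obtain ⟨t, ht, hY⟩ := d.exists_YS_ne
  obtain ⟨x, hx, hC⟩ := d.C_ne
  have hz : ![Real.arccos x, t, 0] ∈ hyperDom :=
    ⟨⟨Real.arccos_pos.2 hx.2, lt_of_le_of_ne (Real.arccos_le_pi x) fun h =>
      hx.1.not_ge (Real.arccos_eq_pi.1 h)⟩, ht⟩
  refine ⟨⟨_, hz⟩, ?_, hY _ rfl⟩
  rw [← d.lift_HS ⟨_, hz⟩]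
  simp only [H, Matrix.cons_val_zero, Real.cos_arccos hx.1.le hx.2.le, Complex.real_smul]
  exact mul_ne_zero (Complex.ofReal_ne_zero.2 (pow_ne_zero _ (sin_pos0 hz).ne')) hC

lemma rk_ne : d.rk ≠ 0 := fun h => by simpa [h] using d.rk_mul

lemma nV_ne (hl : 1 ≤ d.l) : d.nV ≠ 0 := by
  have : (0 : ℝ) < d.l := by exact_mod_cast hl
  exact Complex.ofReal_ne_zero.2 (by positivity)

lemma nU_ne (hk : 2 ≤ d.k) : d.nU ≠ 0 := by
  have : (2 : ℝ) ≤ d.k := by exact_mod_cast hk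
  have : 0 < 2 * ((d.k : ℝ) - 1) * (d.k + 3) := mul_pos (by linarith) (by linarith)
  exact Complex.ofReal_ne_zero.2 (by positivity)

lemma nT_ne (hl : 2 ≤ d.l) : d.nT ≠ 0 := by
  have h1 : (2 : ℝ) ≤ d.l := by exact_mod_cast hl
  have h2 : (2 : ℝ) ≤ d.k := by exact_mod_cast hl.trans d.l_le_k
  have : 0 < ((d.l : ℝ) - 1) * (d.l + 2) := mul_pos (by linarith) (by linarith)
  exact div_ne_zero (mul_ne_zero (Complex.ofReal_ne_zero.2 (by positivity))
    (d.nV_ne (by omega))) (d.A_ne hl)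

lemma ev_cscS_ne (u : hyperChart.U) : ev u (cscS 0) ≠ 0 := fun h => by
  have := congrArg (ev u) (sinS_mul_cscS 0)
  simp only [map_mul, h, mul_zero, map_one] at this
  exact zero_ne_one this

lemma Λ_ne (hl : 1 ≤ d.l) : (d.l : ℂ) * (d.l + 1) ≠ 0 :=
  mul_ne_zero (by exact_mod_cast (by omega : d.l ≠ 0)) (Nat.cast_add_one_ne_zero _)

/-- `V1` has no `χ` component, while that of `V2` is a nonzero multiple of `ℓ(ℓ+1) csc χ · H Y`; no
cancellation is possible. -/
lemma V_eigen_ne (hl : 1 ≤ d.l) {σ : ℝ} (hσ : σ ≠ 0) :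
    ∃ z ∈ hyperDom, ∃ i, d.V1 z i + σ • d.V2 z i ≠ 0 := by
  obtain ⟨u, hH, hY⟩ := d.exists_ne
  refine ⟨u, u.2, 0, ?_⟩
  have hσ' : (σ : ℂ) ≠ 0 := Complex.ofReal_ne_zero.2 hσ
  rw [d.rep_V1.ev_eq, d.rep_V2.ev_eq, curlO_vecO]
  have h0 : Complex.sin (u.1 0) ≠ 0 := by
    exact_mod_cast (sin_pos0 u.2).ne'
  simp [vecO, hlen, hσ', hH, hY, d.rk_ne, d.nV_ne hl, d.Λ_ne hl, h0]

/-- The `χχ` component of `T4` is zero, and that of `T5` is a nonzero multiple of `csc² χ · H Y`,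
with factor `(ℓ-1)ℓ(ℓ+1)(ℓ+2)`. -/
lemma T45_eigen_ne (hl : 2 ≤ d.l) {σ : ℝ} (hσ : σ ≠ 0) :
    ∃ z ∈ hyperDom, ∃ i j, d.T4 z i j + σ • d.T5 z i j ≠ 0 := by
  obtain ⟨u, hH, hY⟩ := d.exists_ne
  refine ⟨u, u.2, 0, 0, ?_⟩
  have hσ' : (σ : ℂ) ≠ 0 := Complex.ofReal_ne_zero.2 hσ
  have hA := d.A_ne hl
  have hA' : (d.l : ℂ) * (d.l + 1) - 2 ≠ 0 := by
    rwa [show (d.l : ℂ) * (d.l + 1) - 2 = (d.l - 1) * (d.l + 2) by ring]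
  rw [d.rep_T4.ev_eq, d.rep_T5.ev_eq]
  have h0 : Complex.sin (u.1 0) ≠ 0 := by
    exact_mod_cast (sin_pos0 u.2).ne'
  have h2 : ev u (2 : HypS) = 2 := map_ofNat _ 2
  simp [tenO, tenO', hlen, hσ', hH, hY, d.rk_ne, d.nT_ne hl, d.Λ_ne (by omega : 1 ≤ d.l), hA', h0,
    h2]

/-- The equation `H' = cot χ H` means that `H` is a multiple of `sin χ`, which solves the radial
equation only if `k(k+2) = 3`. In the algebra: substitution gives a relation in `1` and `cot² χ`
times `H`. Differentiating it twice modulo `H' = cot χ H` isolates `(ℓ(ℓ+1) - 2) H = 0`, and the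
remainder is `(3 - k(k+2)) H = 0`. -/
lemma H1S_ne (hk : 2 ≤ d.k) : d.H1S - cotS 0 * d.HS ≠ 0 := fun h => by
  have ha := cscS_sq 0
  have hs : sinS 0 * cscS 0 = 1 := sinS_mul_cscS 0
  have h1 := congrArg (pdS 0) h
  simp [Derivation.leibniz, pdS_H1S, pdS_HS, pdS_cotS] at h1
  have h2 : ((d.l : HypS) * (d.l + 1) + 1 - d.k * (d.k + 2)) * d.HS
      + ((d.l : HypS) * (d.l + 1) - 2) * cotS 0 ^ 2 * d.HS = 0 := by
    linear_combination h1 + 3 * cotS 0 * h - d.l * (d.l + 1) * d.HS * ha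
  have h3 := congrArg (pdS 0) h2
  simp only [Derivation.leibniz, pdS_HS, pdS_cotS, map_add, map_sub, Derivation.leibniz_pow,
    Derivation.map_natCast, pdS_two, Derivation.map_one_eq_zero, smul_eq_mul, nsmul_eq_mul, if_true,
    Fin.castSucc_zero, map_zero] at h3
  have h4 : 2 * ((d.l : HypS) * (d.l + 1) - 2) * cotS 0 * d.HS = 0 := by
    push_cast at h3
    linear_combination -sinS 0 ^ 2 * (h3 - cotS 0 * h2 - ((d.l : HypS) * (d.l + 1) + 1
        - d.k * (d.k + 2) + ((d.l : HypS) * (d.l + 1) - 2) * cotS 0 ^ 2) * h)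
      + 2 * ((d.l : HypS) * (d.l + 1) - 2) * cotS 0 * d.HS
        * (sinS 0 ^ 2 * ha - (sinS 0 * cscS 0 + 1) * hs)
  have h5 := congrArg (pdS 0) h4
  simp only [Derivation.leibniz, pdS_HS, pdS_cotS, map_add, map_sub,
    Derivation.map_natCast, pdS_two, Derivation.map_one_eq_zero, smul_eq_mul, if_true,
    Fin.castSucc_zero, map_zero] at h5
  have h6 : 2 * ((d.l : HypS) * (d.l + 1) - 2) * d.HS = 0 := by
    linear_combination -h5 + 2 * ((d.l : HypS) * (d.l + 1) - 2) * cotS 0 * h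
  have h7 : (2 : ℂ) • ((3 - (d.k : HypS) * (d.k + 2)) * d.HS) = 0 := by
    rw [two_smul]
    linear_combination 2 * h2 - (1 + cotS 0 ^ 2) * h6
  obtain ⟨u, hu, -⟩ := d.exists_ne
  have h8 := congrArg (ev u) h7
  simp only [map_smul, map_mul, map_sub, map_add, map_natCast, map_ofNat, map_zero, smul_eq_mul,
    mul_eq_zero, hu, two_ne_zero, false_or, or_false, sub_eq_zero] at h8
  have h9 : 3 = d.k * (d.k + 2) := by exact_mod_cast h8
  nlinarith

lemma T12_eigen_ne (hl : 1 ≤ d.l) (hk : 2 ≤ d.k) {σ : ℝ} (hσ : σ ≠ 0) :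
    ∃ z ∈ hyperDom, ∃ i j, d.T1 z i j + σ • d.T2 z i j ≠ 0 := by
  by_contra! h
  have hσ' : (σ : ℂ) ≠ 0 := Complex.ofReal_ne_zero.2 hσ
  obtain ⟨t, ht, hY⟩ := d.exists_YS_ne
  refine d.H1S_ne hk (Sm.ext' fun u => ?_)
  have hz : ![u.1 0, t, 0] ∈ hyperDom := ⟨u.2.1, ht⟩
  have h1 := h _ hz 0 0
  -- This function depends on `χ` only, so `ϑ` may be moved to the angle where `Y` does not vanish.
  -- There the `χχ` component of `T2` is proportional to `csc χ (H' - cot χ H) Y`, and that of `T1`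
  -- is zero.
  have h2 : ev u (d.H1S - cotS 0 * d.HS) = ev ⟨_, hz⟩ (d.H1S - cotS 0 * d.HS) := by
    rw [H1S_eq]
    simp [HS, cotS]
  have hY' := hY ⟨_, hz⟩ rfl
  have hn : d.nU * (d.rk * d.nV) * (d.l * (d.l + 1)) * ev ⟨_, hz⟩ (cscS 0)
      * ev ⟨_, hz⟩ d.YS * σ ≠ 0 :=
    mul_ne_zero (mul_ne_zero (mul_ne_zero (mul_ne_zero (mul_ne_zero (d.nU_ne hk)
      (mul_ne_zero d.rk_ne (d.nV_ne hl))) (d.Λ_ne hl)) (ev_cscS_ne _)) hY') hσ'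
  have h3 := d.rep_T1.ev_eq ⟨_, hz⟩ 0 0
  have h4 := d.rep_T2.ev_eq ⟨_, hz⟩ 0 0
  simp only at h3 h4
  rw [h3, h4] at h1
  rw [h2, map_zero]
  refine (mul_eq_zero.1 (Eq.trans ?_ h1)).resolve_left (neg_ne_zero.2 hn)
  simp only [symGradO_smul]
  simp only [symGradO, cov1O, onOm, Fin.sum_univ_three, curlO_vecO]
  simp [vecO, hlen, onE_zero, Derivation.leibniz, pdS_HS, pdS_YS, pdS_cscS]
  ring

end HarmonicData

end SchwKY

end

/-! ### Assembly of the results -/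

theorem mainTheorem1 (M : ℝ) :
    -- components of `Z[h]` for an arbitrary symmetric tensor, in every chart of the sphere
    (∀ (c : S3Chart) (h : (Idx5 → ℝ) → Idx5 → Idx5 → ℂ), ContDiffOn ℝ ∞ h (region M c) →
      (∀ x ∈ region M c, ∀ μ ν, h x μ ν = h x ν μ) →
      ∀ x ∈ region M c, ∀ μ ν, Zop M c h x μ ν =
        blocks (fun _ _ => 0)
          (fun a i => curl c.metric
            (fun z l => h (Sum.elim (yOf x) z) (Sum.inl a) (Sum.inr l)) (zOf x) i)
          (fun i j => symCurl c.metric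
            (fun z k l => h (Sum.elim (yOf x) z) (Sum.inr k) (Sum.inr l)) (zOf x) i j) μ ν) ∧
    -- on covectors of the sphere the operator is `⋆d`
    (∀ (c : S3Chart) (w : (Fin 3 → ℝ) → Fin 3 → ℂ), ContDiffOn ℝ ∞ w c.dom →
      ∀ z ∈ c.dom, ∀ i, curl c.metric w z i = hodge c.metric (extD w) z i) ∧
    -- scalar pieces are annihilated
    (∀ (c : S3Chart) (p : Pieces (Fin 3)), p.Admissible M c →
      ∀ x ∈ region M c, ∀ μ ν, Zop M c (p.scalarPart.toTensor c) x μ ν = 0) ∧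
    -- the image of a decomposed tensor is decomposed, with no scalar pieces
    (∀ (c : S3Chart) (p : Pieces (Fin 3)), p.Admissible M c →
      (p.image c).Admissible M c ∧
      ∀ x ∈ region M c, ∀ μ ν,
        Zop M c (p.toTensor c) x μ ν = (p.image c).toTensor c x μ ν) ∧
    -- every decomposition of the image over the whole sphere is this one
    (∀ p q : Pieces (Fin 4), p.GlobAdmissible M → q.GlobAdmissible M →
      (∀ c : S3Chart, ∀ x ∈ region M c, ∀ μ ν,
        (q.pull c).toTensor c x μ ν = Zop M c ((p.pull c).toTensor c) x μ ν) →
      ∀ c : S3Chart, ∀ y ∈ regionY M, ∀ z ∈ c.dom,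
        (∀ a b, (q.pull c).ab y z a b = 0) ∧
        (∀ a i, grad (fun z => (q.pull c).sa y z a) z i = 0) ∧
        (q.pull c).sL y z = 0 ∧
        (∀ i j, Lop c.metric ((q.pull c).sT y) z i j = 0) ∧
        (∀ a i, (q.pull c).va y z a i = curl c.metric (fun z => (p.pull c).va y z a) z i) ∧
        (∀ i j, symGrad c.metric ((q.pull c).vi y) z i j =
          symGrad c.metric (curl c.metric ((p.pull c).vi y)) z i j) ∧
        (∀ i j, (q.pull c).tij y z i j = symCurl c.metric ((p.pull c).tij y) z i j)) ∧
    -- scalar modes are annihilated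
    (∀ (c : S3Chart) (S : (Fin 3 → ℝ) → ℂ) (ev : ℝ), ev ≠ 0 → ContDiffOn ℝ ∞ S c.dom →
      (∀ z ∈ c.dom, lap c.metric S z + (ev ^ 2) • S z = 0) →
      ∀ (fab : (Fin 2 → ℝ) → Fin 2 → Fin 2 → ℂ) (fa : (Fin 2 → ℝ) → Fin 2 → ℂ)
        (HL HT : (Fin 2 → ℝ) → ℂ),
      ContDiffOn ℝ ∞ fab (regionY M) → ContDiffOn ℝ ∞ fa (regionY M) →
      ContDiffOn ℝ ∞ HL (regionY M) → ContDiffOn ℝ ∞ HT (regionY M) →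
      (∀ y ∈ regionY M, ∀ a b, fab y a b = fab y b a) →
      ∀ x ∈ region M c, ∀ μ ν, Zop M c (scalarMode c ev S fab fa HL HT) x μ ν = 0) ∧
    -- vector modes
    (∀ (c : S3Chart) (V : (Fin 3 → ℝ) → Fin 3 → ℂ) (ev : ℝ), ev ≠ 0 → ContDiffOn ℝ ∞ V c.dom →
      (∀ z ∈ c.dom, div1 c.metric V z = 0) →
      ∀ (fa : (Fin 2 → ℝ) → Fin 2 → ℂ) (HT : (Fin 2 → ℝ) → ℂ),
      ContDiffOn ℝ ∞ fa (regionY M) → ContDiffOn ℝ ∞ HT (regionY M) →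
      ∀ q : Pieces (Fin 3), q = Pieces.ofVT
        (fun y z a i => y 1 • (fa y a * curl c.metric V z i))
        (fun y z i => (-(y 1 ^ 2 / ev)) • (HT y * curl c.metric V z i)) (fun _ _ _ _ => 0) →
      q.Admissible M c ∧
      ∀ x ∈ region M c, ∀ μ ν,
        Zop M c (vectorMode c ev V fa HT) x μ ν = q.toTensor c x μ ν) ∧
    -- tensor modes
    (∀ (c : S3Chart) (T : (Fin 3 → ℝ) → Fin 3 → Fin 3 → ℂ), ContDiffOn ℝ ∞ T c.dom →
      (∀ z ∈ c.dom, (∀ i j, T z i j = T z j i) ∧ (∀ j, div2 c.metric T z j = 0) ∧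
        trace2 c.metric T z = 0) →
      ∀ HT : (Fin 2 → ℝ) → ℂ, ContDiffOn ℝ ∞ HT (regionY M) →
      ∀ q : Pieces (Fin 3), q = Pieces.ofVT (fun _ _ _ _ => 0) (fun _ _ _ => 0)
        (fun y z i j => (2 * y 1 ^ 2) • (HT y * symCurl c.metric T z i j)) →
      q.Admissible M c ∧
      ∀ x ∈ region M c, ∀ μ ν,
        Zop M c (tensorMode T HT) x μ ν = q.toTensor c x μ ν) ∧
    -- the classes of vector and tensor harmonics
    (∀ d : HarmonicData, ∀ z ∈ hyperDom,
      (∀ i, curl γ d.V0 z i = 0) ∧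
      (∀ i, curl γ d.V1 z i = ((d.k : ℂ) + 1) * d.V2 z i) ∧
      (∀ i, curl γ d.V2 z i = ((d.k : ℂ) + 1) * d.V1 z i) ∧
      (∀ i j, symCurl γ d.T0 z i j = 0) ∧
      (∀ i j, symCurl γ d.T1 z i j = ((d.k : ℂ) + 1) * d.T2 z i j) ∧
      (∀ i j, symCurl γ d.T2 z i j = ((d.k : ℂ) + 1) * d.T1 z i j) ∧
      (∀ i j, symCurl γ d.T3 z i j = 0) ∧
      (∀ i j, symCurl γ d.T4 z i j = 2 * ((d.k : ℂ) + 1) * d.T5 z i j) ∧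
      (∀ i j, symCurl γ d.T5 z i j = 2 * ((d.k : ℂ) + 1) * d.T4 z i j)) ∧
    -- the sums and differences are eigenvectors and eigentensors
    (∀ (d : HarmonicData) (σ : ℝ), σ = 1 ∨ σ = -1 →
      (∀ z ∈ hyperDom,
        (∀ i, curl γ (fun z i => d.V1 z i + σ • d.V2 z i) z i =
          (σ * (d.k + 1)) • (d.V1 z i + σ • d.V2 z i)) ∧
        (∀ i j, symCurl γ (fun z i j => d.T1 z i j + σ • d.T2 z i j) z i j =
          (σ * (d.k + 1)) • (d.T1 z i j + σ • d.T2 z i j)) ∧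
        (∀ i j, symCurl γ (fun z i j => d.T4 z i j + σ • d.T5 z i j) z i j =
          (σ * (2 * (d.k + 1))) • (d.T4 z i j + σ • d.T5 z i j))) ∧
      (1 ≤ d.l → ∃ z ∈ hyperDom, ∃ i, d.V1 z i + σ • d.V2 z i ≠ 0) ∧
      (1 ≤ d.l → 2 ≤ d.k → ∃ z ∈ hyperDom, ∃ i j, d.T1 z i j + σ • d.T2 z i j ≠ 0) ∧
      (2 ≤ d.l → ∃ z ∈ hyperDom, ∃ i j, d.T4 z i j + σ • d.T5 z i j ≠ 0)) := by
  refine ⟨fun c h hh hs x hx μ ν => Zop_eq hh hs hx μ ν,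
    fun c w _ z _ i => curl_eq_hodge w z i,
    fun c p hp x hx μ ν => Pieces.Zop_scalarPart hp hx μ ν,
    fun c p hp => ⟨hp.image, fun x hx μ ν => Pieces.Zop_toTensor hp hx μ ν⟩,
    fun p q hp hq h c y hy z hz => Pieces.unique_of_glob hp hq h c hy hz,
    fun c S ev hev hS hlap fab fa HL HT hfab hfa hHL hHT hsym x hx μ ν =>
      Zop_scalarMode hev hS hlap hfab hfa hHL hHT hsym hx μ ν,
    fun c V ev _ hV hdiv fa HT hfa hHT q hq => Zop_vectorMode hV hdiv hfa hHT hq,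
    fun c T hT hTT HT hHT q hq => Zop_tensorMode hT hTT hHT hq,
    fun d z hz => ⟨d.curl_V0 hz, d.curl_V1 z, d.curl_V2 hz, d.symCurl_T0 hz, d.symCurl_T1 hz,
      d.symCurl_T2 hz, d.symCurl_T3 hz, d.symCurl_T4 z, d.symCurl_T5 hz⟩,
    fun d σ hσ => ?_⟩
  have hσ' : σ ≠ 0 := by rcases hσ with rfl | rfl <;> norm_num
  refine ⟨fun z hz => ⟨fun i => ?_, fun i j => ?_, fun i j => ?_⟩, fun hl => d.V_eigen_ne hl hσ',
    fun hl hk => d.T12_eigen_ne hl hk hσ', fun hl => d.T45_eigen_ne hl hσ'⟩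
  · refine (S3Chart.curl_eigen (c := hyperChart) d.rep_V1.contDiffOn d.rep_V2.contDiffOn hσ hz
      (d.curl_V1 z) (d.curl_V2 hz) i).trans ?_
    simp only [Complex.real_smul]
    push_cast
    ring
  · refine (S3Chart.symCurl_eigen (c := hyperChart) d.rep_T1.contDiffOn d.rep_T2.contDiffOn hσ hz
      (d.symCurl_T1 hz) (d.symCurl_T2 hz) i j).trans ?_
    simp only [Complex.real_smul]
    push_cast
    ring
  · refine (S3Chart.symCurl_eigen (c := hyperChart) d.rep_T4.contDiffOn d.rep_T5.contDiffOn hσ hz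
      (d.symCurl_T4 z) (d.symCurl_T5 hz) i j).trans ?_
    simp only [Complex.real_smul]
    push_cast
    ring
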